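/- **Conventions.** All alphabets are finite. The quotient of a language $L\subseteq\Sigma^*$ by a word $w$ is $w^{-1}L=\{x\mid wx\in L\}$; the complexity $\kappa(L)$ is the number of distinct quotients of $L$ (equivalently, the number of states of a minimal DFA of $L$ over $\Sigma$). A DFA is minimal if all its states are reachable and no two distinct states accept the same language. The syntactic semigroup of $L$ is $\Sigma^+$ modulo the congruence $x\sim y\iff(\forall w,z\in\Sigma^*:\ wxz\in L\Leftrightarrow wyz\in L)$. The atoms of $L$ are the classes of the relation $x\sim y\iff(\forall w\in\Sigma^*:\ wx\in L\Leftrightarrow wy\in L)$ on $\Sigma^*$; each atom is $A_S=\bigcap_{K\in S}K\cap\bigcap_{K\notin S}(\Sigma^*\setminus K)$ for a unique set $S$ of quotients of $L$. A two-sided ideal is a non-empty language with $L=\Sigma^*L\Sigma^*$. A binary boolean function $\circ$ is proper if it is not a function of at most one of its variables; it acts on languages by $w\in K\circ L\iff(w\in K)\circ(w\in L)$. For $n\ge5$ let $\mathcal D_n=\mathcal D_n(a,b,c,d,e,f)$ be the DFA with states $Q_n=\{1,\dots,n\}$, initial state $1$, only final state $n$, in which the letters act by $a:(2,3,\dots,n-1)$,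 $b:(2,3)$ (cycles), $c:(n-1\to2)$, $d:(n-1\to1)$, $e:(\{1,\dots,n-1\}\to2)$, $f:(2\to n)$ (all other states being fixed), and let $L_n=L_n(a,b,c,d,e,f)$ be its language. If some of the arguments $a,\dots,f$ are permuted or replaced by "$-$", $L_n(\dots)$ denotes the dialect over the alphabet of the remaining letters in which the letter in each position plays the role of the letter originally there, and the roles marked "$-$" are removed. A stream $(L_n(\Sigma)\mid n\ge k)$ with a stream $L_n(\pi(\Sigma))$ of dialects ($\pi$ a permutation of $\Sigma$) is most complex in a class $C$ if, for all $m,n\ge k$, $L_n\in C$, $\kappa(L_n)=n$, and, in comparison with all languages of $C$ of complexity $n$ (and $m$), over any finite alphabet (a common one for binary operations), the following are maximal: the size of the syntactic semigroup, the complexity of each quotient (the quotients of any competitor can be matched bijectively with those of $L_n$ so that no quotient is more complex than its partner), the number of atoms, the complexity of each atom $A_S$ of $L_n$ (compared with atoms $A_T$ of a competitor $K$ with $|T|=|S|$ and $K\in T\Leftrightarrow L_n\in S$), and the complexities of the reverse $L_n^R$, the star $L_n^*$, the product $L_mL_n$, and $L_m(\Sigma)\circ L_n(\pi(\Sigma))$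 for every proper $\circ$. **Theorem (Two-Sided Ideals).** For each $n\ge5$ the DFA $\mathcal D_n(a,b,c,d,e,f)$ is minimal and $L_n(a,b,c,d,e,f)$ is a two-sided ideal of complexity $n$. The stream $(L_n(a,b,c,d,e,f)\mid n\ge5)$ with dialect stream $(L_n(b,a,c,d,e,f)\mid n\ge5)$ is most complex in the class of regular two-sided ideals. In particular, for all $m,n\ge5$ the following values are attained; the dialects used are again two-sided ideals of complexity $n$ (respectively $m$), and the values are upper bounds for all regular two-sided ideals of complexity $n$ (and $m$). 1. The syntactic semigroup of $L_n(a,b,c,d,e,f)$ has $n^{n-2}+(n-2)2^{n-2}+1$ elements. No regular two-sided ideal of complexity $n$ over an alphabet with fewer than six letters meets this bound. 2. All quotients of $L_n(a,-,-,d,e,f)$ have complexity $n$, except the quotient $\{a,d,e,f\}^*$ (corresponding to state $n$), which has complexity $1$. Every regular two-sided ideal $L\subseteq\Sigma^*$ of complexity $n$ has the quotient $\Sigma^*$, of complexity $1$, and all its quotients have complexity at most $n$. 3. $L_n(a,-,-,d,e,f)$ has $2^{n-2}+1$ atoms. 4. Each atom $A_S$ of $L_n(a,b,c,d,e,f)$,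 where $S\subseteq Q_n$ stands for the set of quotients accepted from the states in $S$, has complexity $$\kappa(A_S)=\begin{cases}n,&S=Q_n,\\ 2^{n-2}+n-1,&S=Q_n\setminus\{1\},\\ 1+\sum_{x=1}^{|S|}\sum_{y=1}^{n-|S|}\binom{n-2}{x-1}\binom{n-x-1}{y-1},&\text{otherwise.}\end{cases}$$ (As a bound for a general ideal $L$ of complexity $n$: $S$ is a set of quotients of $L$, $Q_n$ is the set of all quotients, and $1$ is the quotient $L$.) 5. The reverse of $L_n(a,-,-,d,e,f)$ has complexity $2^{n-2}+1$. 6. The star of $L_n(a,-,-,-,e,f)$ has complexity $n+1$. 7. The product $L_m(a,-,-,-,e,f)\,L_n(a,-,-,-,e,f)$ has complexity $m+n-1$. 8. For every proper binary boolean function $\circ$, the complexity of $L_m(a,b,-,d,e,f)\circ L_n(b,a,-,d,e,f)$ is maximal among all $K\circ L$ with $K,L$ regular two-sided ideals over a common alphabet, of complexities $m$ and $n$. In particular it is $mn$ for $\cap$ and for $\oplus$ (symmetric difference), $mn-(m-1)$ for $\setminus$, and $mn-(m+n-2)$ for $\cup$. If $m\ne n$, the same bounds are met by $L_m(a,b,-,d,e,f)$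 and $L_n(a,b,-,d,e,f)$. -/

import Mathlib

namespace MostComplex

/-! ### Complexity measures of a language -/

section Measures

variable {α : Type}

/-- The set of (left) quotients `w⁻¹L` of `L`. -/
def quotients (L : Language α) : Set (Language α) := Set.range L.leftQuotient

/-- The (quotient / state) complexity: the number of quotients. It is `⊤` exactly when there are
infinitely many quotients. -/
noncomputable def complexity (L : Language α) : ℕ∞ := (quotients L).encard

/-- The Myhill (syntactic) congruence on the set of non-empty words. -/
def syntacticSetoid (L : Language α) : Setoid {x : List α // x ≠ []} where
  r x y := ∀ w z : List α, w ++ x.1 ++ z ∈ L ↔ w ++ y.1 ++ z ∈ L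
  iseqv :=
    ⟨fun _ _ _ => Iff.rfl, fun h w z => (h w z).symm, fun h k w z => (h w z).trans (k w z)⟩

/-- The cardinality of the syntactic semigroup. -/
noncomputable def syntacticSize (L : Language α) : ℕ∞ := ENat.card (Quotient (syntacticSetoid L))

/-- The left congruence of `L` on words. -/
def leftSetoid (L : Language α) : Setoid (List α) where
  r x y := ∀ w : List α, w ++ x ∈ L ↔ w ++ y ∈ L
  iseqv := ⟨fun _ _ => Iff.rfl, fun h w => (h w).symm, fun h k w => (h w).trans (k w)⟩

/-- The atoms of `L`: the equivalence classes of its left congruence. -/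
def atoms (L : Language α) : Set (Language α) :=
  {A | ∃ x : List α, A = {y : List α | (leftSetoid L).r x y}}

/-- For a set `S` of quotients of `L`, the intersection `A_S` of the quotients in `S` and of the
complements of the quotients outside `S`. -/
def atomOf (L : Language α) (S : Set (Language α)) : Language α :=
  {x : List α | (∀ K ∈ S, x ∈ K) ∧ ∀ K ∈ quotients L \ S, x ∉ K}

/-- A binary boolean function is proper if it is not a function of one variable only
(in particular it is not constant). -/
def IsProper (f : Bool → Bool → Bool) : Prop :=
  (¬ ∃ g : Bool → Bool, ∀ x y, f x y = g x) ∧ ¬ ∃ g : Bool → Bool, ∀ x y, f x y = g y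

open Classical in
/-- The extension of a binary boolean function to languages. -/
def boolOp (f : Bool → Bool → Bool) (K L : Language α) : Language α :=
  {w : List α | f (decide (w ∈ K)) (decide (w ∈ L)) = true}

/-- A regular two-sided ideal: a non-empty regular language `L` with `L = Σ* L Σ*`. -/
def IsRegularTwoSidedIdeal (L : Language α) : Prop :=
  L.IsRegular ∧ L ≠ 0 ∧ L = (⊤ : Language α) * L * (⊤ : Language α)

/-- A DFA is minimal if every state is reachable and no two distinct states are equivalent. -/
def IsMinimalDFA {Q : Type} (M : DFA α Q) : Prop :=
  (∀ q, ∃ w, M.eval w = q) ∧ ∀ p q, M.acceptsFrom p = M.acceptsFrom q → p = q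

end Measures

/-! ### Dialects -/

section Dialects

variable {σ Γ : Type}

/-- A partial map `π` from `σ` to the alphabet `Γ` (`none` means undefined) that is a bijection
from its domain of definition onto `Γ`. -/
def IsPartialPermutation (π : σ → Option Γ) : Prop :=
  (∀ x y g, π x = some g → π y = some g → x = y) ∧ ∀ g, ∃ x, π x = some g

/-- The dialect of `L` given by `π`: the image of `L` under the substitution `x ↦ {π x}` if `π x`
is defined and `x ↦ ∅` otherwise. It is a language over the alphabet `Γ`. -/
def dialect (π : σ → Option Γ) (L : Language σ) : Language Γ :=
  {w : List Γ | ∃ u ∈ L, u.map π = w.map some}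

open Classical in
/-- The partial permutation that keeps the letters of `Γ` and is undefined on the others. -/
noncomputable def keep (Γ : Set σ) : σ → Option Γ :=
  fun x => if h : x ∈ Γ then some ⟨x, h⟩ else none

end Dialects

/-! ### Most complex streams -/

/-- `L` with the dialect stream `L'` is a most complex stream in the class `C`: its `n`-th language
belongs to `C`, has complexity `n`, and every complexity measure of it is maximal among the
languages of `C` of complexity `n`, over arbitrary finite alphabets (for binary operations, both
arguments have the same alphabet). -/
structure IsMostComplexStream (C : ∀ {α : Type}, Language α → Prop) {σ : Type} (k : ℕ)
    (L L' : ∀ n : ℕ, k ≤ n → Language σ) : Prop where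
  mem : ∀ (n : ℕ) (hn : k ≤ n), C (L n hn) ∧ complexity (L n hn) = n
  isDialect : ∃ π : σ → Option σ, IsPartialPermutation π ∧ ∀ (n : ℕ) (hn : k ≤ n), L' n hn = dialect π (L n hn)
  syntacticSemigroup : ∀ (n : ℕ) (hn : k ≤ n) (α : Type) [Finite α] (K : Language α),
    C K → complexity K = n → syntacticSize K ≤ syntacticSize (L n hn)
  /-- The quotients of any competitor can be matched with those of `L n` so that none of them is
  more complex than its partner. -/
  quotientComplexity : ∀ (n : ℕ) (hn : k ≤ n) (α : Type) [Finite α] (K : Language α),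
    C K → complexity K = n → ∃ φ : Language α → Language σ,
      Set.BijOn φ (quotients K) (quotients (L n hn)) ∧
      ∀ X ∈ quotients K, complexity X ≤ complexity (φ X)
  atomCount : ∀ (n : ℕ) (hn : k ≤ n) (α : Type) [Finite α] (K : Language α),
    C K → complexity K = n → (atoms K).encard ≤ (atoms (L n hn)).encard
  /-- Each atom `A_S` of `L n` is compared with the atoms `A_T` of any competitor for which `T` has
  as many elements as `S` and contains the initial quotient if and only if `S` does. -/
  atomComplexity : ∀ (n : ℕ) (hn : k ≤ n) (α : Type) [Finite α] (K : Language α),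
    C K → complexity K = n →
      ∀ S ⊆ quotients (L n hn), atomOf (L n hn) S ∈ atoms (L n hn) →
      ∀ T ⊆ quotients K, atomOf K T ∈ atoms K →
        T.encard = S.encard → (K ∈ T ↔ L n hn ∈ S) →
        complexity (atomOf K T) ≤ complexity (atomOf (L n hn) S)
  reverse : ∀ (n : ℕ) (hn : k ≤ n) (α : Type) [Finite α] (K : Language α),
    C K → complexity K = n → complexity K.reverse ≤ complexity (L n hn).reverse
  star : ∀ (n : ℕ) (hn : k ≤ n) (α : Type) [Finite α] (K : Language α),
    C K → complexity K = n → complexity (KStar.kstar K) ≤ complexity (KStar.kstar (L n hn))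
  product : ∀ (m : ℕ) (hm : k ≤ m) (n : ℕ) (hn : k ≤ n) (α : Type) [Finite α] (K K' : Language α),
    C K → complexity K = m → C K' → complexity K' = n →
      complexity (K * K') ≤ complexity (L m hm * L n hn)
  boolean : ∀ f, IsProper f → ∀ (m : ℕ) (hm : k ≤ m) (n : ℕ) (hn : k ≤ n) (α : Type) [Finite α] (K K' : Language α),
    C K → complexity K = m → C K' → complexity K' = n →
      complexity (boolOp f K K') ≤ complexity (boolOp f (L m hm) (L' n hn))

/-! ### The witness stream -/

/-- The six letters. -/
inductive Letter : Type
  | a | b | c | d | e | f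
  deriving DecidableEq

/-- The transformations of `{1, …, n}` induced by the letters:
`a : (2,3,…,n-1)`, `b : (2,3)`, `c : (n-1 → 2)`, `d : (n-1 → 1)`, `e : ({1,…,n-1} → 2)`,
`f : (2 → n)`. -/
def delta (n : ℕ) : Letter → ℕ → ℕ
  | .a, q => if 2 ≤ q ∧ q < n - 1 then q + 1 else if q = n - 1 then 2 else q
  | .b, q => if q = 2 then 3 else if q = 3 then 2 else q
  | .c, q => if q = n - 1 then 2 else q
  | .d, q => if q = n - 1 then 1 else q
  | .e, q => if q ≤ n - 1 then 2 else q
  | .f, q => if q = 2 then n else q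

theorem delta_mem {n : ℕ} (hn : 5 ≤ n) (x : Letter) {q : ℕ} (hq : q ∈ Set.Icc 1 n) :
    delta n x q ∈ Set.Icc 1 n := by
  obtain ⟨h1, h2⟩ := hq
  cases x <;> simp only [delta, Set.mem_Icc] <;> split_ifs <;> omega

/-- The DFA `D_n(a,b,c,d,e,f)` with states `1, …, n`, initial state `1` and final state `n`. -/
def witnessDFA (n : ℕ) (hn : 5 ≤ n) : DFA Letter (Set.Icc 1 n) where
  step q x := ⟨delta n x q.1, delta_mem hn x q.2⟩
  start := ⟨1, by simp only [Set.mem_Icc]; omega⟩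
  accept := {⟨n, by simp only [Set.mem_Icc]; omega⟩}

/-- The language `L_n(a,b,c,d,e,f)`. -/
def witness (n : ℕ) (hn : 5 ≤ n) : Language Letter := (witnessDFA n hn).accepts

/-- The dialect `L_n(b,a,c,d,e,f)`. -/
def witnessSwap (n : ℕ) (hn : 5 ≤ n) : Language Letter :=
  dialect (fun x => some (Equiv.swap Letter.a Letter.b x)) (witness n hn)

/-- The dialect of `L_n` over the alphabet `Γ` in which each letter of `Γ` plays its own role and
the other letters are removed; thus `witnessOn {a, d, e, f} n hn` is `L_n(a,-,-,d,e,f)`. -/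
def witnessOn (Γ : Set Letter) (n : ℕ) (hn : 5 ≤ n) : Language Γ :=
  dialect (keep Γ) (witness n hn)

/-- The same with the roles of `a` and `b` interchanged (used only if `a, b ∈ Γ`); thus
`witnessSwapOn {a, b, d, e, f} n hn` is `L_n(b,a,-,d,e,f)`. -/
def witnessSwapOn (Γ : Set Letter) (n : ℕ) (hn : 5 ≤ n) : Language Γ :=
  dialect (fun x => keep Γ (Equiv.swap Letter.a Letter.b x)) (witness n hn)

/-- The alphabet `{a, d, e, f}`. -/
def adef : Set Letter := {.a, .d, .e, .f}

/-- The alphabet `{a, e, f}`. -/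
def aef : Set Letter := {.a, .e, .f}

/-- The alphabet `{a, b, d, e, f}`. -/
def abdef : Set Letter := {.a, .b, .d, .e, .f}

/-! ### The bounds -/

/-- `n^{n-2} + (n-2) 2^{n-2} + 1`. -/
def semigroupBound (n : ℕ) : ℕ := n ^ (n - 2) + (n - 2) * 2 ^ (n - 2) + 1

open Classical in
/-- The bound for the complexity of the atom `A_S` of a language `L` of complexity `n`, where `S`
is a finite set of quotients of `L`. The initial state corresponds to the quotient `L`. -/
noncomputable def atomBound (n : ℕ) {α : Type} (L : Language α) (S : Set (Language α)) : ℕ :=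
  if S = quotients L then n
  else if S = quotients L \ {L} then 2 ^ (n - 2) + n - 1
  else 1 + ∑ x ∈ Finset.Icc 1 S.ncard, ∑ y ∈ Finset.Icc 1 (n - S.ncard),
    (n - 2).choose (x - 1) * (n - x - 1).choose (y - 1)

end MostComplex

open MostComplex

/-! Order the quotients of a two-sided ideal `L` of complexity n by inclusion. The left ideal
property makes `L` the least quotient. The right ideal property makes `⊤` the greatest one, and the
only one containing the empty word. Every word therefore acts on the quotients by a monotone map
fixing `⊤`, and the upper bounds come from this picture, applied to the automaton `quotientDFA` of
an arbitrary ideal.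

Syntactic semigroup: if no two quotients other than `L` and `⊤` are comparable, the monotone maps
fixing `⊤` lie in `flatMaps`, which has exactly the required size (`encard_flatMaps`). If a further
strict inclusion p < q exists, the constraint on the images of p and q roughly halves the number of
monotone maps, and summing over the image of the least element stays strictly below the bound
(`encard_monotone_lt`). A semigroup that meets the bound is thus all of `flatMaps`. Generating it
takes two permutations, three letters that collapse different kinds of pairs, and one letter that
moves the least element (`six_le_card_of_transformations`).

Atoms: the set of quotients containing a given word contains `⊤`, and is everything once it contains
`L`; this bounds the number of atoms, which is the complexity of the reverse (`encard_atoms`). A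
quotient of the atom of S is either empty or given by the disjoint images of S and of its
complement. Monotonicity normalises such a pair so that the second set contains the least element,
or, when S omits only `L`, so that the first set is upward closed. Counting normal forms gives the
bounds.

Operations: the star only adds the empty word. In a product, reading stays in a quotient of the
first factor times the second factor until the first factor is entered, and then restarts in the
second. A boolean operation has at most one quotient per pair of quotients, and pairs with an
absorbing `⊤` are merged.

For the witness, `a` and `f` provide words that send any single state outside {1, n} to n and fix
the others, so each set of states containing n but not 1 is the exact set accepting some word; this
gives minimality and separates atoms. The six letters generate all of `flatMaps`
(`transformations_dialectDFA_eq`), which makes the atom bounds sharp. For boolean operations the key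
is `JointlyTransitive`: the letters `a` and `b` act transitively on pairs of middle states, because
of the dialect or because m ≠ n. -/

namespace MostComplex

/-! ### General facts on languages, quotients and automata -/

section General

theorem encard_range_congr {A B C : Type*} {F : A → B} {G : A → C}
    (h : ∀ x y, F x = F y ↔ G x = G y) : (Set.range F).encard = (Set.range G).encard := by
  have hk : Setoid.ker F = Setoid.ker G := Setoid.ext fun x y => h x y
  calc (Set.range F).encard = ENat.card (Quotient (Setoid.ker F)) :=
        (ENat.card_congr (Setoid.quotientKerEquivRange F)).symm
    _ = ENat.card (Quotient (Setoid.ker G)) := by rw [hk]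
    _ = (Set.range G).encard := ENat.card_congr (Setoid.quotientKerEquivRange G)

theorem enatCard_quotient_eq {A B : Type*} (s : Setoid A) {F : A → B}
    (h : ∀ x y, s.r x y ↔ F x = F y) : ENat.card (Quotient s) = (Set.range F).encard := by
  have hk : s = Setoid.ker F := Setoid.ext fun x y => h x y
  subst hk
  exact ENat.card_congr (Setoid.quotientKerEquivRange F)

variable {α : Type} {Q : Type}

theorem mem_top_language (x : List α) : x ∈ (⊤ : Language α) := trivial

/-- `boolOp` is defined with classical decidability; arbitrary instances are allowed here so that
rewriting does not depend on which one occurs. -/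
theorem mem_boolOp {f : Bool → Bool → Bool} {K L : Language α} {w : List α} [Decidable (w ∈ K)]
    [Decidable (w ∈ L)] : w ∈ boolOp f K L ↔ f (decide (w ∈ K)) (decide (w ∈ L)) = true := by
  have : w ∈ boolOp f K L ↔
      f (@decide (w ∈ K) (Classical.propDecidable _)) (@decide (w ∈ L) (Classical.propDecidable _))
        = true := Iff.rfl
  rw [this]
  congr!

theorem self_mem_quotients (L : Language α) : L ∈ quotients L := ⟨[], rfl⟩

theorem leftQuotient_mem_quotients {L K : Language α} (hK : K ∈ quotients L) (w : List α) :
    K.leftQuotient w ∈ quotients L := by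
  obtain ⟨u, rfl⟩ := hK
  exact ⟨u ++ w, L.leftQuotient_append u w⟩

theorem complexity_top : complexity (⊤ : Language α) = 1 := by
  have : quotients (⊤ : Language α) = {⊤} := by
    ext K
    constructor
    · rintro ⟨w, rfl⟩; rfl
    · rintro rfl; exact self_mem_quotients _
  rw [complexity, this, Set.encard_singleton]

/-! ### Measures of a language in terms of a minimal automaton -/

theorem evalFrom_append (M : DFA α Q) (q : Q) (u v : List α) :
    M.evalFrom q (u ++ v) = M.evalFrom (M.evalFrom q u) v := M.evalFrom_of_append q u v

theorem leftQuotient_acceptsFrom (M : DFA α Q) (q : Q) (w : List α) :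
    (M.acceptsFrom q).leftQuotient w = M.acceptsFrom (M.evalFrom q w) := by
  ext x
  rw [Language.mem_leftQuotient, DFA.mem_acceptsFrom, DFA.mem_acceptsFrom, evalFrom_append]

theorem quotients_accepts {M : DFA α Q} (hr : ∀ q, ∃ w, M.eval w = q) :
    quotients M.accepts = Set.range M.acceptsFrom := by
  ext K
  constructor
  · rintro ⟨w, rfl⟩
    exact ⟨M.eval w, (Language.leftQuotient_accepts_apply M w).symm⟩
  · rintro ⟨q, rfl⟩
    obtain ⟨w, rfl⟩ := hr q
    exact ⟨w, Language.leftQuotient_accepts_apply M w⟩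

theorem IsMinimalDFA.injective {M : DFA α Q} (hM : IsMinimalDFA M) :
    Function.Injective M.acceptsFrom := fun p q h => hM.2 p q h

theorem IsMinimalDFA.complexity {M : DFA α Q} (hM : IsMinimalDFA M) :
    complexity M.accepts = ENat.card Q := by
  rw [MostComplex.complexity, quotients_accepts hM.1]
  exact (ENat.card_congr (Equiv.ofInjective _ hM.injective)).symm

/-- The transformations of the states of `M` induced by the non-empty words. -/
def transformations (M : DFA α Q) : Set (Q → Q) :=
  {g | ∃ w, w ≠ [] ∧ ∀ q, M.evalFrom q w = g q}

theorem transformations_eq_range (M : DFA α Q) :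
    transformations M = Set.range fun (w : {x : List α // x ≠ []}) q => M.evalFrom q w.1 := by
  ext g
  constructor
  · rintro ⟨w, hw, h⟩
    exact ⟨⟨w, hw⟩, funext h⟩
  · rintro ⟨w, rfl⟩
    exact ⟨w.1, w.2, fun _ => rfl⟩

theorem comp_mem_transformations {M : DFA α Q} {g h : Q → Q} (hg : g ∈ transformations M)
    (hh : h ∈ transformations M) : h ∘ g ∈ transformations M := by
  obtain ⟨u, hu, hu'⟩ := hg
  obtain ⟨v, hv, hv'⟩ := hh
  refine ⟨u ++ v, by simp [hu], fun q => ?_⟩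
  rw [evalFrom_append, hu', hv']
  rfl

theorem step_mem_transformations (M : DFA α Q) (x : α) :
    (fun q => M.step q x) ∈ transformations M := ⟨[x], by simp, fun _ => rfl⟩

theorem iterate_mem_transformations {M : DFA α Q} {g : Q → Q} (hg : g ∈ transformations M)
    (k : ℕ) : g^[k + 1] ∈ transformations M := by
  induction k with
  | zero => simpa using hg
  | succ k ih => rw [Function.iterate_succ]; exact comp_mem_transformations hg ih

/-- A permutation of a finite set has finite order, so its inverse is one of its powers. The
exponent is kept positive because only non-empty words count. -/
theorem exists_iterate_leftInverse [Finite Q] {g : Q → Q} (hinj : Function.Injective g) :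
    ∃ k : ℕ, Function.LeftInverse g^[k + 1] g := by
  have hb : Function.Bijective g := Finite.injective_iff_bijective.1 hinj
  let e : Equiv.Perm Q := Equiv.ofBijective g hb
  have hpos : 0 < orderOf e := (isOfFinOrder_of_finite e).orderOf_pos
  have hpow : ∀ j : ℕ, ∀ q, g^[j] q = (e ^ j) q := by
    intro j
    induction j with
    | zero => intro q; rfl
    | succ j ih =>
      intro q
      rw [Function.iterate_succ_apply', ih, pow_succ']
      rfl
  -- The inverse is the power with exponent 2 · order − 1; the factor 2 keeps the truncated
  -- subtraction harmless when the order is 1.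
  refine ⟨2 * orderOf e - 2, fun q => ?_⟩
  have h1 : g^[2 * orderOf e - 2 + 1] (g q) = g^[2 * orderOf e] q := by
    rw [← Function.iterate_succ_apply]
    congr 1
    omega
  rw [h1, hpow, mul_comm, pow_mul, pow_orderOf_eq_one]
  rfl

/-- The inverse of a transformation that is a permutation is induced by a word as well. -/
theorem exists_leftInverse_mem_transformations [Finite Q] {M : DFA α Q} {g : Q → Q}
    (hg : g ∈ transformations M) (hinj : Function.Injective g) :
    ∃ h ∈ transformations M, Function.LeftInverse h g ∧ Function.RightInverse h g := by
  obtain ⟨k, hk⟩ := exists_iterate_leftInverse hinj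
  refine ⟨_, iterate_mem_transformations hg k, hk, ?_⟩
  exact Function.LeftInverse.rightInverse_of_surjective hk (Finite.injective_iff_surjective.1 hinj)

/-- The left context w runs over all states by reachability, and the right context z separates
states by minimality, so the syntactic congruence is equality of induced transformations. -/
theorem IsMinimalDFA.syntacticSize {M : DFA α Q} (hM : IsMinimalDFA M) :
    syntacticSize M.accepts = (transformations M).encard := by
  rw [transformations_eq_range]
  refine enatCard_quotient_eq _ fun x y => ⟨fun h => ?_, fun h w z => ?_⟩
  · funext q
    obtain ⟨w, rfl⟩ := hM.1 q
    refine hM.2 _ _ (Language.ext fun z => ?_)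
    have := h w z
    rw [DFA.mem_accepts, DFA.mem_accepts, DFA.eval, evalFrom_append, evalFrom_append,
      evalFrom_append, evalFrom_append] at this
    exact this
  · have := congrFun h (M.eval w)
    rw [DFA.mem_accepts, DFA.mem_accepts, DFA.eval, evalFrom_append, evalFrom_append,
      evalFrom_append, evalFrom_append]
    exact iff_of_eq (congrArg (fun q => M.evalFrom q z ∈ M.accept) this)

theorem encard_atoms_eq {B : Type*} (L : Language α) {F : List α → B}
    (hF : ∀ x y, (leftSetoid L).r x y ↔ F x = F y) :
    (atoms L).encard = (Set.range F).encard := by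
  have h1 : atoms L = Set.range fun x : List α => ({y | (leftSetoid L).r x y} : Language α) := by
    ext A
    exact ⟨fun ⟨x, hx⟩ => ⟨x, hx.symm⟩, fun ⟨x, hx⟩ => ⟨x, hx.symm⟩⟩
  rw [h1]
  refine encard_range_congr fun x y => ?_
  rw [← hF]
  constructor
  · intro h
    have : y ∈ ({z | (leftSetoid L).r y z} : Language α) := (leftSetoid L).iseqv.refl y
    rw [← h] at this
    exact this
  · intro h
    ext z
    exact ⟨fun hz => (leftSetoid L).iseqv.trans ((leftSetoid L).iseqv.symm h) hz,
      fun hz => (leftSetoid L).iseqv.trans h hz⟩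

/-- Reversal turns left contexts into right continuations: two words lie in the same atom exactly
when their reverses give the same quotient of the reversed language. -/
theorem encard_atoms (L : Language α) : (atoms L).encard = complexity L.reverse := by
  have h2 : quotients L.reverse = Set.range fun x : List α => L.reverse.leftQuotient x.reverse := by
    ext A
    constructor
    · rintro ⟨w, rfl⟩; exact ⟨w.reverse, by simp⟩
    · rintro ⟨w, rfl⟩; exact ⟨w.reverse, rfl⟩
  rw [complexity, h2]
  refine encard_atoms_eq L fun x y => ⟨fun h => ?_, fun h w => ?_⟩
  · ext w
    simpa using h w.reverse
  · have : w.reverse ∈ L.reverse.leftQuotient x.reverse ↔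
      w.reverse ∈ L.reverse.leftQuotient y.reverse := by rw [h]
    simpa using this

/-- Since every state is reached, the left contexts see exactly the set of states from which a word
is accepted; this set is the name of the atom. -/
theorem encard_atoms_accepts {M : DFA α Q} (hr : ∀ q, ∃ w, M.eval w = q) :
    (atoms M.accepts).encard =
      (Set.range fun x : List α => {q | M.evalFrom q x ∈ M.accept}).encard := by
  refine encard_atoms_eq _ fun x y => ⟨fun h => ?_, fun h w => ?_⟩
  · ext q
    obtain ⟨w, rfl⟩ := hr q
    have := h w
    rw [DFA.mem_accepts, DFA.mem_accepts, DFA.eval, evalFrom_append, evalFrom_append] at this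
    exact this
  · rw [DFA.mem_accepts, DFA.mem_accepts, DFA.eval, evalFrom_append, evalFrom_append]
    exact Set.ext_iff.1 h (M.eval w)

/-- The words accepted from all states in `X` and from no state in `Y`. -/
def between (M : DFA α Q) (X Y : Set Q) : Language α :=
  {x | (∀ q ∈ X, x ∈ M.acceptsFrom q) ∧ ∀ q ∈ Y, x ∉ M.acceptsFrom q}

theorem mem_between {M : DFA α Q} {X Y : Set Q} {x : List α} :
    x ∈ between M X Y ↔
      (∀ q ∈ X, M.evalFrom q x ∈ M.accept) ∧ ∀ q ∈ Y, M.evalFrom q x ∉ M.accept := Iff.rfl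

/-- Reading a word pushes both conditions forward, so the quotients of an atom are described by
images of a set of states and of its complement. -/
theorem leftQuotient_between (M : DFA α Q) (X Y : Set Q) (w : List α) :
    (between M X Y).leftQuotient w =
      between M ((M.evalFrom · w) '' X) ((M.evalFrom · w) '' Y) := by
  ext x
  rw [Language.mem_leftQuotient, mem_between, mem_between]
  simp only [Set.forall_mem_image, evalFrom_append]

theorem IsMinimalDFA.atomOf {M : DFA α Q} (hM : IsMinimalDFA M) (S : Set Q) :
    atomOf M.accepts (M.acceptsFrom '' S) = between M S Sᶜ := by
  ext x
  have h : quotients M.accepts \ M.acceptsFrom '' S = M.acceptsFrom '' Sᶜ := by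
    rw [quotients_accepts hM.1, Set.image_compl_eq_range_sdiff_image hM.injective]
  show ((∀ K ∈ M.acceptsFrom '' S, x ∈ K) ∧ ∀ K ∈ quotients M.accepts \ M.acceptsFrom '' S, x ∉ K) ↔ _
  rw [h]
  simp only [Set.forall_mem_image]
  rfl

theorem complexity_between (M : DFA α Q) (X Y : Set Q) :
    complexity (between M X Y) = (Set.range fun w : List α =>
      between M ((M.evalFrom · w) '' X) ((M.evalFrom · w) '' Y)).encard := by
  rw [complexity, quotients]
  congr 2
  funext w
  exact leftQuotient_between M X Y w

/-- The automaton whose states are the quotients of `L`. -/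
def quotientDFA (L : Language α) : DFA α (quotients L) where
  step q x := ⟨q.1.leftQuotient [x], leftQuotient_mem_quotients q.2 [x]⟩
  start := ⟨L, self_mem_quotients L⟩
  accept := {q | [] ∈ q.1}

theorem quotientDFA_evalFrom (L : Language α) (q : quotients L) (w : List α) :
    ((quotientDFA L).evalFrom q w).1 = q.1.leftQuotient w := by
  induction w using List.reverseRecOn with
  | nil => rfl
  | append_singleton x a ih =>
    rw [DFA.evalFrom_append_singleton, Language.leftQuotient_append, ← ih]
    rfl

theorem quotientDFA_acceptsFrom (L : Language α) (q : quotients L) :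
    (quotientDFA L).acceptsFrom q = q.1 := by
  ext x
  have h : x ∈ (quotientDFA L).acceptsFrom q ↔ [] ∈ ((quotientDFA L).evalFrom q x).1 := Iff.rfl
  rw [h, quotientDFA_evalFrom, Language.mem_leftQuotient, List.append_nil]

theorem quotientDFA_accepts (L : Language α) : (quotientDFA L).accepts = L :=
  quotientDFA_acceptsFrom L ⟨L, self_mem_quotients L⟩

/-- This transfers the automaton description of the measures to an arbitrary language. -/
theorem isMinimalDFA_quotientDFA (L : Language α) : IsMinimalDFA (quotientDFA L) := by
  refine ⟨?_, fun p q h => ?_⟩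
  · rintro ⟨_, w, rfl⟩
    exact ⟨w, Subtype.ext (quotientDFA_evalFrom L _ w)⟩
  · rw [quotientDFA_acceptsFrom, quotientDFA_acceptsFrom] at h
    exact Subtype.ext h

/-! ### Two-sided ideals -/

theorem IsRegularTwoSidedIdeal.append_mem {L : Language α} (h : IsRegularTwoSidedIdeal L)
    {x : List α} (hx : x ∈ L) (u v : List α) : u ++ x ++ v ∈ L := by
  rw [h.2.2]
  exact Language.append_mem_mul (Language.append_mem_mul (mem_top_language u) hx)
    (mem_top_language v)

theorem isRegularTwoSidedIdeal_of_forall {L : Language α} (hr : L.IsRegular) {x : List α}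
    (hx : x ∈ L) (h : ∀ y ∈ L, ∀ u v, u ++ y ++ v ∈ L) : IsRegularTwoSidedIdeal L := by
  refine ⟨hr, ?_, ?_⟩
  · rintro rfl
    exact Language.notMem_zero x hx
  · ext y
    constructor
    · intro hy
      have := Language.append_mem_mul (Language.append_mem_mul (mem_top_language []) hy)
        (mem_top_language [])
      simpa using this
    · intro hy
      obtain ⟨z, hz, v, -, rfl⟩ := Language.mem_mul.1 hy
      obtain ⟨u, -, y, hy', rfl⟩ := Language.mem_mul.1 hz
      exact h y hy' u v

end General

end MostComplex

namespace MostComplex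

/-! ### Upper bounds for quotients, atoms and operations on ideals -/

section UpperBounds

variable {α : Type}

/-- The left ideal half of the hypothesis: `L` is the least quotient. -/
theorem IsRegularTwoSidedIdeal.le_quotient {L K : Language α} (h : IsRegularTwoSidedIdeal L)
    (hK : K ∈ quotients L) : L ≤ K := by
  obtain ⟨w, rfl⟩ := hK
  intro x hx
  have := h.append_mem hx w []
  rwa [List.append_nil] at this

/-- The right ideal half of the hypothesis, inherited by all quotients. -/
theorem IsRegularTwoSidedIdeal.append_right_mem {L K : Language α} (h : IsRegularTwoSidedIdeal L)
    (hK : K ∈ quotients L) {x : List α} (hx : x ∈ K) (y : List α) : x ++ y ∈ K := by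
  obtain ⟨w, rfl⟩ := hK
  have := h.append_mem hx [] y
  rw [List.nil_append, List.append_assoc] at this
  exact this

theorem IsRegularTwoSidedIdeal.eq_top {L K : Language α} (h : IsRegularTwoSidedIdeal L)
    (hK : K ∈ quotients L) (hx : [] ∈ K) : K = ⊤ := by
  ext x
  exact ⟨fun _ => mem_top_language x, fun _ => h.append_right_mem hK hx x⟩

theorem IsRegularTwoSidedIdeal.leftQuotient_eq_top {L K : Language α}
    (h : IsRegularTwoSidedIdeal L) (hK : K ∈ quotients L) {x : List α} (hx : x ∈ K) :
    K.leftQuotient x = ⊤ := by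
  refine h.eq_top (leftQuotient_mem_quotients hK x) ?_
  rw [Language.mem_leftQuotient, List.append_nil]
  exact hx

theorem IsRegularTwoSidedIdeal.exists_mem {L : Language α} (h : IsRegularTwoSidedIdeal L) :
    ∃ x, x ∈ L := by
  by_contra hne
  push Not at hne
  refine h.2.1 (Language.ext fun x => ?_)
  exact ⟨fun hx => absurd hx (hne x), fun hx => absurd hx (Language.notMem_zero x)⟩

theorem IsRegularTwoSidedIdeal.top_mem {L : Language α} (h : IsRegularTwoSidedIdeal L) :
    ⊤ ∈ quotients L := by
  obtain ⟨x, hx⟩ := h.exists_mem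
  exact ⟨x, h.leftQuotient_eq_top (self_mem_quotients L) hx⟩

theorem ne_top_of_complexity {L : Language α} {n : ℕ} (hn : 2 ≤ n) (hL : complexity L = n) :
    L ≠ ⊤ := by
  rintro rfl
  rw [complexity_top] at hL
  have : (1 : ℕ) = n := by exact_mod_cast hL
  omega

theorem IsRegularTwoSidedIdeal.nil_notMem {L : Language α} (h : IsRegularTwoSidedIdeal L)
    (hL : L ≠ ⊤) : [] ∉ L := fun hx => hL (h.eq_top (self_mem_quotients L) hx)

theorem complexity_quotient_le {L K : Language α} (hK : K ∈ quotients L) :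
    complexity K ≤ complexity L := by
  refine Set.encard_le_encard ?_
  rintro _ ⟨w, rfl⟩
  exact leftQuotient_mem_quotients hK w

theorem IsRegularTwoSidedIdeal.finite_quotients {L : Language α} (h : IsRegularTwoSidedIdeal L) :
    (quotients L).Finite := h.1.finite_range_leftQuotient

/-! ### Atoms and reversal -/

/-- Apart from the full set, such a set is t together with an arbitrary subset of the n − 2 elements
outside {b, t}. The same family serves for the upper bound on atoms and for the witness. -/
theorem encard_sets_top_bot {Q : Type*} {n : ℕ} (hQ : ENat.card Q = n) {b t : Q} (hbt : b ≠ t) :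
    {S : Set Q | t ∈ S ∧ (b ∈ S → S = Set.univ)}.encard = ((2 ^ (n - 2) + 1 : ℕ) : ℕ∞) := by
  classical
  have hfin : Finite Q := by
    rw [← ENat.card_lt_top, hQ]; exact ENat.natCast_lt_top n
  have hset : {S : Set Q | t ∈ S ∧ (b ∈ S → S = Set.univ)} =
      insert Set.univ (insert t '' (𝒫 ({b, t}ᶜ : Set Q))) := by
    ext S
    simp only [Set.mem_ofPred_eq, Set.mem_insert_iff, Set.mem_image, Set.mem_powerset_iff]
    constructor
    · rintro ⟨ht, hb⟩
      by_cases hbS : b ∈ S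
      · exact Or.inl (hb hbS)
      · refine Or.inr ⟨S \ {t}, ?_, ?_⟩
        · intro x hx
          simp only [Set.mem_compl_iff, Set.mem_insert_iff, Set.mem_singleton_iff, not_or]
          exact ⟨fun h => hbS (h ▸ hx.1), hx.2⟩
        · simp [ht]
    · rintro (rfl | ⟨S, hS, rfl⟩)
      · simp
      · refine ⟨Set.mem_insert _ _, fun hb => ?_⟩
        rcases hb with hb | hb
        · exact absurd hb hbt
        · exact absurd (Or.inl rfl) (hS hb)
  have hinj : Set.InjOn (insert t) (𝒫 ({b, t}ᶜ : Set Q)) := by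
    intro S hS T hT h
    have h1 : ∀ S ∈ 𝒫 ({b, t}ᶜ : Set Q), insert t S \ {t} = S := by
      intro S hS
      refine Set.insert_sdiff_self_of_notMem fun ht => hS ht (Or.inr rfl)
    rw [← h1 S hS, ← h1 T hT, h]
  have hcard : ({b, t}ᶜ : Set Q).ncard = n - 2 := by
    have : Nat.card Q = n := by
      rw [ENat.card_eq_coe_natCard] at hQ
      exact_mod_cast hQ
    rw [Set.ncard_compl, Set.ncard_pair hbt, this]
  rw [hset, Set.encard_insert_of_notMem, hinj.encard_image,
    ← (Set.toFinite (𝒫 ({b, t}ᶜ : Set Q))).cast_ncard_eq, Set.ncard_powerset, hcard]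
  · push_cast; rfl
  · rintro ⟨S, hS, hu⟩
    have : b ∈ insert t S := by rw [hu]; trivial
    rcases this with hb | hb
    · exact hbt hb
    · exact hS hb (Or.inl rfl)

/-- A word lies in `⊤`, and if it lies in `L` it lies in every quotient. -/
theorem IsRegularTwoSidedIdeal.encard_atoms_le {L : Language α} (h : IsRegularTwoSidedIdeal L)
    {n : ℕ} (hn : 2 ≤ n) (hL : complexity L = n) :
    (atoms L).encard ≤ ((2 ^ (n - 2) + 1 : ℕ) : ℕ∞) := by
  have hM := isMinimalDFA_quotientDFA L
  have hb : (⟨L, self_mem_quotients L⟩ : quotients L) ≠ ⟨⊤, h.top_mem⟩ := fun he =>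
    ne_top_of_complexity hn hL (Subtype.ext_iff.1 he)
  rw [← encard_sets_top_bot (Q := quotients L) hL hb]
  have := encard_atoms_accepts hM.1
  rw [quotientDFA_accepts] at this
  rw [this]
  refine Set.encard_le_encard ?_
  rintro _ ⟨x, rfl⟩
  have hmem : ∀ q : quotients L,
      (quotientDFA L).evalFrom q x ∈ (quotientDFA L).accept ↔ x ∈ q.1 := by
    intro q
    rw [← DFA.mem_acceptsFrom, quotientDFA_acceptsFrom]
  constructor
  · exact (hmem _).2 (mem_top_language x)
  · intro hx
    ext q
    refine ⟨fun _ => trivial, fun _ => (hmem q).2 ?_⟩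
    exact h.le_quotient q.2 ((hmem _).1 hx)

/-! ### Star -/

/-- A non-empty concatenation of words of an ideal begins with a word of the ideal. -/
theorem IsRegularTwoSidedIdeal.mem_kstar {L : Language α} (h : IsRegularTwoSidedIdeal L)
    {x : List α} : x ∈ KStar.kstar L ↔ x = [] ∨ x ∈ L := by
  constructor
  · rintro ⟨l, rfl, hl⟩
    cases l with
    | nil => exact Or.inl rfl
    | cons y l =>
      right
      have := h.append_mem (hl y (by simp)) [] l.flatten
      simpa using this
  · rintro (rfl | hx)
    · exact Language.nil_mem_kstar L
    · exact ⟨[x], by simp, by simpa using hx⟩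

theorem IsRegularTwoSidedIdeal.leftQuotient_kstar {L : Language α} (h : IsRegularTwoSidedIdeal L)
    {w : List α} (hw : w ≠ []) : (KStar.kstar L).leftQuotient w = L.leftQuotient w := by
  ext x
  rw [Language.mem_leftQuotient, h.mem_kstar, Language.mem_leftQuotient]
  simp [hw]

theorem IsRegularTwoSidedIdeal.quotients_kstar_subset {L : Language α}
    (h : IsRegularTwoSidedIdeal L) :
    quotients (KStar.kstar L) ⊆ insert (KStar.kstar L) (quotients L) := by
  rintro _ ⟨w, rfl⟩
  by_cases hw : w = []
  · subst hw; exact Or.inl rfl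
  · right
    rw [h.leftQuotient_kstar hw]
    exact ⟨w, rfl⟩

theorem IsRegularTwoSidedIdeal.complexity_kstar_le {L : Language α}
    (h : IsRegularTwoSidedIdeal L) {n : ℕ} (hL : complexity L = n) :
    complexity (KStar.kstar L) ≤ ((n + 1 : ℕ) : ℕ∞) := by
  calc _ ≤ (insert (KStar.kstar L) (quotients L)).encard :=
        Set.encard_le_encard h.quotients_kstar_subset
    _ ≤ (quotients L).encard + 1 := Set.encard_insert_le _ _
    _ = _ := by
      have : (quotients L).encard = n := hL
      rw [this]; rfl

/-- The word w makes `L` itself a quotient of the star, so no quotient of `L` is lost. The star is a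
new quotient: it contains the empty word, so as a quotient of `L` it would be `⊤`; then w would be
in `L`, and `w⁻¹L = L` would contain the empty word. -/
theorem IsRegularTwoSidedIdeal.complexity_kstar_eq {L : Language α}
    (h : IsRegularTwoSidedIdeal L) {n : ℕ} (hn : 2 ≤ n) (hL : complexity L = n) {w : List α}
    (hw : w ≠ []) (hwL : L.leftQuotient w = L) :
    complexity (KStar.kstar L) = ((n + 1 : ℕ) : ℕ∞) := by
  have hset : quotients (KStar.kstar L) = insert (KStar.kstar L) (quotients L) := by
    refine subset_antisymm h.quotients_kstar_subset ?_
    rintro _ (rfl | ⟨u, rfl⟩)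
    · exact self_mem_quotients _
    · refine ⟨w ++ u, ?_⟩
      rw [h.leftQuotient_kstar (by simp [hw]), Language.leftQuotient_append, hwL]
  have hnil := h.nil_notMem (ne_top_of_complexity hn hL)
  have hnot : KStar.kstar L ∉ quotients L := by
    intro hmem
    have htop := h.eq_top hmem (Language.nil_mem_kstar L)
    have h1 : w ∈ KStar.kstar L := by rw [htop]; trivial
    rcases h.mem_kstar.1 h1 with h2 | h2
    · exact hw h2
    · apply hnil
      rw [← hwL, Language.mem_leftQuotient, List.append_nil]
      exact h2
  have hL' : (quotients L).encard = n := hL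
  rw [complexity, hset, Set.encard_insert_of_notMem hnot, hL']
  rfl

/-! ### Product -/

/-- No prefix of w lies in the right ideal `K`, so in any factorisation the first factor extends
beyond w. -/
theorem IsRegularTwoSidedIdeal.leftQuotient_mul_of_notMem {K L : Language α}
    (hK : IsRegularTwoSidedIdeal K) {w : List α} (hw : w ∉ K) :
    (K * L).leftQuotient w = K.leftQuotient w * L := by
  ext x
  rw [Language.mem_leftQuotient, Language.mem_mul, Language.mem_mul]
  constructor
  · rintro ⟨u, hu, v, hv, he⟩
    rcases List.append_eq_append_iff.1 he with ⟨s, rfl, rfl⟩ | ⟨s, rfl, rfl⟩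
    · exact absurd (hK.append_right_mem (self_mem_quotients K) hu s) hw
    · exact ⟨s, hu, v, hv, rfl⟩
  · rintro ⟨u, hu, v, hv, rfl⟩
    exact ⟨w ++ u, hu, v, hv, by simp⟩

/-- When `K` has just been entered, a longer first factor gains nothing: its surplus is a prefix of
a word of `L`, which the left ideal `L` absorbs. -/
theorem IsRegularTwoSidedIdeal.leftQuotient_mul_of_first {K L : Language α}
    (hK : IsRegularTwoSidedIdeal K) (hL : IsRegularTwoSidedIdeal L) {w : List α} {a : α}
    (hw : w ∉ K) (hwa : w ++ [a] ∈ K) : (K * L).leftQuotient (w ++ [a]) = L := by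
  rw [Language.leftQuotient_append, hK.leftQuotient_mul_of_notMem hw]
  ext x
  rw [Language.mem_leftQuotient, Language.mem_mul]
  constructor
  · rintro ⟨u, hu, v, hv, he⟩
    cases u with
    | nil =>
      rw [Language.mem_leftQuotient, List.append_nil] at hu
      exact absurd hu hw
    | cons c u =>
      simp only [List.cons_append, List.nil_append, List.cons.injEq] at he
      rw [← he.2]
      have := hL.append_mem hv u []
      rwa [List.append_nil] at this
  · intro hx
    exact ⟨[a], hwa, x, hx, rfl⟩

theorem IsRegularTwoSidedIdeal.leftQuotient_mul_of_mem {K L : Language α}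
    (hK : IsRegularTwoSidedIdeal K) (hL : IsRegularTwoSidedIdeal L) {w : List α} (hw : w ∈ K) :
    (K * L).leftQuotient w ∈ quotients L := by
  induction w using List.reverseRecOn with
  | nil =>
    have hKtop := hK.eq_top (self_mem_quotients K) hw
    have : K * L = L := by
      ext x
      rw [Language.mem_mul]
      constructor
      · rintro ⟨u, -, v, hv, rfl⟩
        have := hL.append_mem hv u []
        rwa [List.append_nil] at this
      · intro hx
        exact ⟨[], hw, x, hx, rfl⟩
    rw [Language.leftQuotient_nil, this]
    exact self_mem_quotients L
  | append_singleton w a ih =>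
    by_cases hw' : w ∈ K
    · rw [Language.leftQuotient_append]
      exact leftQuotient_mem_quotients (ih hw') [a]
    · rw [hK.leftQuotient_mul_of_first hL hw' hw]
      exact self_mem_quotients L

theorem IsRegularTwoSidedIdeal.quotients_mul_subset {K L : Language α}
    (hK : IsRegularTwoSidedIdeal K) (hL : IsRegularTwoSidedIdeal L) :
    quotients (K * L) ⊆ (· * L) '' (quotients K \ {⊤}) ∪ quotients L := by
  rintro _ ⟨w, rfl⟩
  by_cases hw : w ∈ K
  · exact Or.inr (hK.leftQuotient_mul_of_mem hL hw)
  · refine Or.inl ⟨K.leftQuotient w, ⟨⟨w, rfl⟩, fun h => hw ?_⟩,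
      (hK.leftQuotient_mul_of_notMem hw).symm⟩
    have : [] ∈ K.leftQuotient w := by rw [Set.mem_singleton_iff.1 h]; trivial
    rwa [Language.mem_leftQuotient, List.append_nil] at this

theorem IsRegularTwoSidedIdeal.exists_first {K : Language α} (hK : IsRegularTwoSidedIdeal K)
    (hne : K ≠ ⊤) : ∃ w a, w ∉ K ∧ w ++ [a] ∈ K := by
  by_contra hcon
  push Not at hcon
  have : ∀ w, w ∉ K := by
    intro w
    induction w using List.reverseRecOn with
    | nil => exact hK.nil_notMem hne
    | append_singleton w a ih => exact hcon w a ih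
  obtain ⟨x, hx⟩ := hK.exists_mem
  exact this x hx

/-- The two families correspond to words outside and inside `K`; all quotients of `L` occur because
`K` is entered at some letter. -/
theorem IsRegularTwoSidedIdeal.quotients_mul {K L : Language α}
    (hK : IsRegularTwoSidedIdeal K) (hL : IsRegularTwoSidedIdeal L) (hne : K ≠ ⊤) :
    quotients (K * L) = (· * L) '' (quotients K \ {⊤}) ∪ quotients L := by
  refine subset_antisymm (hK.quotients_mul_subset hL) ?_
  rintro _ (⟨_, ⟨⟨w, rfl⟩, hw⟩, rfl⟩ | ⟨v, rfl⟩)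
  · refine ⟨w, hK.leftQuotient_mul_of_notMem fun h => hw ?_⟩
    exact hK.leftQuotient_eq_top (self_mem_quotients K) h
  · obtain ⟨w, a, hw, hwa⟩ := hK.exists_first hne
    refine ⟨w ++ [a] ++ v, ?_⟩
    rw [Language.leftQuotient_append, hK.leftQuotient_mul_of_first hL hw hwa]

theorem IsRegularTwoSidedIdeal.encard_quotients_diff_top {K : Language α}
    (hK : IsRegularTwoSidedIdeal K) {m : ℕ} (hKm : complexity K = m) :
    (quotients K \ {⊤}).encard = ((m - 1 : ℕ) : ℕ∞) := by
  have hKm' : (quotients K).encard = m := hKm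
  rw [Set.encard_sdiff_singleton_of_mem hK.top_mem, hKm']
  push_cast; rfl

theorem IsRegularTwoSidedIdeal.complexity_mul_le {K L : Language α}
    (hK : IsRegularTwoSidedIdeal K) (hL : IsRegularTwoSidedIdeal L) {m n : ℕ} (hm : 1 ≤ m)
    (hKm : complexity K = m) (hLn : complexity L = n) :
    complexity (K * L) ≤ ((m + n - 1 : ℕ) : ℕ∞) := by
  have hLn' : (quotients L).encard = n := hLn
  calc _ ≤ ((· * L) '' (quotients K \ {⊤}) ∪ quotients L).encard :=
        Set.encard_le_encard (hK.quotients_mul_subset hL)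
    _ ≤ ((· * L) '' (quotients K \ {⊤})).encard + (quotients L).encard := Set.encard_union_le _ _
    _ ≤ (quotients K \ {⊤}).encard + (quotients L).encard := by
      exact add_le_add_left (Set.encard_image_le _ _) _
    _ = ((m + n - 1 : ℕ) : ℕ∞) := by
      rw [hK.encard_quotients_diff_top hKm, hLn', ← Nat.cast_add]
      congr 1
      omega

/-! ### Boolean operations -/

/-- The maximal complexity of `boolOp f K L` for two-sided ideals of complexities `m` and `n`. -/
def boolBound (f : Bool → Bool → Bool) (m n : ℕ) : ℕ :=
  (if f true true = f true false then m - 1 else m) *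
    (if f true true = f false true then n - 1 else n) +
  (if f true true = f true false ∨ f true true = f false true then 1 else 0)

theorem leftQuotient_boolOp (f : Bool → Bool → Bool) (K L : Language α) (w : List α) :
    (boolOp f K L).leftQuotient w = boolOp f (K.leftQuotient w) (L.leftQuotient w) := rfl

/-- If f ignores its second argument once the first is true, then `⊤` on the left is absorbing, and
a whole row of pairs of quotients merges into one language. -/
theorem boolOp_top_left {f : Bool → Bool → Bool} (hf : f true true = f true false)
    (L : Language α) : boolOp f ⊤ L = boolOp f ⊤ ⊤ := by
  classical
  ext x
  rw [mem_boolOp, mem_boolOp, decide_eq_true (mem_top_language x)]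
  cases decide (x ∈ L) <;> simp [hf]

theorem boolOp_top_right {f : Bool → Bool → Bool} (hf : f true true = f false true)
    (K : Language α) : boolOp f K ⊤ = boolOp f ⊤ ⊤ := by
  classical
  ext x
  rw [mem_boolOp, mem_boolOp, decide_eq_true (mem_top_language x)]
  cases decide (x ∈ K) <;> simp [hf]

theorem complexity_boolOp_le {f : Bool → Bool → Bool} {K L : Language α}
    (hK : IsRegularTwoSidedIdeal K) (hL : IsRegularTwoSidedIdeal L) {m n : ℕ}
    (hKm : complexity K = m) (hLn : complexity L = n) :
    complexity (boolOp f K L) ≤ (boolBound f m n : ℕ∞) := by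
  have hKm' : (quotients K).encard = m := hKm
  have hLn' : (quotients L).encard = n := hLn
  have hKt := hK.encard_quotients_diff_top hKm
  have hLt := hL.encard_quotients_diff_top hLn
  let F : Language α × Language α → Language α := fun p => boolOp f p.1 p.2
  have hsub : quotients (boolOp f K L) ⊆ F '' (quotients K ×ˢ quotients L) := by
    rintro _ ⟨w, rfl⟩
    exact ⟨(K.leftQuotient w, L.leftQuotient w), ⟨⟨w, rfl⟩, ⟨w, rfl⟩⟩, rfl⟩
  -- `hbound` covers the case without an absorbing `⊤`. In the other cases `hbound'` removes `⊤`
  -- from the absorbing sides and adds back the single merged language, which is the summand 1 of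
  -- `boolBound`.
  have hbound : ∀ (A B : Set (Language α)) (a b : ℕ), A.encard = a → B.encard = b →
      (F '' (A ×ˢ B)).encard ≤ ((a * b : ℕ) : ℕ∞) := by
    intro A B a b ha hb
    refine (Set.encard_image_le _ _).trans ?_
    rw [Set.encard_prod, ha, hb]
    push_cast; rfl
  have hbound' : ∀ (A B : Set (Language α)) (a b : ℕ), A.encard = a → B.encard = b →
      quotients (boolOp f K L) ⊆ insert (F (⊤, ⊤)) (F '' (A ×ˢ B)) →
      complexity (boolOp f K L) ≤ ((a * b + 1 : ℕ) : ℕ∞) := by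
    intro A B a b ha hb hs
    refine (Set.encard_le_encard hs).trans ((Set.encard_insert_le _ _).trans ?_)
    rw [Nat.cast_add]
    gcongr
    · exact hbound A B a b ha hb
    · simp
  unfold boolBound
  by_cases h1 : f true true = f true false <;> by_cases h2 : f true true = f false true
  · rw [if_pos h1, if_pos h2, if_pos (Or.inl h1)]
    refine hbound' _ _ _ _ hKt hLt fun X hX => ?_
    obtain ⟨⟨A, B⟩, ⟨hA, hB⟩, rfl⟩ := hsub hX
    by_cases hA' : A = ⊤
    · exact Or.inl (by rw [hA']; exact boolOp_top_left h1 B)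
    by_cases hB' : B = ⊤
    · exact Or.inl (by rw [hB']; exact boolOp_top_right h2 A)
    · exact Or.inr ⟨(A, B), ⟨⟨hA, hA'⟩, ⟨hB, hB'⟩⟩, rfl⟩
  · rw [if_pos h1, if_neg h2, if_pos (Or.inl h1)]
    refine hbound' _ _ _ _ hKt hLn' fun X hX => ?_
    obtain ⟨⟨A, B⟩, ⟨hA, hB⟩, rfl⟩ := hsub hX
    by_cases hA' : A = ⊤
    · exact Or.inl (by rw [hA']; exact boolOp_top_left h1 B)
    · exact Or.inr ⟨(A, B), ⟨⟨hA, hA'⟩, hB⟩, rfl⟩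
  · rw [if_neg h1, if_pos h2, if_pos (Or.inr h2)]
    refine hbound' _ _ _ _ hKm' hLt fun X hX => ?_
    obtain ⟨⟨A, B⟩, ⟨hA, hB⟩, rfl⟩ := hsub hX
    by_cases hB' : B = ⊤
    · exact Or.inl (by rw [hB']; exact boolOp_top_right h2 A)
    · exact Or.inr ⟨(A, B), ⟨hA, ⟨hB, hB'⟩⟩, rfl⟩
  · rw [if_neg h1, if_neg h2, if_neg (not_or.2 ⟨h1, h2⟩), add_zero]
    exact (Set.encard_le_encard hsub).trans (hbound _ _ _ _ hKm' hLn')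

end UpperBounds

end MostComplex

namespace MostComplex

/-! ### Counting monotone maps on the poset of quotients -/

section MonotoneMaps

/-- The self-maps of `Q` that fix `t` and either fix `b` or have no value besides `f b` and `t`.
They are the monotone maps fixing `t` if `b` is the least element, `t` is the greatest element and
the other elements are pairwise incomparable. -/
def flatMaps {Q : Type*} (b t : Q) : Set (Q → Q) :=
  {f | f t = t ∧ (f b = b ∨ ∀ q, f q = f b ∨ f q = t)}

theorem sum_ite_pair {Q : Type*} [Fintype Q] [DecidableEq Q] {b t : Q} (hbt : b ≠ t)
    (A B C : ℕ) : ∑ r : Q, (if r = b then A else if r = t then B else C) =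
      A + B + (Fintype.card Q - 2) * C := by
  rw [← Finset.add_sum_erase _ _ (Finset.mem_univ b),
    ← Finset.add_sum_erase _ _ (Finset.mem_erase.2 ⟨hbt.symm, Finset.mem_univ t⟩),
    Finset.sum_congr rfl (g := fun _ => C), Finset.sum_const, Finset.card_erase_of_mem,
    Finset.card_erase_of_mem (Finset.mem_univ b), Finset.card_univ]
  · simp [hbt.symm, add_assoc, Nat.sub_sub]
  · exact Finset.mem_erase.2 ⟨hbt.symm, Finset.mem_univ t⟩
  · intro x hx
    simp only [Finset.mem_erase] at hx
    simp [hx.1, hx.2.1]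

theorem prod_ite_mem_one {Q : Type*} [Fintype Q] [DecidableEq Q] (s : Finset Q) (k : ℕ) :
    ∏ q : Q, (if q ∈ s then 1 else k) = k ^ (Fintype.card Q - s.card) := by
  rw [Finset.prod_ite, Finset.prod_const_one, one_mul, Finset.prod_const]
  congr 1
  rw [← Finset.card_compl]
  congr 1
  ext x
  simp

/-- Split by r = f b. For r = b the n − 2 remaining values are free; for r outside {b, t} each of
them is r or t; for r = t only the constant map is left. -/
theorem encard_flatMaps {Q : Type*} {n : ℕ} (hQ : ENat.card Q = n) {b t : Q}
    (hbt : b ≠ t) : (flatMaps b t).encard = semigroupBound n := by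
  classical
  have hfin : Finite Q := by
    rw [← ENat.card_lt_top, hQ]; exact ENat.natCast_lt_top n
  have := Fintype.ofFinite Q
  have hcard : Fintype.card Q = n := by
    rw [ENat.card_eq_coe_fintype_card] at hQ
    exact_mod_cast hQ
  -- The admissible values at q once f b = r is fixed. For r = t the set {r, t} is a singleton, so
  -- this case needs no separate clause.
  let fam : Q → Q → Finset Q := fun r q => if q = t then {t} else if q = b then {r} else
    if r = b then Finset.univ else {r, t}
  have hset : flatMaps b t =
      ((Finset.univ.biUnion fun r => Fintype.piFinset (fam r) : Finset (Q → Q)) : Set (Q → Q)) := by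
    ext f
    simp only [flatMaps, Set.mem_ofPred_eq, Finset.coe_biUnion, Finset.coe_univ, Set.mem_univ,
      Set.iUnion_true, Set.mem_iUnion, Finset.mem_coe, Fintype.mem_piFinset, fam]
    constructor
    · rintro ⟨h1, h2⟩
      refine ⟨f b, fun q => ?_⟩
      by_cases hqt : q = t
      · subst hqt; simp [h1]
      by_cases hqb : q = b
      · subst hqb; simp [hqt]
      by_cases hb : f b = b
      · simp [hqt, hqb, hb]
      · rcases h2 with h2 | h2
        · exact absurd h2 hb
        · simp only [hqt, hqb, hb, if_false, Finset.mem_insert, Finset.mem_singleton]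
          exact h2 q
    · rintro ⟨r, hr⟩
      have ht := hr t
      have hb := hr b
      simp only [if_true, Finset.mem_singleton] at ht
      simp only [hbt, if_false, if_true, Finset.mem_singleton] at hb
      refine ⟨ht, ?_⟩
      by_cases hrb : r = b
      · exact Or.inl (hb.trans hrb)
      · right
        intro q
        by_cases hqt : q = t
        · right; rw [hqt, ht]
        by_cases hqb : q = b
        · left; rw [hqb]
        have := hr q
        simp only [hqt, hqb, hrb, if_false, Finset.mem_insert, Finset.mem_singleton] at this
        rwa [hb]
  rw [hset, Set.encard_coe_eq_coe_finsetCard, Finset.card_biUnion]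
  · have hterm : ∀ r, (Fintype.piFinset (fam r)).card =
        if r = b then n ^ (n - 2) else if r = t then 1 else 2 ^ (n - 2) := by
      intro r
      have hk : ∀ k : ℕ, (∀ q, q ≠ t → q ≠ b → (fam r q).card = k) →
          (Fintype.piFinset (fam r)).card = k ^ (n - 2) := by
        intro k hk
        rw [Fintype.card_piFinset, ← hcard, ← Finset.card_pair hbt, ← prod_ite_mem_one]
        refine Finset.prod_congr rfl fun q _ => ?_
        by_cases hqt : q = t
        · simp [hqt, fam]
        by_cases hqb : q = b
        · simp [hqb, fam, hbt]
        · rw [hk q hqt hqb]; simp [hqt, hqb]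
      split_ifs with h1 h2
      · refine hk n fun q hqt hqb => ?_
        simp [fam, hqt, hqb, h1, hcard]
      · rw [hk 1, one_pow]
        intro q hqt hqb
        simp [fam, hqt, hqb, h2, hbt.symm]
      · refine hk 2 fun q hqt hqb => ?_
        simp [fam, hqt, hqb, h1, Finset.card_pair h2]
    rw [Finset.sum_congr rfl fun r _ => hterm r, sum_ite_pair hbt, hcard, semigroupBound]
    congr 1
    ring
  · intro r _ s _ hrs
    rw [Function.onFun, Finset.disjoint_left]
    intro f hf hg
    have h1 := (Fintype.mem_piFinset.1 hf) b
    have h2 := (Fintype.mem_piFinset.1 hg) b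
    simp only [fam, hbt, if_false, if_true, Finset.mem_singleton] at h1 h2
    exact hrs (h1.symm.trans h2)

/-- Bernoulli's inequality for (1 + 1/i)^k, with denominators cleared. -/
theorem mul_succ_pow_ge (i k : ℕ) : i ^ k * (i + k) ≤ i * (i + 1) ^ k := by
  induction k with
  | zero => simp
  | succ k ih =>
    calc i ^ (k + 1) * (i + (k + 1)) = i ^ k * (i * (i + k + 1)) := by ring
      _ ≤ i ^ k * ((i + k) * (i + 1)) := Nat.mul_le_mul_left _ (by nlinarith)
      _ = i ^ k * (i + k) * (i + 1) := by ring
      _ ≤ i * (i + 1) ^ k * (i + 1) := by gcongr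
      _ = i * (i + 1) ^ (k + 1) := by ring

/-- The summands j^k (j + 1) at least double from one index to the next in this range, so the sum in
`sum_pow_mul_le` is dominated like a geometric series. -/
theorem two_mul_pow_mul_le {i k : ℕ} (hk : 1 ≤ k) (hi : i ≤ k + 1) :
    2 * (i ^ k * (i + 1)) ≤ (i + 1) ^ k * (i + 2) := by
  rcases Nat.eq_zero_or_pos i with rfl | hpos
  · simp [Nat.pos_iff_ne_zero.1 hk]
  refine Nat.le_of_mul_le_mul_left ?_ hpos
  calc i * (2 * (i ^ k * (i + 1))) = i ^ k * (2 * i * (i + 1)) := by ring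
    _ ≤ i ^ k * ((i + k) * (i + 2)) := Nat.mul_le_mul_left _ (by nlinarith)
    _ = i ^ k * (i + k) * (i + 2) := by ring
    _ ≤ i * (i + 1) ^ k * (i + 2) := Nat.mul_le_mul_right _ (mul_succ_pow_ge i k)
    _ = i * ((i + 1) ^ k * (i + 2)) := by ring

theorem sum_pow_mul_le {k : ℕ} (hk : 1 ≤ k) (i : ℕ) (hi : i ≤ k + 2) :
    ∑ j ∈ Finset.range i, (j + 1) ^ k * (j + 2) ≤ 2 * (i ^ k * (i + 1)) := by
  induction i with
  | zero => simp
  | succ i ih =>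
    rw [Finset.sum_range_succ]
    have h1 := ih (by omega)
    have h2 := two_mul_pow_mul_le (i := i) hk (by omega)
    have h3 : (i + 1) ^ k * (i + 1 + 1) = (i + 1) ^ k * (i + 2) := by ring
    omega

/-- The first three binomial terms of (1 + 1/t)^s, with denominators cleared. Bernoulli alone is too
weak for `two_mul_pow_le_succ_pow`. -/
theorem two_mul_sq_mul_succ_pow_ge (t s : ℕ) :
    t ^ s * (2 * t ^ 2 + 2 * s * t + s * (s - 1)) ≤ 2 * t ^ 2 * (t + 1) ^ s := by
  have h : ∀ s : ℕ, (t : ℤ) ^ s * (2 * t ^ 2 + 2 * s * t + s * (s - 1)) ≤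
      2 * t ^ 2 * (t + 1) ^ s := by
    intro s
    induction s with
    | zero => simp
    | succ s ih =>
      have hs : (0 : ℤ) ≤ s * (s - 1) := by
        rcases s with _ | s
        · simp
        · push_cast; nlinarith
      have ht : (0 : ℤ) ≤ t := by positivity
      calc (t : ℤ) ^ (s + 1) * (2 * t ^ 2 + 2 * (s + 1 : ℕ) * t + (s + 1 : ℕ) * ((s + 1 : ℕ) - 1))
          = (t : ℤ) ^ s * (t * (2 * t ^ 2 + 2 * (s + 1) * t + (s + 1) * s)) := by
            push_cast; ring
        _ ≤ (t : ℤ) ^ s * ((2 * t ^ 2 + 2 * s * t + s * (s - 1)) * (t + 1)) := by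
            refine mul_le_mul_of_nonneg_left ?_ (by positivity)
            nlinarith
        _ = (t : ℤ) ^ s * (2 * t ^ 2 + 2 * s * t + s * (s - 1)) * (t + 1) := by ring
        _ ≤ 2 * t ^ 2 * (t + 1) ^ s * (t + 1) := by gcongr
        _ = 2 * t ^ 2 * (t + 1) ^ (s + 1) := by ring
  -- The induction runs over the integers because s − 1 is truncated at s = 0.
  have := h s
  rcases s with _ | s
  · simp
  · zify
    simpa using this

/-- With t = s + 3 the three-term estimate reduces the claim to (s − 9)(s + 2) ≥ 0, hence the
hypothesis on s. -/
theorem two_mul_pow_le_succ_pow {s : ℕ} (hs : 9 ≤ s) : 2 * (s + 3) ^ s ≤ (s + 4) ^ s := by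
  have h := two_mul_sq_mul_succ_pow_ge (s + 3) s
  have hpos : 0 < 2 * (s + 3) ^ 2 := by positivity
  refine Nat.le_of_mul_le_mul_left ?_ hpos
  refine le_trans ?_ h
  calc 2 * (s + 3) ^ 2 * (2 * (s + 3) ^ s) = (s + 3) ^ s * (4 * (s + 3) ^ 2) := by ring
    _ ≤ _ := by
      gcongr
      obtain ⟨r, rfl⟩ := Nat.exists_eq_add_of_le hs
      have : 9 + r - 1 = 8 + r := by omega
      rw [this]
      nlinarith

/-- The last summand is n^(n-3) (n + 1), and the others together are at most n^(n-3) (n − 1). The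
total is at most 2 n^(n-2), and the lower terms of the bound make the inequality strict. -/
theorem sum_pow_lt_two_mul_semigroupBound {n : ℕ} (hn : 5 ≤ n) :
    ∑ j ∈ Finset.range n, (j + 1) ^ (n - 3) * (j + 2) < 2 * semigroupBound n := by
  -- The estimate needs s = n − 4 ≥ 9; the smaller n are evaluated.
  by_cases h13 : n < 13
  · interval_cases n <;> simp [Finset.sum_range_succ, semigroupBound]
  · obtain ⟨s, rfl⟩ : ∃ s, n = s + 4 := ⟨n - 4, by omega⟩
    have hs : 9 ≤ s := by omega
    have h1 := sum_pow_mul_le (k := s + 1) (by omega) (s + 3) (by omega)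
    have h2 := two_mul_pow_le_succ_pow hs
    have h3 : s + 4 - 3 = s + 1 := by omega
    have h4 : s + 4 - 2 = s + 2 := by omega
    rw [Finset.sum_range_succ, semigroupBound, h3, h4]
    have h5 : 2 * ((s + 3) ^ (s + 1) * (s + 3 + 1)) ≤ (s + 4) ^ (s + 1) * (s + 3) := by
      calc _ = 2 * (s + 3) ^ s * ((s + 3) * (s + 4)) := by ring
        _ ≤ (s + 4) ^ s * ((s + 3) * (s + 4)) := by gcongr
        _ = _ := by ring
    have h6 : 2 * (s + 4) ^ (s + 2) =
      (s + 4) ^ (s + 1) * (s + 3) + (s + 3 + 1) ^ (s + 1) * (s + 3 + 2) := by ring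
    have h7 : (0 : ℕ) ≤ (s + 2) * 2 ^ (s + 2) := Nat.zero_le _
    omega

variable {Q : Type*} [PartialOrder Q]

open Classical in
-- The order relation on U and its converse have the same size, their union lies in the square, and
-- by antisymmetry they meet only in the diagonal.
theorem two_mul_card_le_pairs (U : Finset Q) :
    2 * ((U ×ˢ U).filter fun p => p.1 ≤ p.2).card ≤ U.card ^ 2 + U.card := by
  set A := (U ×ˢ U).filter fun p => p.1 ≤ p.2 with hA
  set B := (U ×ˢ U).filter fun p => p.2 ≤ p.1 with hB
  have hAB : A.card = B.card := by
    refine Finset.card_bij (fun p _ => p.swap) ?_ ?_ ?_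
    · intro p hp
      simp only [hA, hB, Finset.mem_filter, Finset.mem_product, Prod.fst_swap,
        Prod.snd_swap] at hp ⊢
      exact ⟨⟨hp.1.2, hp.1.1⟩, hp.2⟩
    · intro p _ q _ h
      exact Prod.swap_injective h
    · intro p hp
      simp only [hB, Finset.mem_filter, Finset.mem_product] at hp
      exact ⟨p.swap, by simp [hA, hp.1.1, hp.1.2, hp.2], by simp⟩
  have h1 := Finset.card_union_add_card_inter A B
  have h2 : (A ∪ B).card ≤ U.card ^ 2 := by
    rw [sq, ← Finset.card_product]
    refine Finset.card_le_card (Finset.union_subset ?_ ?_) <;> exact Finset.filter_subset _ _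
  have h3 : (A ∩ B).card ≤ U.card := by
    refine Finset.card_le_card_of_injOn Prod.fst ?_ ?_
    · intro p hp
      have hp := Finset.mem_coe.1 hp
      simp only [hA, hB, Finset.mem_inter, Finset.mem_filter, Finset.mem_product] at hp
      exact hp.1.1.1
    · intro p hp q hq h
      have hp := Finset.mem_coe.1 hp
      have hq := Finset.mem_coe.1 hq
      simp only [hA, hB, Finset.mem_inter, Finset.mem_filter, Finset.mem_product] at hp hq
      refine Prod.ext h ?_
      rw [← le_antisymm hp.1.2 hp.2.2, ← le_antisymm hq.1.2 hq.2.2, h]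
  omega

open Classical in
-- All values lie in the up-set U of r. The values at b and t are fixed, those at p and q form a
-- pair in the order relation of U, and the other n − 4 are estimated by arbitrary elements of U.
theorem two_mul_card_monotone_le [Fintype Q] {b t p q : Q} (hb : ∀ x, b ≤ x) (ht : ∀ x, x ≤ t)
    (hpq : p < q) (hpb : p ≠ b) (hqt : q ≠ t) {n : ℕ} (hn : 4 ≤ n) (hcard : Fintype.card Q = n)
    (r : Q) (U : Finset Q) (hU : ∀ x, x ∈ U ↔ r ≤ x) :
    2 * (Finset.univ.filter fun f : Q → Q => Monotone f ∧ f t = t ∧ f b = r).card ≤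
      U.card ^ (n - 3) * (U.card + 1) := by
  have hpt : p ≠ t := fun h => absurd (h ▸ hpq) (not_lt_of_ge (ht q))
  have hqb : q ≠ b := fun h => absurd (h ▸ hpq) (not_lt_of_ge (hb p))
  have hbt : b ≠ t := fun h => hpb (le_antisymm (h ▸ ht p) (hb p))
  have hs : ({b, t, p, q} : Finset Q).card = 4 := by
    rw [Finset.card_insert_of_notMem, Finset.card_insert_of_notMem, Finset.card_pair hpq.ne]
    · simp [hpt.symm, hqt.symm]
    · simp [hbt, hpb.symm, hqb.symm]
  let s : Finset Q := {b, t, p, q}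
  have hinj : (Finset.univ.filter fun f : Q → Q => Monotone f ∧ f t = t ∧ f b = r).card ≤
      (((U ×ˢ U).filter fun p => p.1 ≤ p.2) ×ˢ
        Fintype.piFinset fun x => if x ∈ s then ({t} : Finset Q) else U).card := by
    -- In the second component the values at b, t, p, q are overwritten by the dummy value t, so
    -- that these four points contribute the factor 1.
    refine Finset.card_le_card_of_injOn
      (fun f => ((f p, f q), fun x => if x ∈ s then t else f x)) ?_ ?_
    · intro f hf
      have hf := Finset.mem_coe.1 hf
      simp only [Finset.mem_filter, Finset.mem_univ, true_and] at hf
      obtain ⟨hmono, hft, hfb⟩ := hf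
      have hfU : ∀ x, f x ∈ U := fun x => (hU _).2 (hfb ▸ hmono (hb x))
      refine Finset.mem_coe.2 ?_
      simp only [Finset.mem_product, Finset.mem_filter, Fintype.mem_piFinset]
      refine ⟨⟨⟨hfU p, hfU q⟩, hmono hpq.le⟩, fun x => ?_⟩
      split_ifs
      · simp
      · exact hfU x
    · intro f hf g hg h
      have hf := Finset.mem_coe.1 hf
      have hg := Finset.mem_coe.1 hg
      simp only [Finset.mem_filter, Finset.mem_univ, true_and] at hf hg
      simp only [Prod.mk.injEq] at h
      funext x
      by_cases hx : x ∈ s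
      · simp only [s, Finset.mem_insert, Finset.mem_singleton] at hx
        rcases hx with rfl | rfl | rfl | rfl
        · rw [hf.2.2, hg.2.2]
        · rw [hf.2.1, hg.2.1]
        · exact h.1.1
        · exact h.1.2
      · have := congrFun h.2 x
        simpa [hx] using this
  have hpi : (Fintype.piFinset fun x => if x ∈ s then ({t} : Finset Q) else U).card =
      U.card ^ (n - 4) := by
    rw [Fintype.card_piFinset, ← hcard, ← hs, ← prod_ite_mem_one]
    refine Finset.prod_congr rfl fun x _ => ?_
    show _ = if x ∈ s then 1 else U.card
    split_ifs <;> simp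
  rw [Finset.card_product, hpi] at hinj
  have h2 := two_mul_card_le_pairs U
  obtain ⟨k, rfl⟩ : ∃ k, n = k + 4 := ⟨n - 4, by omega⟩
  have h3 : k + 4 - 3 = k + 1 := by omega
  have h4 : k + 4 - 4 = k := by omega
  rw [h4] at hinj
  rw [h3]
  calc _ ≤ 2 * (((U ×ˢ U).filter fun p => p.1 ≤ p.2).card * U.card ^ k) := by gcongr
    _ = 2 * ((U ×ˢ U).filter fun p => p.1 ≤ p.2).card * U.card ^ k := by ring
    _ ≤ (U.card ^ 2 + U.card) * U.card ^ k := by gcongr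
    _ = _ := by ring

/-- A linear extension: the up-set of the element in position i lies in the positions from i on,
which bounds its size by n − i. -/
theorem exists_equiv_fin_monotone [Fintype Q] {n : ℕ} (hcard : Fintype.card Q = n) :
    ∃ e : Q ≃ Fin n, ∀ x y, x ≤ y → e x ≤ e y := by
  classical
  let _ : Fintype (LinearExtension Q) := ‹Fintype Q›
  have hc : Fintype.card (LinearExtension Q) = n := hcard
  let o := (Fintype.orderIsoFinOfCardEq (LinearExtension Q) hc).symm
  exact ⟨o.toEquiv, fun x y h => o.monotone (toLinearExtension.monotone h)⟩

/-- The count is split by the image r of b. The up-sets of the various r have sizes at most n, n −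
1, …, 1 along a linear extension, which leads to the sum estimated before. -/
theorem encard_monotone_lt [Fintype Q] {b t p q : Q} (hb : ∀ x, b ≤ x) (ht : ∀ x, x ≤ t)
    (hpq : p < q) (hpb : p ≠ b) (hqt : q ≠ t) {n : ℕ} (hn : 5 ≤ n) (hcard : Fintype.card Q = n) :
    {f : Q → Q | Monotone f ∧ f t = t}.encard < semigroupBound n := by
  classical
  obtain ⟨e, he⟩ := exists_equiv_fin_monotone hcard
  have hset : {f : Q → Q | Monotone f ∧ f t = t} =
      ((Finset.univ.filter fun f : Q → Q => Monotone f ∧ f t = t : Finset (Q → Q)) :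
        Set (Q → Q)) := by ext; simp
  rw [hset, Set.encard_coe_eq_coe_finsetCard, Nat.cast_lt]
  rw [Finset.card_eq_sum_card_fiberwise (f := fun f => f b) (t := Finset.univ)
    fun _ _ => Finset.mem_coe.2 (Finset.mem_univ _)]
  refine Nat.lt_of_mul_lt_mul_left (a := 2)
    (lt_of_le_of_lt ?_ (sum_pow_lt_two_mul_semigroupBound hn))
  rw [Finset.mul_sum]
  calc _ ≤ ∑ r : Q, (n - (e r : ℕ)) ^ (n - 3) * (n - (e r : ℕ) + 1) := by
        refine Finset.sum_le_sum fun r _ => ?_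
        have h1 := two_mul_card_monotone_le hb ht hpq hpb hqt (by omega) hcard r
          (Finset.univ.filter fun x => r ≤ x) (by simp)
        have h2 : (Finset.univ.filter fun x => r ≤ x).card ≤ n - (e r : ℕ) := by
          rw [← Fin.card_Ici]
          refine Finset.card_le_card_of_injOn e ?_ e.injective.injOn
          intro x hx
          have hx := Finset.mem_coe.1 hx
          simp only [Finset.mem_filter, Finset.mem_univ, true_and] at hx
          exact Finset.mem_coe.2 (Finset.mem_Ici.2 (he _ _ hx))
        rw [Finset.filter_filter]
        simp only [and_assoc]
        exact h1.trans (by gcongr)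
    _ = ∑ i : Fin n, (n - (i : ℕ)) ^ (n - 3) * (n - (i : ℕ) + 1) :=
        e.sum_comp fun i : Fin n => (n - (i : ℕ)) ^ (n - 3) * (n - (i : ℕ) + 1)
    _ = ∑ i ∈ Finset.range n, (n - i) ^ (n - 3) * (n - i + 1) :=
        Fin.sum_univ_eq_sum_range (fun i => (n - i) ^ (n - 3) * (n - i + 1)) n
    _ = ∑ j ∈ Finset.range n, (j + 1) ^ (n - 3) * (j + 2) := by
        rw [← Finset.sum_range_reflect]
        refine Finset.sum_congr rfl fun i hi => ?_
        have hi := Finset.mem_range.1 hi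
        have h : n - (n - 1 - i) = i + 1 := by omega
        rw [h]

theorem monotone_subset_flatMaps {b t : Q} (hb : ∀ x, b ≤ x)
    (hflat : ∀ p q : Q, p < q → p = b ∨ q = t) :
    {f : Q → Q | Monotone f ∧ f t = t} ⊆ flatMaps b t := by
  rintro f ⟨hf, hft⟩
  refine ⟨hft, ?_⟩
  by_contra hcon
  push Not at hcon
  obtain ⟨hfb, q, hq1, hq2⟩ := hcon
  rcases hflat (f b) (f q) (lt_of_le_of_ne (hf (hb q)) (Ne.symm hq1)) with h | h
  · exact hfb h
  · exact hq2 h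

end MonotoneMaps

end MostComplex

namespace MostComplex

/-! ### The bound for the syntactic semigroup -/

section Ideal

variable {α : Type}

theorem leftQuotient_mono {K L : Language α} (h : K ≤ L) (w : List α) :
    K.leftQuotient w ≤ L.leftQuotient w := fun _ hx => h hx

theorem transformations_quotientDFA_subset {L : Language α} (h : IsRegularTwoSidedIdeal L) :
    transformations (quotientDFA L) ⊆
      {f : quotients L → quotients L | Monotone f ∧ f ⟨⊤, h.top_mem⟩ = ⟨⊤, h.top_mem⟩} := by
  rintro f ⟨w, -, hw⟩
  obtain rfl : (fun q => (quotientDFA L).evalFrom q w) = f := funext hw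
  refine ⟨fun p q hpq => ?_, Subtype.ext ?_⟩
  · show ((quotientDFA L).evalFrom p w).1 ≤ ((quotientDFA L).evalFrom q w).1
    rw [quotientDFA_evalFrom, quotientDFA_evalFrom]
    exact leftQuotient_mono hpq w
  · rw [quotientDFA_evalFrom]
    rfl

theorem syntacticSize_eq_transformations (L : Language α) :
    syntacticSize L = (transformations (quotientDFA L)).encard := by
  rw [← (isMinimalDFA_quotientDFA L).syntacticSize, quotientDFA_accepts]

/-- The syntactic semigroup is smaller than the bound, unless every transformation induced by a
word belongs to a set of maps whose cardinality is the bound. -/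
theorem IsRegularTwoSidedIdeal.syntacticSize_lt_or {L : Language α}
    (h : IsRegularTwoSidedIdeal L) {n : ℕ} (hn : 5 ≤ n) (hL : complexity L = n) :
    syntacticSize L < semigroupBound n ∨ transformations (quotientDFA L) ⊆
      flatMaps ⟨L, self_mem_quotients L⟩ ⟨⊤, h.top_mem⟩ := by
  classical
  have hfin : Finite (quotients L) := h.finite_quotients
  have := Fintype.ofFinite (quotients L)
  have hcard : Fintype.card (quotients L) = n := by
    have h1 : ENat.card (quotients L) = n := hL
    rw [ENat.card_eq_coe_fintype_card] at h1
    exact_mod_cast h1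
  have hb : ∀ x : quotients L, ⟨L, self_mem_quotients L⟩ ≤ x := fun x => h.le_quotient x.2
  have ht : ∀ x : quotients L, x ≤ ⟨⊤, h.top_mem⟩ := fun x => le_top (a := x.1)
  have hsub := transformations_quotientDFA_subset h
  by_cases hflat : ∀ p q : quotients L, p < q →
      p = ⟨L, self_mem_quotients L⟩ ∨ q = ⟨⊤, h.top_mem⟩
  · exact Or.inr (hsub.trans (monotone_subset_flatMaps hb hflat))
  · push Not at hflat
    obtain ⟨p, q, hpq, hp, hq⟩ := hflat
    left
    rw [syntacticSize_eq_transformations]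
    exact (Set.encard_le_encard hsub).trans_lt (encard_monotone_lt hb ht hpq hp hq hn hcard)

theorem IsRegularTwoSidedIdeal.bot_ne_top {L : Language α} (h : IsRegularTwoSidedIdeal L) {n : ℕ}
    (hn : 2 ≤ n) (hL : complexity L = n) :
    (⟨L, self_mem_quotients L⟩ : quotients L) ≠ ⟨⊤, h.top_mem⟩ := fun he =>
  ne_top_of_complexity hn hL (Subtype.ext_iff.1 he)

theorem IsRegularTwoSidedIdeal.syntacticSize_le {L : Language α}
    (h : IsRegularTwoSidedIdeal L) {n : ℕ} (hn : 5 ≤ n) (hL : complexity L = n) :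
    syntacticSize L ≤ semigroupBound n := by
  rcases h.syntacticSize_lt_or hn hL with h1 | h1
  · exact h1.le
  · rw [syntacticSize_eq_transformations,
      ← encard_flatMaps (Q := quotients L) hL (h.bot_ne_top (by omega) hL)]
    exact Set.encard_le_encard h1

end Ideal

/-! ### The number of letters -/

section Letters

variable {α Q : Type}

/-- The map `s` identifies `y` and `z` and no other pair of elements. -/
def CollapsesOnly (s : Q → Q) (y z : Q) : Prop :=
  s y = s z ∧ y ≠ z ∧ ∀ y' z', s y' = s z' → y' = z' ∨ (y' = y ∧ z' = z) ∨ (y' = z ∧ z' = y)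

theorem CollapsesOnly.pair_eq {s : Q → Q} {y z y' z' : Q} (h : CollapsesOnly s y z)
    (h' : CollapsesOnly s y' z') : (y' = y ∧ z' = z) ∨ (y' = z ∧ z' = y) :=
  (h.2.2 y' z' h'.1).resolve_left h'.2.1

/-- Otherwise s has at most the two values s b and t, while at least three points are mapped
injectively. -/
theorem apply_bot_of_injOn [Fintype Q] {s : Q → Q} {b t y : Q} (hs : s ∈ flatMaps b t)
    (hcard : 4 ≤ Fintype.card Q) (hinj : Set.InjOn s {y}ᶜ) : s b = b := by
  classical
  by_contra hb
  have h2 := hs.2.resolve_left hb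
  have h1 : (Finset.univ.erase y).card ≤ ({s b, t} : Finset Q).card := by
    refine Finset.card_le_card_of_injOn s ?_ ?_
    · intro q _
      have := h2 q
      simpa using this
    · intro p hp q hq h
      refine hinj ?_ ?_ h
      · simpa using hp
      · simpa using hq
  rw [Finset.card_erase_of_mem (Finset.mem_univ y), Finset.card_univ] at h1
  have := Finset.card_le_two (a := s b) (b := t)
  omega

/-- The first letter of an injective word is injective, hence bijective on the finite state set, and
can be cancelled. -/
theorem step_injective_of_evalFrom_injective [Finite Q] {M : DFA α Q} {w : List α}
    (hw : Function.Injective fun q => M.evalFrom q w) :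
    ∀ x ∈ w, Function.Injective fun q => M.step q x := by
  induction w with
  | nil => simp
  | cons x w ih =>
    have hx : Function.Injective fun q => M.step q x := by
      intro p q h
      refine hw ?_
      have h : M.step p x = M.step q x := h
      simp only [DFA.evalFrom_cons, h]
    have hsurj := Finite.injective_iff_surjective.1 hx
    have hw' : Function.Injective fun q => M.evalFrom q w := by
      intro p q h
      obtain ⟨p, rfl⟩ := hsurj p
      obtain ⟨q, rfl⟩ := hsurj q
      have : p = q := hw h
      rw [this]
    intro y hy
    rcases List.mem_cons.1 hy with rfl | hy
    · exact hx
    · exact ih hw' y hy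

theorem exists_first_not_injective {M : DFA α Q} {w : List α}
    (hw : ¬ Function.Injective fun q => M.evalFrom q w) :
    ∃ u x v, w = u ++ x :: v ∧ (Function.Injective fun q => M.evalFrom q u) ∧
      (∀ y ∈ u, Function.Injective fun q => M.step q y) ∧
      ¬ Function.Injective fun q => M.step q x := by
  induction w with
  | nil => exact absurd (fun p q h => h) hw
  | cons x w ih =>
    by_cases hx : Function.Injective fun q => M.step q x
    · have hw' : ¬ Function.Injective fun q => M.evalFrom q w := fun h => hw (h.comp hx)
      obtain ⟨u, y, v, rfl, h1, h2, h3⟩ := ih hw'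
      refine ⟨x :: u, y, v, rfl, h1.comp hx, ?_, h3⟩
      intro z hz
      rcases List.mem_cons.1 hz with rfl | hz
      · exact hx
      · exact h2 z hz
    · exact ⟨[], x, w, rfl, fun p q h => h, by simp, hx⟩

/-- Take a word that moves u to v and fixes everything else. The letters before its first
non-injective letter permute the states and fix b and t. That letter then identifies only the images
of u and v, since any other collapse would survive to the end of the word. The type of the pair
relative to b and t is preserved by p. -/
theorem exists_collapsing_letter [Fintype Q] {M : DFA α Q} {b t : Q}
    (hM : transformations M = flatMaps b t) (hcard : 4 ≤ Fintype.card Q) {u v : Q} (hub : u ≠ b)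
    (hut : u ≠ t) (huv : u ≠ v) :
    ∃ x, ∃ p : Q → Q, Function.Injective p ∧ p b = b ∧ p t = t ∧ M.step b x = b ∧
      CollapsesOnly (fun q => M.step q x) (p u) (p v) := by
  classical
  have hstep : ∀ x, (fun q => M.step q x) ∈ flatMaps b t := fun x =>
    hM ▸ step_mem_transformations M x
  have hg : Function.update id u v ∈ flatMaps b t := by
    refine ⟨?_, Or.inl ?_⟩
    · rw [Function.update_of_ne hut.symm]; rfl
    · rw [Function.update_of_ne hub.symm]; rfl
  rw [← hM] at hg
  obtain ⟨w, -, hw⟩ := hg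
  have hcol : ∀ y z, M.evalFrom y w = M.evalFrom z w → y = z ∨ (y = u ∧ z = v) ∨ (y = v ∧ z = u) := by
    intro y z h
    rw [hw, hw] at h
    by_cases hy : y = u <;> by_cases hz : z = u
    · exact Or.inl (hy.trans hz.symm)
    · rw [hy, Function.update_self, Function.update_of_ne hz] at h
      exact Or.inr (Or.inl ⟨hy, h.symm⟩)
    · rw [hz, Function.update_self, Function.update_of_ne hy] at h
      exact Or.inr (Or.inr ⟨h, hz⟩)
    · rw [Function.update_of_ne hy, Function.update_of_ne hz] at h
      exact Or.inl h
  have hni : ¬ Function.Injective fun q => M.evalFrom q w := by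
    intro h
    refine huv (h ?_)
    simp only [hw, Function.update_self, Function.update_of_ne huv.symm, id]
  obtain ⟨w1, x, w2, rfl, h1, h2, h3⟩ := exists_first_not_injective hni
  have hfix : ∀ l : List α, (∀ y ∈ l, Function.Injective fun q => M.step q y) →
      M.evalFrom b l = b ∧ M.evalFrom t l = t := by
    intro l hl
    induction l with
    | nil => exact ⟨rfl, rfl⟩
    | cons y l ih =>
      have h4 : M.step b y = b := apply_bot_of_injOn (hstep y) hcard
        ((hl y (by simp)).injOn (s := {b}ᶜ))
      have h5 : M.step t y = t := (hstep y).1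
      rw [DFA.evalFrom_cons, DFA.evalFrom_cons, h4, h5]
      exact ih fun z hz => hl z (by simp [hz])
  have hsplit : ∀ y z, M.step (M.evalFrom y w1) x = M.step (M.evalFrom z w1) x →
      y = z ∨ (y = u ∧ z = v) ∨ (y = v ∧ z = u) := by
    intro y z h
    refine hcol y z ?_
    rw [evalFrom_append, evalFrom_append, DFA.evalFrom_cons, DFA.evalFrom_cons, h]
  have hsurj := Finite.injective_iff_surjective.1 h1
  have huv' : M.step (M.evalFrom u w1) x = M.step (M.evalFrom v w1) x := by
    rw [Function.Injective] at h3
    push Not at h3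
    obtain ⟨y, z, hyz, hne⟩ := h3
    obtain ⟨y, rfl⟩ := hsurj y
    obtain ⟨z, rfl⟩ := hsurj z
    rcases hsplit y z hyz with h | ⟨rfl, rfl⟩ | ⟨rfl, rfl⟩
    · exact absurd (by rw [h]) hne
    · exact hyz
    · exact hyz.symm
  have hcoll : CollapsesOnly (fun q => M.step q x) (M.evalFrom u w1) (M.evalFrom v w1) := by
    refine ⟨huv', fun h => huv (h1 h), fun y z h => ?_⟩
    obtain ⟨y, rfl⟩ := hsurj y
    obtain ⟨z, rfl⟩ := hsurj z
    rcases hsplit y z h with h | ⟨rfl, rfl⟩ | ⟨rfl, rfl⟩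
    · exact Or.inl (by rw [h])
    · exact Or.inr (Or.inl ⟨rfl, rfl⟩)
    · exact Or.inr (Or.inr ⟨rfl, rfl⟩)
  refine ⟨x, fun q => M.evalFrom q w1, h1, (hfix w1 h2).1, (hfix w1 h2).2, ?_, hcoll⟩
  refine apply_bot_of_injOn (hstep x) hcard (y := M.evalFrom u w1) ?_
  intro y hy z hz h
  rcases hcoll.2.2 y z h with h | ⟨rfl, rfl⟩ | ⟨rfl, rfl⟩
  · exact h
  · exact absurd rfl hy
  · exact absurd rfl hz

/-- The transpositions of p, q and of q, r are induced by words of injective letters. If only one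
such letter existed, both words would be powers of it and would commute. -/
theorem exists_two_injective_letters [Fintype Q] {M : DFA α Q} {b t : Q}
    (hM : transformations M = flatMaps b t) (hcard : 5 ≤ Fintype.card Q) :
    ∃ x y : α, x ≠ y ∧ (Function.Injective fun q => M.step q x) ∧
      Function.Injective fun q => M.step q y := by
  classical
  have h3 : 2 < (Finset.univ \ {b, t} : Finset Q).card := by
    have h1 := Finset.le_card_sdiff {b, t} (Finset.univ : Finset Q)
    have h2 := Finset.card_le_two (a := b) (b := t)
    rw [Finset.card_univ] at h1
    omega
  obtain ⟨p, q, r, hp, hq, hr, hpq, hpr, hqr⟩ := Finset.two_lt_card_iff.1 h3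
  simp only [Finset.mem_sdiff, Finset.mem_univ, true_and, Finset.mem_insert,
    Finset.mem_singleton, not_or] at hp hq hr
  have hswap : ∀ y z : Q, y ≠ b → y ≠ t → z ≠ b → z ≠ t →
      ⇑(Equiv.swap y z) ∈ transformations M := by
    intro y z hyb hyt hzb hzt
    rw [hM]
    exact ⟨Equiv.swap_apply_of_ne_of_ne hyt.symm hzt.symm,
      Or.inl (Equiv.swap_apply_of_ne_of_ne hyb.symm hzb.symm)⟩
  obtain ⟨w, hw0, hw⟩ := hswap p q hp.1 hp.2 hq.1 hq.2
  obtain ⟨w', -, hw'⟩ := hswap q r hq.1 hq.2 hr.1 hr.2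
  have hi : ∀ x ∈ w, Function.Injective fun q => M.step q x :=
    step_injective_of_evalFrom_injective (by
      simp only [hw]; exact (Equiv.swap p q).injective)
  have hi' : ∀ x ∈ w', Function.Injective fun q => M.step q x :=
    step_injective_of_evalFrom_injective (by
      simp only [hw']; exact (Equiv.swap q r).injective)
  obtain ⟨x, hx⟩ := List.exists_mem_of_ne_nil w hw0
  by_contra hcon
  push Not at hcon
  have hall : ∀ y, (Function.Injective fun q => M.step q y) → y = x := by
    intro y hy
    by_contra hne
    exact hcon x y (Ne.symm hne) (hi x hx) hy
  have e1 := List.eq_replicate_of_mem fun y hy => hall y (hi y hy)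
  have e2 := List.eq_replicate_of_mem fun y hy => hall y (hi' y hy)
  have hcomm : w ++ w' = w' ++ w := by
    rw [e1, e2, List.replicate_append_replicate, List.replicate_append_replicate, add_comm]
  have h4 : M.evalFrom p (w ++ w') = M.evalFrom p (w' ++ w) := by rw [hcomm]
  rw [evalFrom_append, evalFrom_append, hw, hw', hw, hw', Equiv.swap_apply_left,
    Equiv.swap_apply_left, Equiv.swap_apply_of_ne_of_ne hpq hpr, Equiv.swap_apply_left] at h4
  exact hqr h4.symm

/-- Two letters are permutations. Three letters fix b and collapse one pair each: two middle states,
a middle state with b, a middle state with t. A sixth letter moves b. These behaviours exclude one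
another. -/
theorem six_le_card_of_transformations [Fintype Q] [Finite α] {M : DFA α Q} {b t : Q} (hbt : b ≠ t)
    (hM : transformations M = flatMaps b t) (hcard : 5 ≤ Fintype.card Q) : 6 ≤ Nat.card α := by
  classical
  have := Fintype.ofFinite α
  have h1 : 1 < (Finset.univ \ {b, t} : Finset Q).card := by
    have h1 := Finset.le_card_sdiff {b, t} (Finset.univ : Finset Q)
    have h2 := Finset.card_le_two (a := b) (b := t)
    rw [Finset.card_univ] at h1
    omega
  obtain ⟨p, hp, q, hq, hpq⟩ := Finset.one_lt_card.1 h1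
  simp only [Finset.mem_sdiff, Finset.mem_univ, true_and, Finset.mem_insert,
    Finset.mem_singleton, not_or] at hp hq
  obtain ⟨x1, x2, h12, hi1, hi2⟩ := exists_two_injective_letters hM hcard
  obtain ⟨x3, p3, hp3, hp3b, hp3t, hb3, hc3⟩ :=
    exists_collapsing_letter hM (by omega) hp.1 hp.2 hpq
  obtain ⟨x4, p4, hp4, hp4b, hp4t, hb4, hc4⟩ :=
    exists_collapsing_letter hM (by omega) hp.1 hp.2 hp.1
  obtain ⟨x5, p5, hp5, hp5b, hp5t, hb5, hc5⟩ :=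
    exists_collapsing_letter hM (by omega) hp.1 hp.2 hp.2
  obtain ⟨x6, hb6⟩ : ∃ x, M.step b x ≠ b := by
    by_contra hcon
    push Not at hcon
    have hmem : (fun _ => t) ∈ transformations M := by
      rw [hM]; exact ⟨rfl, Or.inr fun _ => Or.inr rfl⟩
    obtain ⟨w, -, hw⟩ := hmem
    have : ∀ w : List α, M.evalFrom b w = b := by
      intro w
      induction w with
      | nil => rfl
      | cons x w ih => rw [DFA.evalFrom_cons, hcon, ih]
    exact hbt ((this w).symm.trans (hw b))
  have hinj6 : ∀ x, (Function.Injective fun q => M.step q x) → M.step b x = b := fun x hx =>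
    apply_bot_of_injOn (y := b) (hM ▸ step_mem_transformations M x) (by omega) hx.injOn
  have hni : ∀ x y z, CollapsesOnly (fun q => M.step q x) y z →
      ¬ Function.Injective fun q => M.step q x := fun x y z h hx => h.2.1 (hx h.1)
  have hpb : ∀ (g : Q → Q) (y : Q), Function.Injective g → g b = b → y ≠ b → g y ≠ b :=
    fun g y hg hgb hy h => hy (hg (h.trans hgb.symm))
  have hpt : ∀ (g : Q → Q) (y : Q), Function.Injective g → g t = t → y ≠ t → g y ≠ t :=
    fun g y hg hgb hy h => hy (hg (h.trans hgb.symm))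
  have n13 : x1 ≠ x3 := by rintro rfl; exact hni _ _ _ hc3 hi1
  have n14 : x1 ≠ x4 := by rintro rfl; exact hni _ _ _ hc4 hi1
  have n15 : x1 ≠ x5 := by rintro rfl; exact hni _ _ _ hc5 hi1
  have n16 : x1 ≠ x6 := by rintro rfl; exact hb6 (hinj6 _ hi1)
  have n23 : x2 ≠ x3 := by rintro rfl; exact hni _ _ _ hc3 hi2
  have n24 : x2 ≠ x4 := by rintro rfl; exact hni _ _ _ hc4 hi2
  have n25 : x2 ≠ x5 := by rintro rfl; exact hni _ _ _ hc5 hi2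
  have n26 : x2 ≠ x6 := by rintro rfl; exact hb6 (hinj6 _ hi2)
  have n34 : x3 ≠ x4 := by
    rintro rfl
    rcases hc3.pair_eq hc4 with ⟨-, h⟩ | ⟨-, h⟩
    · exact hpb p3 q hp3 hp3b hq.1 (h.symm.trans hp4b)
    · exact hpb p3 p hp3 hp3b hp.1 (h.symm.trans hp4b)
  have n35 : x3 ≠ x5 := by
    rintro rfl
    rcases hc3.pair_eq hc5 with ⟨-, h⟩ | ⟨-, h⟩
    · exact hpt p3 q hp3 hp3t hq.2 (h.symm.trans hp5t)
    · exact hpt p3 p hp3 hp3t hp.2 (h.symm.trans hp5t)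
  have n36 : x3 ≠ x6 := by rintro rfl; exact hb6 hb3
  have n45 : x4 ≠ x5 := by
    rintro rfl
    rcases hc4.pair_eq hc5 with ⟨-, h⟩ | ⟨-, h⟩
    · exact hbt (hp4b.symm.trans (h.symm.trans hp5t))
    · exact hpt p4 p hp4 hp4t hp.2 (h.symm.trans hp5t)
  have n46 : x4 ≠ x6 := by rintro rfl; exact hb6 hb4
  have n56 : x5 ≠ x6 := by rintro rfl; exact hb6 hb5
  have hcard6 : ({x1, x2, x3, x4, x5, x6} : Finset α).card = 6 := by
    rw [Finset.card_insert_of_notMem, Finset.card_insert_of_notMem, Finset.card_insert_of_notMem,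
      Finset.card_insert_of_notMem, Finset.card_pair n56] <;>
    simp [*]
  rw [Nat.card_eq_fintype_card, ← hcard6]
  exact Finset.card_le_univ _

/-- Equality with the bound would force the transformations to be all of `flatMaps`, which needs six
letters. -/
theorem IsRegularTwoSidedIdeal.syntacticSize_lt [Finite α] {L : Language α}
    (h : IsRegularTwoSidedIdeal L) {n : ℕ} (hn : 5 ≤ n) (hL : complexity L = n)
    (hα : Nat.card α < 6) : syntacticSize L < semigroupBound n := by
  rcases h.syntacticSize_lt_or hn hL with h1 | h1
  · exact h1
  · have hb := h.bot_ne_top (by omega) hL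
    have hfin : Finite (quotients L) := h.finite_quotients
    have := Fintype.ofFinite (quotients L)
    have hL' : ENat.card (quotients L) = n := hL
    have hcard : Fintype.card (quotients L) = n := by
      have h2 := hL'
      rw [ENat.card_eq_coe_fintype_card] at h2
      exact_mod_cast h2
    rw [syntacticSize_eq_transformations, ← encard_flatMaps hL' hb]
    refine (Set.toFinite _).encard_lt_encard (h1.ssubset_of_ne fun he => ?_)
    have := six_le_card_of_transformations hb he (hn.trans_eq hcard.symm)
    omega

end Letters

end MostComplex

namespace MostComplex

/-! ### Generating sets of maps -/

section Generation

variable {Q : Type*} [DecidableEq Q]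

theorem comp_update_comp {s s' : Q → Q} (h1 : Function.LeftInverse s' s)
    (h2 : Function.RightInverse s' s) (p v : Q) :
    s ∘ Function.update id p v ∘ s' = Function.update id (s p) (s v) := by
  funext x
  by_cases hx : x = s p
  · subst hx
    simp [h1 p]
  · have : s' x ≠ p := fun h => hx (by rw [← h, h2 x])
    simp [Function.update_of_ne hx, Function.update_of_ne this, h2 x]

theorem comp_swap_comp {s s' : Q → Q} (h1 : Function.LeftInverse s' s)
    (h2 : Function.RightInverse s' s) (p q : Q) :
    s ∘ Equiv.swap p q ∘ s' = Equiv.swap (s p) (s q) := by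
  funext x
  obtain ⟨x, rfl⟩ : ∃ y, x = s y := ⟨s' x, (h2 x).symm⟩
  have hinj := h1.injective
  simp only [Function.comp_apply, h1 x]
  by_cases hp : x = p
  · simp [hp]
  by_cases hq : x = q
  · simp [hq]
  rw [Equiv.swap_apply_of_ne_of_ne hp hq,
    Equiv.swap_apply_of_ne_of_ne (hinj.ne hp) (hinj.ne hq)]

theorem swap_leftInverse (y z : Q) :
    Function.LeftInverse (Equiv.swap y z) (Equiv.swap y z) := fun x =>
  Equiv.ext_iff.1 (Equiv.swap_swap y z) x

theorem swap_comp_update_comp_swap (y z p v : Q) :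
    Equiv.swap y z ∘ Function.update id p v ∘ Equiv.swap y z =
      Function.update id (Equiv.swap y z p) (Equiv.swap y z v) :=
  comp_update_comp (swap_leftInverse y z) (swap_leftInverse y z) p v

/-- A set of maps that is closed under composition and contains the identity, the transpositions of
elements outside `{b, t}` and the maps that move one element outside `{b, t}` contains all maps
that fix `b` and `t`. -/
theorem mem_of_swap_update [Fintype Q] {T : Set (Q → Q)} {b t : Q} (hid : id ∈ T)
    (hcomp : ∀ g ∈ T, ∀ h ∈ T, h ∘ g ∈ T)
    (hswap : ∀ p q : Q, p ≠ b → p ≠ t → q ≠ b → q ≠ t → ⇑(Equiv.swap p q) ∈ T)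
    (hupd : ∀ p v : Q, p ≠ b → p ≠ t → Function.update id p v ∈ T) {f : Q → Q} (hb : f b = b)
    (ht : f t = t) : f ∈ T := by
  induction hk : (Finset.univ.filter fun q => f q ≠ q).card using Nat.strong_induction_on
    generalizing f with
  | _ k ih =>
  by_cases hinj : Function.Injective f
  · by_cases hall : ∀ q, f q = q
    · rwa [show f = id from funext hall]
    push Not at hall
    obtain ⟨p, hp⟩ := hall
    have hpb : p ≠ b := fun h => hp (by rw [h, hb])
    have hpt : p ≠ t := fun h => hp (by rw [h, ht])
    have hfb : f p ≠ b := fun h => hpb (hinj (h.trans hb.symm))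
    have hft : f p ≠ t := fun h => hpt (hinj (h.trans ht.symm))
    -- Composing with the transposition makes p a fixed point and, by injectivity, moves no point
    -- that was fixed before.
    have hf' : ⇑(Equiv.swap p (f p)) ∘ f ∈ T := by
      refine ih _ ?_ ?_ ?_ rfl
      · rw [← hk]
        refine Finset.card_lt_card ⟨fun q hq => ?_, fun hsub => ?_⟩
        · simp only [Finset.mem_filter, Finset.mem_univ, true_and, Function.comp_apply] at hq ⊢
          intro h
          rw [h] at hq
          refine hq (Equiv.swap_apply_of_ne_of_ne ?_ ?_)
          · rintro rfl; exact hp h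
          · intro h'
            exact hp ((hinj (h.trans h')) ▸ h)
        · have := hsub (Finset.mem_filter.2 ⟨Finset.mem_univ p, hp⟩)
          simp at this
      · simp [hb, Equiv.swap_apply_of_ne_of_ne hpb.symm hfb.symm]
      · simp [ht, Equiv.swap_apply_of_ne_of_ne hpt.symm hft.symm]
    have := hcomp _ hf' _ (hswap p (f p) hpb hpt hfb hft)
    rwa [← Function.comp_assoc, show ⇑(Equiv.swap p (f p)) ∘ ⇑(Equiv.swap p (f p)) = id from
      funext (swap_leftInverse p (f p)), Function.id_comp] at this
  · have hsurj : ¬ Function.Surjective f := fun h => hinj (Finite.injective_iff_surjective.2 h)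
    rw [Function.Surjective] at hsurj
    push Not at hsurj
    obtain ⟨p, hp⟩ := hsurj
    have hpb : p ≠ b := fun h => hp b (by rw [h, hb])
    have hpt : p ≠ t := fun h => hp t (by rw [h, ht])
    -- Here p is not a value of f. So p can first be kept in place and moved to f p afterwards: no
    -- other point is at p at that time.
    have hf' : Function.update f p p ∈ T := by
      refine ih _ ?_ ?_ ?_ rfl
      · rw [← hk]
        refine Finset.card_lt_card ⟨fun q hq => ?_, fun hsub => ?_⟩
        · simp only [Finset.mem_filter, Finset.mem_univ, true_and] at hq ⊢
          by_cases hqp : q = p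
          · subst hqp; exact hp q
          · rwa [Function.update_of_ne hqp] at hq
        · have := hsub (Finset.mem_filter.2 ⟨Finset.mem_univ p, hp p⟩)
          simp at this
      · rw [Function.update_of_ne hpb.symm, hb]
      · rw [Function.update_of_ne hpt.symm, ht]
    have := hcomp _ hf' _ (hupd p (f p) hpb hpt)
    convert this using 1
    funext q
    by_cases hqp : q = p
    · subst hqp; simp
    · simp [Function.update_of_ne hqp, Function.update_of_ne (hp q)]

end Generation

/-! ### Dialects of the witness -/

section Dialect

/-- When π is inverse to the renaming ψ, substituting letters in words amounts to relabelling the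
transitions; letters outside the range of ψ disappear. -/
theorem dialect_accepts {σ Γ Q : Type} {π : σ → Option Γ} {ψ : Γ → σ}
    (h : ∀ x g, π x = some g ↔ x = ψ g) (M : DFA σ Q) :
    dialect π M.accepts = (M.comap ψ).accepts := by
  have key : ∀ (u : List σ) (w : List Γ), u.map π = w.map some ↔ u = w.map ψ := by
    intro u
    induction u with
    | nil => intro w; cases w <;> simp
    | cons x u ih => intro w; cases w <;> simp [h, ih]
  ext w
  have h1 : w ∈ dialect π M.accepts ↔ ∃ u ∈ M.accepts, u.map π = w.map some := Iff.rfl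
  rw [h1, DFA.mem_accepts, DFA.eval_comap]
  simp only [key]
  constructor
  · rintro ⟨u, hu, rfl⟩; exact hu
  · intro hw; exact ⟨_, hw, rfl⟩

theorem keep_eq_some {σ : Type} {Γ : Set σ} (x : σ) (g : Γ) : keep Γ x = some g ↔ x = g.1 := by
  unfold keep
  split_ifs with h
  · simp only [Option.some.injEq]
    constructor
    · rintro rfl; rfl
    · rintro rfl; rfl
  · simp only [false_iff]
    rintro rfl
    exact h g.2

variable {β : Type} {n : ℕ}

/-- The automaton `D_n` in which the letter `x` plays the role of `φ x`. -/
def dialectDFA (φ : β → Letter) (hn : 5 ≤ n) : DFA β (Set.Icc 1 n) := (witnessDFA n hn).comap φ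

theorem witnessSwap_eq (hn : 5 ≤ n) :
    witnessSwap n hn = (dialectDFA (Equiv.swap Letter.a Letter.b) hn).accepts := by
  refine dialect_accepts (fun x g => ?_) (witnessDFA n hn)
  rw [Option.some.injEq, Equiv.swap_apply_eq_iff]

theorem witnessOn_eq (Γ : Set Letter) (hn : 5 ≤ n) :
    witnessOn Γ n hn = (dialectDFA (Subtype.val : Γ → Letter) hn).accepts :=
  dialect_accepts keep_eq_some (witnessDFA n hn)

theorem witnessSwapOn_eq (Γ : Set Letter) (hn : 5 ≤ n) :
    witnessSwapOn Γ n hn =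
      (dialectDFA (fun x : Γ => Equiv.swap Letter.a Letter.b x.1) hn).accepts := by
  refine dialect_accepts (fun x g => ?_) (witnessDFA n hn)
  rw [keep_eq_some, Equiv.swap_apply_eq_iff]

theorem witness_eq (hn : 5 ≤ n) : witness n hn = (dialectDFA id hn).accepts := rfl

/-- The initial state. -/
def bot (hn : 5 ≤ n) : Set.Icc 1 n := ⟨1, le_rfl, by omega⟩

/-- The final state. -/
def top (hn : 5 ≤ n) : Set.Icc 1 n := ⟨n, by omega, le_rfl⟩

/-- The state `2`. -/
def two (hn : 5 ≤ n) : Set.Icc 1 n := ⟨2, by omega, by omega⟩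

variable {φ : β → Letter} {hn : 5 ≤ n}

theorem bot_ne_top (hn : 5 ≤ n) : bot hn ≠ top hn := fun h => by
  have : 1 = n := congrArg Subtype.val h
  omega

theorem two_ne_top (hn : 5 ≤ n) : two hn ≠ top hn := fun h => by
  have : 2 = n := congrArg Subtype.val h
  omega

theorem two_ne_bot (hn : 5 ≤ n) : two hn ≠ bot hn := fun h => by
  have : 2 = 1 := congrArg Subtype.val h
  omega

theorem ne_bot_iff (q : Set.Icc 1 n) : q ≠ bot hn ↔ 2 ≤ q.1 := by
  have h1 : q = bot hn ↔ q.1 = 1 := Subtype.ext_iff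
  have h2 := q.2.1
  rw [ne_eq, h1]
  omega

theorem ne_top_iff (q : Set.Icc 1 n) : q ≠ top hn ↔ q.1 ≤ n - 1 := by
  have h1 : q = top hn ↔ q.1 = n := Subtype.ext_iff
  have h2 := q.2.2
  rw [ne_eq, h1]
  omega

theorem dialectDFA_step_val (q : Set.Icc 1 n) (x : β) :
    ((dialectDFA φ hn).step q x).1 = delta n (φ x) q.1 := rfl

theorem dialectDFA_accept (q : Set.Icc 1 n) : q ∈ (dialectDFA φ hn).accept ↔ q = top hn := Iff.rfl

theorem dialectDFA_start : (dialectDFA φ hn).start = bot hn := rfl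

theorem mem_acceptsFrom_dialectDFA {q : Set.Icc 1 n} {w : List β} :
    w ∈ (dialectDFA φ hn).acceptsFrom q ↔ (dialectDFA φ hn).evalFrom q w = top hn := Iff.rfl

theorem step_top (x : β) : (dialectDFA φ hn).step (top hn) x = top hn := by
  refine Subtype.ext ?_
  rw [dialectDFA_step_val]
  show delta n (φ x) n = n
  cases φ x <;> simp only [delta] <;> split_ifs <;> omega

theorem evalFrom_top (w : List β) : (dialectDFA φ hn).evalFrom (top hn) w = top hn := by
  induction w with
  | nil => rfl
  | cons x w ih => rw [DFA.evalFrom_cons, step_top, ih]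

theorem step_e {x : β} (hx : φ x = .e) {q : Set.Icc 1 n} (hq : q ≠ top hn) :
    (dialectDFA φ hn).step q x = two hn := by
  refine Subtype.ext ?_
  rw [dialectDFA_step_val, hx]
  rw [ne_top_iff] at hq
  simp only [delta, hq, if_true]
  rfl

theorem step_f {x : β} (hx : φ x = .f) :
    (fun q => (dialectDFA φ hn).step q x) = Function.update id (two hn) (top hn) := by
  funext q
  refine Subtype.ext ?_
  rw [dialectDFA_step_val, hx]
  by_cases hq : q = two hn
  · subst hq
    rw [Function.update_self]
    simp [delta, two, top]
  · rw [Function.update_of_ne hq]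
    have : q.1 ≠ 2 := fun h => hq (Subtype.ext h)
    simp [delta, this]

theorem step_injective_a {x : β} (hx : φ x = .a) :
    Function.Injective fun q => (dialectDFA φ hn).step q x := by
  intro p q h
  have h := congrArg Subtype.val h
  simp only [dialectDFA_step_val, hx, delta] at h
  have hp := p.2
  have hq := q.2
  simp only [Set.mem_Icc] at hp hq
  refine Subtype.ext ?_
  split_ifs at h <;> omega

theorem step_injective_b {x : β} (hx : φ x = .b) :
    Function.Injective fun q => (dialectDFA φ hn).step q x := by
  intro p q h
  have h := congrArg Subtype.val h
  simp only [dialectDFA_step_val, hx, delta] at h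
  refine Subtype.ext ?_
  split_ifs at h <;> omega

theorem step_bot {x : β} (hx : φ x ≠ .e) : (dialectDFA φ hn).step (bot hn) x = bot hn := by
  refine Subtype.ext ?_
  rw [dialectDFA_step_val]
  show delta n (φ x) 1 = 1
  generalize φ x = y at hx
  cases y <;> simp only [delta] <;> first | (split_ifs <;> omega) | exact absurd rfl hx

theorem step_a_val {x : β} (hx : φ x = .a) {q : Set.Icc 1 n} (h1 : 2 ≤ q.1) (h2 : q.1 < n - 1) :
    ((dialectDFA φ hn).step q x).1 = q.1 + 1 := by
  rw [dialectDFA_step_val, hx]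
  simp [delta, h1, h2]

/-- All states other than `1` and `n` are reached from the state `2` by powers of `a`. -/
theorem exists_evalFrom_two {x : β} (hx : φ x = .a) {q : Set.Icc 1 n} (hb : q ≠ bot hn)
    (ht : q ≠ top hn) : ∃ k, (dialectDFA φ hn).evalFrom (two hn) (List.replicate k x) = q := by
  rw [ne_bot_iff] at hb
  rw [ne_top_iff] at ht
  have key : ∀ k, 2 + k ≤ n - 1 →
      ((dialectDFA φ hn).evalFrom (two hn) (List.replicate k x)).1 = 2 + k := by
    intro k
    induction k with
    | zero => intro _; rfl
    | succ k ih =>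
      intro hk
      have := ih (by omega)
      rw [List.replicate_succ', DFA.evalFrom_append_singleton, step_a_val hx (by omega) (by omega),
        this]
      omega
  refine ⟨q.1 - 2, Subtype.ext ?_⟩
  rw [key _ (by omega)]
  omega

/-- Conjugating `f` by powers of the permutation `a` moves its source from 2 to any other middle
state, while n stays fixed. -/
theorem update_top_mem {x y : β} (hx : φ x = .a) (hy : φ y = .f) {p : Set.Icc 1 n}
    (hb : p ≠ bot hn) (ht : p ≠ top hn) :
    Function.update id p (top hn) ∈ transformations (dialectDFA φ hn) := by
  obtain ⟨k, rfl⟩ := exists_evalFrom_two hx hb ht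
  clear hb ht
  induction k with
  | zero =>
    rw [List.replicate_zero, DFA.evalFrom_nil, ← step_f hy]
    exact step_mem_transformations _ y
  | succ k ih =>
    rw [List.replicate_succ', DFA.evalFrom_append_singleton]
    set s := fun q => (dialectDFA φ hn).step q x
    have hs : s ∈ transformations (dialectDFA φ hn) := step_mem_transformations _ x
    obtain ⟨s', hs', h1, h2⟩ := exists_leftInverse_mem_transformations hs (step_injective_a hx)
    have := comp_mem_transformations (comp_mem_transformations hs' ih) hs
    rw [comp_update_comp h1 h2] at this
    have htop : s (top hn) = top hn := step_top x
    rwa [htop] at this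

/-- For distinct states, one of them is not 1; a word sending only that state to n separates it from
the other if both are nonfinal. The final state is recognised by the empty word. -/
theorem isMinimalDFA_dialectDFA {x y z : β} (hx : φ x = .a) (hy : φ y = .e) (hz : φ z = .f) :
    IsMinimalDFA (dialectDFA φ hn) := by
  have hsep : ∀ p q : Set.Icc 1 n, p ≠ bot hn → p ≠ q →
      (dialectDFA φ hn).acceptsFrom p ≠ (dialectDFA φ hn).acceptsFrom q := by
    intro p q hp hpq h
    by_cases hpt : p = top hn
    · have : [] ∈ (dialectDFA φ hn).acceptsFrom p := hpt
      rw [h] at this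
      exact hpq (hpt.trans (Eq.symm this))
    by_cases hqt : q = top hn
    · have : [] ∈ (dialectDFA φ hn).acceptsFrom q := hqt
      rw [← h] at this
      exact hpt this
    obtain ⟨w, -, hw⟩ := update_top_mem hx hz hp hpt
    have h1 : w ∈ (dialectDFA φ hn).acceptsFrom p := by
      rw [mem_acceptsFrom_dialectDFA, hw, Function.update_self]
    rw [h, mem_acceptsFrom_dialectDFA, hw, Function.update_of_ne (Ne.symm hpq)] at h1
    exact hqt h1
  refine ⟨fun q => ?_, fun p q h => ?_⟩
  · by_cases hb : q = bot hn
    · exact ⟨[], hb.symm⟩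
    by_cases ht : q = top hn
    · refine ⟨[y, z], ?_⟩
      rw [ht, DFA.eval, DFA.evalFrom_cons, dialectDFA_start, step_e hy (bot_ne_top hn),
        DFA.evalFrom_singleton]
      have := congrFun (step_f (φ := φ) (hn := hn) hz) (two hn)
      rwa [Function.update_self] at this
    · obtain ⟨k, hk⟩ := exists_evalFrom_two hx hb ht
      refine ⟨y :: List.replicate k x, ?_⟩
      rw [DFA.eval, DFA.evalFrom_cons, dialectDFA_start, step_e hy (bot_ne_top hn), hk]
  · by_contra hpq
    by_cases hp : p = bot hn
    · exact hsep q p (fun hq => hpq (hp.trans hq.symm)) (Ne.symm hpq) h.symm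
    · exact hsep p q hp hpq h

theorem comp_mem_flatMaps {Q : Type*} {b t : Q} {g h : Q → Q} (hg : g ∈ flatMaps b t)
    (hh : h ∈ flatMaps b t) : h ∘ g ∈ flatMaps b t := by
  refine ⟨?_, ?_⟩
  · simp [hg.1, hh.1]
  · simp only [Function.comp_apply]
    rcases hg.2 with hgb | hgb
    · rw [hgb]
      rcases hh.2 with hhb | hhb
      · exact Or.inl hhb
      · exact Or.inr fun q => hhb (g q)
    · right
      intro q
      rcases hgb q with h1 | h1
      · left; rw [h1]
      · right; rw [h1, hh.1]

theorem transformations_subset {α Q : Type} {M : DFA α Q} {T : Set (Q → Q)}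
    (hstep : ∀ x, (fun q => M.step q x) ∈ T) (hcomp : ∀ g ∈ T, ∀ h ∈ T, h ∘ g ∈ T) :
    transformations M ⊆ T := by
  rintro g ⟨w, hw, hg⟩
  obtain rfl : (fun q => M.evalFrom q w) = g := funext hg
  clear hg
  induction w using List.reverseRecOn with
  | nil => exact absurd rfl hw
  | append_singleton w x ih =>
    by_cases hw' : w = []
    · subst hw'; exact hstep x
    · have := hcomp _ (ih hw') _ (hstep x)
      convert this using 1
      funext q
      simp

theorem transformations_dialectDFA_subset :
    transformations (dialectDFA φ hn) ⊆ flatMaps (bot hn) (top hn) := by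
  refine transformations_subset (fun x => ⟨step_top x, ?_⟩) fun g hg h hh => comp_mem_flatMaps hg hh
  by_cases hx : φ x = .e
  · right
    intro q
    by_cases hq : q = top hn
    · right; rw [hq]; exact step_top x
    · left
      show (dialectDFA φ hn).step q x = (dialectDFA φ hn).step (bot hn) x
      rw [step_e hx hq, step_e hx (bot_ne_top hn)]
  · exact Or.inl (step_bot hx)

/-- An accepted word moves 1 to n. Since its transformation lies in `flatMaps`, all its values are
then n, so the word may be surrounded by anything. -/
theorem isRegularTwoSidedIdeal_dialectDFA {y z : β} (hy : φ y = .e) (hz : φ z = .f) :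
    IsRegularTwoSidedIdeal (dialectDFA φ hn).accepts := by
  refine isRegularTwoSidedIdeal_of_forall (x := [y, z]) ⟨_, inferInstance, _, rfl⟩ ?_ ?_
  · show (dialectDFA φ hn).step ((dialectDFA φ hn).step (bot hn) y) z = top hn
    rw [step_e hy (bot_ne_top hn)]
    have := congrFun (step_f (φ := φ) (hn := hn) hz) (two hn)
    rwa [Function.update_self] at this
  · intro w hw u v
    have hw' : (dialectDFA φ hn).evalFrom (bot hn) w = top hn := hw
    have hne : w ≠ [] := by
      rintro rfl
      exact bot_ne_top hn hw'
    have hmem : (fun q => (dialectDFA φ hn).evalFrom q w) ∈ flatMaps (bot hn) (top hn) :=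
      transformations_dialectDFA_subset ⟨w, hne, fun _ => rfl⟩
    have hall : ∀ q, (dialectDFA φ hn).evalFrom q w = top hn := by
      intro q
      rcases hmem.2 with h | h
      · exact absurd (h.symm.trans hw') (bot_ne_top hn)
      · rcases h q with h | h
        · exact h.trans hw'
        · exact h
    show (dialectDFA φ hn).evalFrom (bot hn) (u ++ w ++ v) = top hn
    rw [evalFrom_append, evalFrom_append, hall, evalFrom_top]

theorem enatCard_states (n : ℕ) : ENat.card (Set.Icc 1 n) = n := by
  rw [ENat.card_eq_coe_fintype_card]
  simp

theorem complexity_dialectDFA {x y z : β} (hx : φ x = .a) (hy : φ y = .e) (hz : φ z = .f) :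
    complexity (dialectDFA φ hn).accepts = n := by
  rw [(isMinimalDFA_dialectDFA hx hy hz).complexity, enatCard_states]

end Dialect

end MostComplex

namespace MostComplex

section Witness

variable {β : Type} {n : ℕ} {φ : β → Letter} {hn : 5 ≤ n}

/-! ### The syntactic semigroup -/

theorem three_mem (hn : 5 ≤ n) : 3 ∈ Set.Icc 1 n := ⟨by omega, by omega⟩

theorem pred_mem (hn : 5 ≤ n) : n - 1 ∈ Set.Icc 1 n := ⟨by omega, by omega⟩

theorem step_b {x : β} (hx : φ x = .b) : (fun q => (dialectDFA φ hn).step q x) =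
    Equiv.swap (two hn) ⟨3, three_mem hn⟩ := by
  funext q
  refine Subtype.ext ?_
  rw [dialectDFA_step_val, hx]
  have e2 : q = two hn ↔ q.1 = 2 := Subtype.ext_iff
  have e3 : q = ⟨3, three_mem hn⟩ ↔ q.1 = 3 := Subtype.ext_iff
  simp only [delta, Equiv.swap_apply_def, e2, e3]
  split_ifs <;> rfl

theorem step_c {x : β} (hx : φ x = .c) : (fun q => (dialectDFA φ hn).step q x) =
    Function.update id ⟨n - 1, pred_mem hn⟩ (two hn) := by
  funext q
  refine Subtype.ext ?_
  rw [dialectDFA_step_val, hx]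
  have e : q = ⟨n - 1, pred_mem hn⟩ ↔ q.1 = n - 1 := Subtype.ext_iff
  simp only [delta, Function.update_apply, e]
  split_ifs <;> rfl

theorem step_d {x : β} (hx : φ x = .d) : (fun q => (dialectDFA φ hn).step q x) =
    Function.update id ⟨n - 1, pred_mem hn⟩ (bot hn) := by
  funext q
  refine Subtype.ext ?_
  rw [dialectDFA_step_val, hx]
  have e : q = ⟨n - 1, pred_mem hn⟩ ↔ q.1 = n - 1 := Subtype.ext_iff
  simp only [delta, Function.update_apply, e]
  split_ifs <;> rfl

theorem swap_mem_transformations {x y : β} (hx : φ x = .a) (hy : φ y = .b) {p q : Set.Icc 1 n}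
    (hpb : p ≠ bot hn) (hpt : p ≠ top hn) (hqb : q ≠ bot hn) (hqt : q ≠ top hn) :
    ⇑(Equiv.swap p q) ∈ transformations (dialectDFA φ hn) := by
  set s := fun q => (dialectDFA φ hn).step q x with hs_def
  have hs : s ∈ transformations (dialectDFA φ hn) := step_mem_transformations _ x
  obtain ⟨s', hs', h1, h2⟩ := exists_leftInverse_mem_transformations hs (step_injective_a hx)
  -- Neighbouring transpositions are the conjugates of `b` by powers of `a`; the remaining ones
  -- follow by conjugating with neighbouring transpositions.
  have hadj : ∀ k, ∀ p q : Set.Icc 1 n, p.1 = 2 + k → q.1 = 3 + k → q.1 ≤ n - 1 →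
      ⇑(Equiv.swap p q) ∈ transformations (dialectDFA φ hn) := by
    intro k
    induction k with
    | zero =>
      intro p q hp hq _
      obtain rfl : p = two hn := Subtype.ext hp
      obtain rfl : q = ⟨3, three_mem hn⟩ := Subtype.ext hq
      rw [← step_b hy]
      exact step_mem_transformations _ y
    | succ k ih =>
      intro p q hp hq hqn
      have := comp_mem_transformations (comp_mem_transformations hs'
        (ih ⟨2 + k, by omega, by omega⟩ ⟨3 + k, by omega, by omega⟩ rfl rfl
          (show 3 + k ≤ n - 1 by omega))) hs
      rw [comp_swap_comp h1 h2] at this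
      convert this using 3
      · refine Subtype.ext ?_
        rw [hs_def, step_a_val hx (show 2 ≤ 2 + k by omega) (show 2 + k < n - 1 by omega), hp]
        show 2 + (k + 1) = 2 + k + 1
        omega
      · refine Subtype.ext ?_
        rw [hs_def, step_a_val hx (show 2 ≤ 3 + k by omega) (show 3 + k < n - 1 by omega), hq]
        show 3 + (k + 1) = 3 + k + 1
        omega
  have hdist : ∀ k, ∀ p q : Set.Icc 1 n, 2 ≤ p.1 → q.1 = p.1 + k + 1 → q.1 ≤ n - 1 →
      ⇑(Equiv.swap p q) ∈ transformations (dialectDFA φ hn) := by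
    intro k
    induction k with
    | zero =>
      intro p q hp hq hqn
      exact hadj (p.1 - 2) p q (by omega) (by omega) hqn
    | succ k ih =>
      intro p q hp hq hqn
      have hr : q.1 - 1 ∈ Set.Icc 1 n := ⟨by omega, by omega⟩
      have h3 := ih p ⟨q.1 - 1, hr⟩ hp (show q.1 - 1 = _ by omega) (show q.1 - 1 ≤ _ by omega)
      have h4 := hadj (q.1 - 3) ⟨q.1 - 1, hr⟩ q (show q.1 - 1 = _ by omega) (by omega) hqn
      have := comp_mem_transformations (comp_mem_transformations h4 h3) h4
      rw [comp_swap_comp (swap_leftInverse _ _) (swap_leftInverse _ _),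
        Equiv.swap_apply_left, Equiv.swap_apply_of_ne_of_ne] at this
      · exact this
      · intro h
        have : p.1 = q.1 - 1 := congrArg Subtype.val h
        omega
      · intro h
        have : p.1 = q.1 := congrArg Subtype.val h
        omega
  have hp2 := (ne_bot_iff p).1 hpb
  have hq2 := (ne_bot_iff q).1 hqb
  have hpn := (ne_top_iff p).1 hpt
  have hqn := (ne_top_iff q).1 hqt
  rcases lt_trichotomy p.1 q.1 with h | h | h
  · exact hdist (q.1 - p.1 - 1) p q hp2 (by omega) hqn
  · obtain rfl : p = q := Subtype.ext h
    have h5 := hadj 0 (two hn) ⟨3, three_mem hn⟩ rfl rfl (show 3 ≤ n - 1 by omega)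
    have := comp_mem_transformations h5 h5
    rw [Equiv.swap_self]
    convert this using 1
    exact (funext (swap_leftInverse (two hn) (⟨3, three_mem hn⟩ : Set.Icc 1 n))).symm
  · rw [Equiv.swap_comm]
    exact hdist (p.1 - q.1 - 1) q p hq2 (by omega) hpn

/-- All permutations of the middle states come from `a` and `b`. Conjugating `c`, `d` and `f` with
them gives the maps moving one middle state anywhere, hence all maps fixing 1 and n. The letter `e`
supplies the maps that move 1. -/
theorem transformations_dialectDFA_eq (hφ : Function.Surjective φ) :
    transformations (dialectDFA φ hn) = flatMaps (bot hn) (top hn) := by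
  refine subset_antisymm transformations_dialectDFA_subset ?_
  obtain ⟨a, ha⟩ := hφ .a
  obtain ⟨b, hb⟩ := hφ .b
  obtain ⟨c, hc⟩ := hφ .c
  obtain ⟨d, hd⟩ := hφ .d
  obtain ⟨e, he⟩ := hφ .e
  obtain ⟨f, hf⟩ := hφ .f
  have hswap : ∀ p q : Set.Icc 1 n, p ≠ bot hn → p ≠ top hn → q ≠ bot hn → q ≠ top hn →
      ⇑(Equiv.swap p q) ∈ transformations (dialectDFA φ hn) := fun p q h1 h2 h3 h4 =>
    swap_mem_transformations ha hb h1 h2 h3 h4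
  have hid : id ∈ transformations (dialectDFA φ hn) := by
    have := hswap (two hn) (two hn) (two_ne_bot hn) (two_ne_top hn) (two_ne_bot hn) (two_ne_top hn)
    rwa [Equiv.swap_self] at this
  have hconj : ∀ y z p v : Set.Icc 1 n, y ≠ bot hn → y ≠ top hn → z ≠ bot hn → z ≠ top hn →
      Function.update id p v ∈ transformations (dialectDFA φ hn) →
      Function.update id (Equiv.swap y z p) (Equiv.swap y z v) ∈
        transformations (dialectDFA φ hn) := by
    intro y z p v h1 h2 h3 h4 h
    have h5 := hswap y z h1 h2 h3 h4
    have := comp_mem_transformations (comp_mem_transformations h5 h) h5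
    rwa [swap_comp_update_comp_swap] at this
  have hlb : (⟨n - 1, pred_mem hn⟩ : Set.Icc 1 n) ≠ bot hn :=
    (ne_bot_iff _).2 (show 2 ≤ n - 1 by omega)
  have hlt : (⟨n - 1, pred_mem hn⟩ : Set.Icc 1 n) ≠ top hn :=
    (ne_top_iff _).2 (le_refl (n - 1))
  have hl2 : (⟨n - 1, pred_mem hn⟩ : Set.Icc 1 n) ≠ two hn := by
    intro h
    have : n - 1 = 2 := congrArg Subtype.val h
    omega
  have hupd : ∀ p v : Set.Icc 1 n, p ≠ bot hn → p ≠ top hn →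
      Function.update id p v ∈ transformations (dialectDFA φ hn) := by
    intro p v hpb hpt
    by_cases hvt : v = top hn
    · subst hvt; exact update_top_mem ha hf hpb hpt
    by_cases hvb : v = bot hn
    · subst hvb
      have h1 := step_mem_transformations (dialectDFA φ hn) d
      rw [step_d hd] at h1
      have h2 := hconj _ p _ _ hlb hlt hpb hpt h1
      rwa [Equiv.swap_apply_left, Equiv.swap_apply_of_ne_of_ne hlb.symm hpb.symm] at h2
    by_cases hvp : v = p
    · subst hvp
      rwa [show Function.update id v v = (id : Set.Icc 1 n → Set.Icc 1 n) from
        Function.update_eq_self v id]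
    have h1 := step_mem_transformations (dialectDFA φ hn) c
    rw [step_c hc] at h1
    have h2 := hconj _ p _ _ hlb hlt hpb hpt h1
    rw [Equiv.swap_apply_left] at h2
    -- The target 2 of `c` is carried along by the conjugation: u is 2, or n − 1 if p = 2. A second
    -- conjugation takes u to v and leaves p alone.
    obtain ⟨u, hu⟩ : ∃ u, u = Equiv.swap (⟨n - 1, pred_mem hn⟩ : Set.Icc 1 n) p (two hn) := ⟨_, rfl⟩
    rw [← hu] at h2
    have hup : u ≠ p := by
      intro h
      rw [h, eq_comm, Equiv.swap_apply_eq_iff, Equiv.swap_apply_right] at hu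
      exact hl2 hu.symm
    have hubt : u ≠ bot hn ∧ u ≠ top hn := by
      rw [hu, Equiv.swap_apply_def]
      split_ifs
      · exact ⟨hpb, hpt⟩
      · exact ⟨hlb, hlt⟩
      · exact ⟨two_ne_bot hn, two_ne_top hn⟩
    have h3 := hconj u v _ _ hubt.1 hubt.2 hvb hvt h2
    rwa [Equiv.swap_apply_left, Equiv.swap_apply_of_ne_of_ne hup.symm (Ne.symm hvp)] at h3
  have hfix : ∀ g : Set.Icc 1 n → Set.Icc 1 n, g (bot hn) = bot hn → g (top hn) = top hn →
      g ∈ transformations (dialectDFA φ hn) := fun g h1 h2 =>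
    mem_of_swap_update hid (fun g hg h hh => comp_mem_transformations hg hh) hswap hupd h1 h2
  rintro g ⟨hgt, hg⟩
  by_cases hgb : g (bot hn) = bot hn
  · exact hfix g hgb hgt
  have hg := hg.resolve_left hgb
  have hE := step_mem_transformations (dialectDFA φ hn) e
  by_cases hgbt : g (bot hn) = top hn
  -- In this case g is constantly n, which is `e` followed by `f`.
  · have h1 := comp_mem_transformations hE (step_mem_transformations (dialectDFA φ hn) f)
    convert h1 using 1
    rw [step_f hf]
    funext q
    have hgq : g q = top hn := by
      rcases hg q with h | h
      · rw [h, hgbt]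
      · exact h
    rw [hgq]
    by_cases hq : q = top hn
    · rw [hq, Function.comp_apply, step_top, Function.update_of_ne (two_ne_top hn).symm]
      rfl
    · rw [Function.comp_apply, step_e he hq, Function.update_self]
  -- First send to n whatever g sends to n and fix the rest, then collapse the rest to 2 by `e`,
  -- then exchange 2 with the value of g at 1.
  · have h1 := hfix (fun q => if g q = top hn then top hn else q) (by simp [hgbt]) (by simp [hgt])
    have h2 := comp_mem_transformations (comp_mem_transformations h1 hE)
      (hswap (two hn) (g (bot hn)) (two_ne_bot hn) (two_ne_top hn) hgb hgbt)
    convert h2 using 1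
    funext q
    simp only [Function.comp_apply]
    by_cases hq : g q = top hn
    · rw [if_pos hq, step_top, Equiv.swap_apply_of_ne_of_ne (two_ne_top hn).symm (Ne.symm hgbt), hq]
    · have hqt : q ≠ top hn := fun h => hq (by rw [h, hgt])
      rw [if_neg hq, step_e he hqt, Equiv.swap_apply_left]
      exact (hg q).resolve_right hq

theorem syntacticSize_dialectDFA (hφ : Function.Surjective φ) :
    syntacticSize (dialectDFA φ hn).accepts = semigroupBound n := by
  obtain ⟨a, ha⟩ := hφ .a
  obtain ⟨e, he⟩ := hφ .e
  obtain ⟨f, hf⟩ := hφ .f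
  rw [(isMinimalDFA_dialectDFA ha he hf).syntacticSize, transformations_dialectDFA_eq hφ,
    encard_flatMaps (enatCard_states n) (bot_ne_top hn)]

/-! ### Quotients, atoms, star -/

/-- The nonfinal states can return to 1: `e` leads to 2, powers of `a` to n − 1, and `d` back to 1.
Hence each nonfinal quotient has all quotients of the language. -/
theorem complexity_acceptsFrom {a d e f : β} (ha : φ a = .a) (hd : φ d = .d) (he : φ e = .e)
    (hf : φ f = .f) {q : Set.Icc 1 n} (hq : q ≠ top hn) :
    complexity ((dialectDFA φ hn).acceptsFrom q) = n := by
  have hmin := isMinimalDFA_dialectDFA (hn := hn) ha he hf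
  have hreach : ∀ p, ∃ w, (dialectDFA φ hn).evalFrom q w = p := by
    intro p
    obtain ⟨w, hw⟩ := hmin.1 p
    by_cases hb : q = bot hn
    · exact ⟨w, by rw [hb]; exact hw⟩
    · obtain ⟨k, hk⟩ := exists_evalFrom_two (hn := hn) ha (q := ⟨n - 1, pred_mem hn⟩)
        ((ne_bot_iff _).2 (show 2 ≤ n - 1 by omega)) ((ne_top_iff _).2 (le_refl (n - 1)))
      refine ⟨e :: (List.replicate k a ++ (d :: w)), ?_⟩
      rw [DFA.evalFrom_cons, step_e he hq, evalFrom_append, hk, DFA.evalFrom_cons]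
      have := congrFun (step_d (φ := φ) (hn := hn) hd) ⟨n - 1, pred_mem hn⟩
      rw [Function.update_self] at this
      rw [this]
      exact hw
  have hset : quotients ((dialectDFA φ hn).acceptsFrom q) = quotients (dialectDFA φ hn).accepts := by
    rw [quotients_accepts hmin.1]
    ext K
    constructor
    · rintro ⟨w, rfl⟩
      exact ⟨_, (leftQuotient_acceptsFrom _ _ _).symm⟩
    · rintro ⟨p, rfl⟩
      obtain ⟨w, rfl⟩ := hreach p
      exact ⟨w, leftQuotient_acceptsFrom _ _ _⟩
  rw [complexity, hset]
  exact complexity_dialectDFA ha he hf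

theorem acceptsFrom_top : (dialectDFA φ hn).acceptsFrom (top hn) = ⊤ := by
  ext w
  exact ⟨fun _ => mem_top_language w, fun _ => evalFrom_top w⟩

theorem complexity_of_mem_quotients {a d e f : β} (ha : φ a = .a) (hd : φ d = .d) (he : φ e = .e)
    (hf : φ f = .f) {K : Language β} (hK : K ∈ quotients (dialectDFA φ hn).accepts) (hne : K ≠ ⊤) :
    complexity K = n := by
  rw [quotients_accepts (isMinimalDFA_dialectDFA ha he hf).1] at hK
  obtain ⟨q, rfl⟩ := hK
  refine complexity_acceptsFrom ha hd he hf fun h => hne ?_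
  rw [h, acceptsFrom_top]

/-- Every set of states that contains `n` and not `1` is the set of states that accept some word. -/
theorem exists_word_accepted_exactly {a f : β} (ha : φ a = .a) (hf : φ f = .f)
    (S : Set (Set.Icc 1 n)) (ht : top hn ∈ S) (hb : bot hn ∉ S) :
    ∃ w, ∀ q, (dialectDFA φ hn).evalFrom q w = top hn ↔ q ∈ S := by
  classical
  have key : ∀ F : Finset (Set.Icc 1 n), bot hn ∉ F →
      ∃ w, ∀ q, (dialectDFA φ hn).evalFrom q w = if q ∈ F then top hn else q := by
    intro F
    induction F using Finset.induction_on with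
    | empty => intro _; exact ⟨[], by simp⟩
    | insert p F hp ih =>
      intro hbF
      obtain ⟨w, hw⟩ := ih fun h => hbF (Finset.mem_insert_of_mem h)
      by_cases hpt : p = top hn
      · refine ⟨w, fun q => ?_⟩
        rw [hw]
        by_cases hq : q = p
        · subst hq; simp [hpt]
        · simp [hq]
      · obtain ⟨u, -, hu⟩ := update_top_mem (hn := hn) ha hf (p := p)
          (fun h => hbF (h ▸ Finset.mem_insert_self p F)) hpt
        refine ⟨u ++ w, fun q => ?_⟩
        rw [evalFrom_append, hu]
        by_cases hq : q = p
        · rw [hq, Function.update_self, evalFrom_top]; simp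
        · rw [Function.update_of_ne hq]; simp [hw, hq]
  obtain ⟨w, hw⟩ := key S.toFinset (by simpa using hb)
  refine ⟨w, fun q => ?_⟩
  rw [hw]
  by_cases hq : q ∈ S
  · simp [hq]
  · simp only [Set.mem_toFinset, hq, if_false, iff_false]
    rintro rfl
    exact hq ht

theorem encard_atoms_dialectDFA {a e f : β} (ha : φ a = .a) (he : φ e = .e) (hf : φ f = .f) :
    (atoms (dialectDFA φ hn).accepts).encard = ((2 ^ (n - 2) + 1 : ℕ) : ℕ∞) := by
  have hid := isRegularTwoSidedIdeal_dialectDFA (hn := hn) he hf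
  have hmin := isMinimalDFA_dialectDFA (hn := hn) ha he hf
  refine le_antisymm (hid.encard_atoms_le (by omega) (complexity_dialectDFA ha he hf)) ?_
  rw [← encard_sets_top_bot (enatCard_states n) (bot_ne_top hn), encard_atoms_accepts hmin.1]
  refine Set.encard_le_encard ?_
  rintro S ⟨ht, hb⟩
  by_cases hbS : bot hn ∈ S
  · rw [hb hbS]
    obtain ⟨w, hw⟩ := hid.exists_mem
    refine ⟨w, ?_⟩
    ext q
    refine ⟨fun _ => trivial, fun _ => ?_⟩
    have : (dialectDFA φ hn).acceptsFrom q ∈ quotients (dialectDFA φ hn).accepts := by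
      rw [quotients_accepts hmin.1]; exact ⟨q, rfl⟩
    exact hid.le_quotient this hw
  · obtain ⟨w, hw⟩ := exists_word_accepted_exactly (hn := hn) ha hf S ht hbS
    exact ⟨w, Set.ext hw⟩

/-- The letter `a` fixes the initial state, so it is a non-empty word w with `w⁻¹L = L`. -/
theorem complexity_kstar_dialectDFA {a e f : β} (ha : φ a = .a) (he : φ e = .e) (hf : φ f = .f) :
    complexity (KStar.kstar (dialectDFA φ hn).accepts) = ((n + 1 : ℕ) : ℕ∞) := by
  refine (isRegularTwoSidedIdeal_dialectDFA he hf).complexity_kstar_eq (by omega)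
    (complexity_dialectDFA ha he hf) (w := [a]) (by simp) ?_
  rw [Language.leftQuotient_accepts_apply, DFA.eval_singleton, dialectDFA_start,
    step_bot (by rw [ha]; simp)]
  rfl

/-! ### Product -/

/-- The word ef is accepted from every nonfinal state, but e is not. So ef lies in every quotient of
`L` and in no product X L with X ≠ `⊤`: this keeps the two families disjoint. If w lies in X but not
in Y, then w followed by ef separates X L from Y L. -/
theorem complexity_mul_dialectDFA {m : ℕ} {hm : 5 ≤ m} {a e f : β} (ha : φ a = .a) (he : φ e = .e)
    (hf : φ f = .f) :
    complexity ((dialectDFA φ hm).accepts * (dialectDFA φ hn).accepts) =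
      ((m + n - 1 : ℕ) : ℕ∞) := by
  set K := (dialectDFA φ hm).accepts with hK_def
  set L := (dialectDFA φ hn).accepts with hL_def
  have hK : IsRegularTwoSidedIdeal K := isRegularTwoSidedIdeal_dialectDFA he hf
  have hL : IsRegularTwoSidedIdeal L := isRegularTwoSidedIdeal_dialectDFA he hf
  have hKm : complexity K = m := complexity_dialectDFA ha he hf
  have hLn : complexity L = n := complexity_dialectDFA ha he hf
  have hKtop := ne_top_of_complexity (by omega) hKm
  have hLtop := ne_top_of_complexity (by omega) hLn
  have hminK := isMinimalDFA_dialectDFA (hn := hm) ha he hf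
  have hef : [e, f] ∈ L := by
    show (dialectDFA φ hn).step ((dialectDFA φ hn).step (bot hn) e) f = top hn
    rw [step_e he (bot_ne_top hn)]
    have := congrFun (step_f (φ := φ) (hn := hn) hf) (two hn)
    rwa [Function.update_self] at this
  have hKef : ∀ X ∈ quotients K, X ≠ ⊤ → [e] ∉ X ∧ [e, f] ∈ X := by
    intro X hX hne
    rw [hK_def, quotients_accepts hminK.1] at hX
    obtain ⟨q, rfl⟩ := hX
    have hq : q ≠ top hm := by
      rintro rfl
      exact hne acceptsFrom_top
    constructor
    · rw [mem_acceptsFrom_dialectDFA, DFA.evalFrom_singleton, step_e he hq]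
      exact two_ne_top hm
    · rw [mem_acceptsFrom_dialectDFA, DFA.evalFrom_cons, step_e he hq, DFA.evalFrom_singleton]
      have := congrFun (step_f (φ := φ) (hn := hm) hf) (two hm)
      rwa [Function.update_self] at this
  have hnot : ∀ X ∈ quotients K, X ≠ ⊤ → [e, f] ∉ X * L := by
    intro X hX hne hmem
    obtain ⟨u, hu, v, hv, huv⟩ := Language.mem_mul.1 hmem
    have hXef := hKef X hX hne
    have hv0 : v ≠ [] := by
      rintro rfl
      exact hL.nil_notMem hLtop hv
    rcases u with _ | ⟨x, _ | ⟨y, u⟩⟩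
    · exact hne (hK.eq_top hX hu)
    · simp only [List.cons_append, List.nil_append, List.cons.injEq] at huv
      rw [huv.1] at hu
      exact hXef.1 hu
    · simp only [List.cons_append, List.cons.injEq, List.append_eq_nil_iff] at huv
      exact hv0 huv.2.2.2
  have hlq : ∀ X ∈ quotients K, ∀ w, w ∉ X → (X * L).leftQuotient w = X.leftQuotient w * L := by
    rintro _ ⟨u, rfl⟩ w hw
    have hu : u ∉ K := by
      intro hu
      refine hw ?_
      rw [hK.leftQuotient_eq_top (self_mem_quotients K) hu]
      trivial
    rw [← hK.leftQuotient_mul_of_notMem hu, ← Language.leftQuotient_append,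
      ← Language.leftQuotient_append, hK.leftQuotient_mul_of_notMem]
    exact hw
  have hsep : ∀ X ∈ quotients K, ∀ Y ∈ quotients K, X * L = Y * L → ∀ w ∈ X, w ∈ Y := by
    intro X hX Y hY h w hwX
    by_contra hwY
    have h1 : w ++ [e, f] ∈ X * L := Language.append_mem_mul hwX hef
    rw [h, ← Language.mem_leftQuotient, hlq Y hY w hwY] at h1
    refine hnot _ (leftQuotient_mem_quotients hY w) (fun htop => hwY ?_) h1
    have : [] ∈ Y.leftQuotient w := by rw [htop]; trivial
    rwa [Language.mem_leftQuotient, List.append_nil] at this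
  have hinj : Set.InjOn (· * L) (quotients K \ {⊤}) := by
    intro X hX Y hY h
    ext w
    exact ⟨hsep X hX.1 Y hY.1 h w, hsep Y hY.1 X hX.1 h.symm w⟩
  have hdisj : Disjoint ((· * L) '' (quotients K \ {⊤})) (quotients L) := by
    rw [Set.disjoint_left]
    rintro _ ⟨X, hX, rfl⟩ hmem
    exact hnot X hX.1 hX.2 (hL.le_quotient hmem hef)
  have hLn' : (quotients L).encard = n := hLn
  rw [complexity, hK.quotients_mul hL hKtop, Set.encard_union_eq hdisj, hinj.encard_image,
    hK.encard_quotients_diff_top hKm, hLn', ← Nat.cast_add]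
  congr 1
  omega

end Witness

end MostComplex

namespace MostComplex

/-! ### Counting pairs of sets -/

section Counting

theorem sum_Icc_one_eq_sum_range (s : ℕ) (g : ℕ → ℕ) :
    ∑ x ∈ Finset.Icc 1 s, g x = ∑ x ∈ Finset.range s, g (x + 1) := by
  induction s with
  | zero => simp
  | succ s ih => rw [Finset.sum_Icc_succ_top (by omega), ih, Finset.sum_range_succ]

variable {Q : Type} [DecidableEq Q]

/-- The pairs of disjoint sets `X ∋ t` and `Y ∋ b` with at most `s` and `r` elements. -/
def atomPairs [Fintype Q] (b t : Q) (s r : ℕ) : Finset (Finset Q × Finset Q) :=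
  Finset.univ.filter fun p =>
    t ∈ p.1 ∧ b ∈ p.2 ∧ Disjoint p.1 p.2 ∧ p.1.card ≤ s ∧ p.2.card ≤ r

theorem mem_atomPairs [Fintype Q] {b t : Q} {s r : ℕ} {p : Finset Q × Finset Q} :
    p ∈ atomPairs b t s r ↔
      t ∈ p.1 ∧ b ∈ p.2 ∧ Disjoint p.1 p.2 ∧ p.1.card ≤ s ∧ p.2.card ≤ r := by
  simp [atomPairs]

theorem card_biUnion_powersetCard (F : Finset Q) (s : ℕ) :
    ((Finset.range s).biUnion fun x => Finset.powersetCard x F).card =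
      ∑ x ∈ Finset.range s, F.card.choose x := by
  rw [Finset.card_biUnion fun i _ j _ hij => Finset.pairwise_disjoint_powersetCard F hij]
  exact Finset.sum_congr rfl fun x _ => Finset.card_powersetCard x F

/-- Removing t from X and b from Y leaves disjoint subsets of the n − 2 other elements, of sizes x −
1 and y − 1; the second is chosen among the n − x − 1 elements left by the first. -/
theorem card_atomPairs [Fintype Q] {n : ℕ} (hQ : Fintype.card Q = n) {b t : Q} (hbt : b ≠ t) (s r : ℕ) :
    (atomPairs b t s r).card = ∑ x ∈ Finset.Icc 1 s, ∑ y ∈ Finset.Icc 1 r,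
      (n - 2).choose (x - 1) * (n - x - 1).choose (y - 1) := by
  let mid : Finset Q := {b, t}ᶜ
  have hmid : mid.card = n - 2 := by
    rw [Finset.card_compl, Finset.card_pair hbt, hQ]
  have hbm : b ∉ mid := by simp [mid]
  have htm : t ∉ mid := by simp [mid]
  have hmem : ∀ x, x ∈ mid ↔ x ≠ b ∧ x ≠ t := by intro x; simp [mid]
  have hbij : (((Finset.range s).biUnion fun x => Finset.powersetCard x mid).sigma fun X =>
      (Finset.range r).biUnion fun y => Finset.powersetCard y (mid \ X)).card =
        (atomPairs b t s r).card := by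
    have hdom : ∀ p : (_ : Finset Q) × Finset Q,
        p ∈ (((Finset.range s).biUnion fun x => Finset.powersetCard x mid).sigma fun X =>
          (Finset.range r).biUnion fun y => Finset.powersetCard y (mid \ X)) ↔
        (p.1 ⊆ mid ∧ p.1.card < s) ∧ p.2 ⊆ mid \ p.1 ∧ p.2.card < r := by
      intro p
      simp only [Finset.mem_sigma, Finset.mem_biUnion, Finset.mem_range, Finset.mem_powersetCard]
      constructor
      · rintro ⟨⟨x, hx, h1, rfl⟩, ⟨y, hy, h2, rfl⟩⟩
        exact ⟨⟨h1, hx⟩, h2, hy⟩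
      · rintro ⟨⟨h1, hx⟩, h2, hy⟩
        exact ⟨⟨_, hx, h1, rfl⟩, _, hy, h2, rfl⟩
    refine Finset.card_bij (fun p _ => (insert t p.1, insert b p.2)) ?_ ?_ ?_
    · rintro ⟨X, Y⟩ hp
      obtain ⟨⟨h1, h2⟩, h3, h4⟩ := (hdom _).1 hp
      have hY : ∀ y ∈ Y, y ≠ b ∧ y ≠ t ∧ y ∉ X := fun y hy => by
        have := Finset.mem_sdiff.1 (h3 hy)
        exact ⟨((hmem y).1 this.1).1, ((hmem y).1 this.1).2, this.2⟩
      refine mem_atomPairs.2 ⟨Finset.mem_insert_self _ _, Finset.mem_insert_self _ _, ?_, ?_, ?_⟩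
      · rw [Finset.disjoint_left]
        intro x hx hy
        rcases Finset.mem_insert.1 hx with hx' | hx' <;>
          rcases Finset.mem_insert.1 hy with hy' | hy'
        · exact hbt (hy'.symm.trans hx')
        · exact (hY _ hy').2.1 hx'
        · exact hbm (hy' ▸ h1 hx')
        · exact (hY _ hy').2.2 hx'
      · exact (Finset.card_insert_le _ _).trans h2
      · exact (Finset.card_insert_le _ _).trans h4
    · rintro ⟨X, Y⟩ hp ⟨X', Y'⟩ hp' h
      obtain ⟨⟨h1, -⟩, h3, -⟩ := (hdom _).1 hp
      obtain ⟨⟨h1', -⟩, h3', -⟩ := (hdom _).1 hp'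
      simp only [Prod.mk.injEq] at h
      dsimp only at h1 h3 h1' h3'
      have e1 : X = X' := by
        rw [← Finset.erase_insert (fun h => htm (h1 h)), h.1,
          Finset.erase_insert (fun h => htm (h1' h))]
      have e2 : Y = Y' := by
        rw [← Finset.erase_insert (fun h => hbm (Finset.mem_sdiff.1 (h3 h)).1), h.2,
          Finset.erase_insert (fun h => hbm (Finset.mem_sdiff.1 (h3' h)).1)]
      rw [e1, e2]
    · rintro ⟨X, Y⟩ hp
      obtain ⟨h1, h2, h3, h4, h5⟩ := mem_atomPairs.1 hp
      have hd := Finset.disjoint_left.1 h3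
      refine ⟨⟨X.erase t, Y.erase b⟩, (hdom _).2 ⟨⟨?_, ?_⟩, ?_, ?_⟩, ?_⟩
      · intro x hx
        have hx := Finset.mem_erase.1 hx
        exact (hmem x).2 ⟨fun h => hd (h ▸ hx.2) h2, hx.1⟩
      · exact (Finset.card_erase_lt_of_mem h1).trans_le h4
      · intro x hx
        have hx := Finset.mem_erase.1 hx
        refine Finset.mem_sdiff.2 ⟨(hmem x).2 ⟨hx.1, fun h => hd h1 (h ▸ hx.2)⟩, fun h => ?_⟩
        exact hd (Finset.mem_erase.1 h).2 hx.2
      · exact (Finset.card_erase_lt_of_mem h2).trans_le h5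
      · simp [Finset.insert_erase h1, Finset.insert_erase h2]
  rw [← hbij, Finset.card_sigma, Finset.sum_biUnion fun i _ j _ hij =>
    Finset.pairwise_disjoint_powersetCard mid hij, sum_Icc_one_eq_sum_range]
  refine Finset.sum_congr rfl fun x _ => ?_
  have hterm : ∀ X ∈ Finset.powersetCard x mid,
      ((Finset.range r).biUnion fun y => Finset.powersetCard y (mid \ X)).card =
        ∑ y ∈ Finset.range r, (n - 2 - x).choose y := by
    intro X hX
    obtain ⟨h1, h2⟩ := Finset.mem_powersetCard.1 hX
    rw [card_biUnion_powersetCard, Finset.card_sdiff_of_subset h1, hmid, h2]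
  rw [Finset.sum_congr rfl hterm, Finset.sum_const, Finset.card_powersetCard, hmid,
    sum_Icc_one_eq_sum_range, smul_eq_mul, Finset.mul_sum]
  refine Finset.sum_congr rfl fun y _ => ?_
  have e1 : n - (x + 1) - 1 = n - 2 - x := by omega
  rw [e1]
  simp

open Classical in
/-- In a poset of `n` elements with least element `b`, there are at most `2 ^ (n - 2) + (n - 2)` pairs
of an element `q ≠ t` and a set of elements that are greater than `q` and different from `t` which is
upward closed up to `t`. -/
theorem card_upper_sets_le [Fintype Q] [PartialOrder Q] {n : ℕ} (hQ : Fintype.card Q = n) {b t : Q}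
    (hb : ∀ x, b ≤ x) (hbt : b ≠ t) (P : Finset (Q × Finset Q))
    (hP : ∀ p ∈ P, p.1 ≠ t ∧ (∀ k ∈ p.2, p.1 < k ∧ k ≠ t) ∧
      ∀ k ∈ p.2, ∀ l, k ≤ l → l ≠ t → l ∈ p.2) : P.card ≤ 2 ^ (n - 2) + (n - 2) := by
  let mid : Finset Q := {b, t}ᶜ
  have hmid : mid.card = n - 2 := by
    rw [Finset.card_compl, Finset.card_pair hbt, hQ]
  have hmem : ∀ x, x ∈ mid ↔ x ≠ b ∧ x ≠ t := by intro x; simp [mid]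
  let full : Q → Finset Q := fun q => Finset.univ.filter fun k => q < k ∧ k ≠ t
  -- For q = b the code is the upward closed set U itself. For q ≠ b the set {q} ∪ U is used when it
  -- is not upward closed, and q is recovered as its least element. If U consists of all admissible
  -- elements above q, then {q} replaces it; if U is empty, q goes to the second summand.
  let code : Q × Finset Q → Finset Q ⊕ Q := fun p =>
    if p.1 = b then Sum.inl p.2 else if p.2 = ∅ then Sum.inr p.1
    else if p.2 = full p.1 then Sum.inl {p.1} else Sum.inl (insert p.1 p.2)
  have hcard : P.card ≤ (mid.powerset.disjSum mid).card := by
    refine Finset.card_le_card_of_injOn code ?_ ?_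
    · rintro ⟨q, U⟩ hp
      obtain ⟨hqt, hU, -⟩ := hP _ (Finset.mem_coe.1 hp)
      have hUmid : U ⊆ mid := fun k hk =>
        (hmem k).2 ⟨((hb q).trans_lt (hU k hk).1).ne', (hU k hk).2⟩
      refine Finset.mem_coe.2 ?_
      show code (q, U) ∈ _
      by_cases hqb : q = b
      · simp only [code, hqb, if_true, Finset.inl_mem_disjSum, Finset.mem_powerset]
        exact hUmid
      have hqm : q ∈ mid := (hmem q).2 ⟨hqb, hqt⟩
      by_cases hU0 : U = ∅
      · simpa [code, hqb, hU0] using hqm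
      by_cases hUf : U = full q
      · simp only [code, hqb, hU0, if_false]
        rw [if_pos hUf, Finset.inl_mem_disjSum, Finset.mem_powerset, Finset.singleton_subset_iff]
        exact hqm
      · simp only [code, hqb, hU0, hUf, if_false, Finset.inl_mem_disjSum, Finset.mem_powerset]
        exact Finset.insert_subset hqm hUmid
    · rintro ⟨q, U⟩ hp ⟨q', U'⟩ hp' h
      obtain ⟨hqt, hU, hup⟩ := hP _ (Finset.mem_coe.1 hp)
      obtain ⟨hqt', hU', hup'⟩ := hP _ (Finset.mem_coe.1 hp')
      dsimp only at hqt hU hup hqt' hU' hup'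
      have hfull : ∀ (q : Q) (U : Finset Q), (∀ k ∈ U, q < k ∧ k ≠ t) → U ≠ full q →
          ∃ l, q < l ∧ l ≠ t ∧ l ∉ U := by
        intro q U hU hne
        by_contra hcon
        push Not at hcon
        refine hne (Finset.Subset.antisymm (fun k hk => ?_) fun k hk => ?_)
        · simpa [full] using hU k hk
        · have := (Finset.mem_filter.1 hk).2
          exact hcon k this.1 this.2
      have hq_notMem : ∀ (q : Q) (U : Finset Q), (∀ k ∈ U, q < k ∧ k ≠ t) → q ∉ U :=
        fun q U hU hq => lt_irrefl q (hU q hq).1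
      -- an upward closed set is never the code of a pair with `q ≠ b`
      have hmix : ∀ (q : Q) (U V : Finset Q), (∀ k ∈ U, q < k ∧ k ≠ t) →
          q ≠ t → (∀ k ∈ V, ∀ l, k ≤ l → l ≠ t → l ∈ V) → q ≠ b → code (q, U) ≠ Sum.inl V := by
        intro q U V hU hqt hV hqb hc
        by_cases hU0 : U = ∅
        · simp [code, hqb, hU0] at hc
        by_cases hUf : U = full q
        · simp only [code, hqb, hU0, if_false] at hc
          rw [if_pos hUf, Sum.inl.injEq] at hc
          obtain ⟨k, hk⟩ := Finset.nonempty_iff_ne_empty.2 hU0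
          have hkV := hV q (hc ▸ Finset.mem_singleton_self q) k (hU k hk).1.le (hU k hk).2
          rw [← hc, Finset.mem_singleton] at hkV
          exact (hU k hk).1.ne' hkV
        · simp only [code, hqb, hU0, hUf, if_false, Sum.inl.injEq] at hc
          obtain ⟨l, hl1, hl2, hl3⟩ := hfull q U hU hUf
          have hlV := hV q (hc ▸ Finset.mem_insert_self q U) l hl1.le hl2
          rw [← hc, Finset.mem_insert] at hlV
          rcases hlV with h | h
          · exact hl1.ne' h
          · exact hl3 h
      by_cases hqb : q = b <;> by_cases hqb' : q' = b
      · simp only [code, hqb, hqb', if_true, Sum.inl.injEq] at h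
        rw [hqb, hqb', h]
      · have e : code (q, U) = Sum.inl U := by simp [code, hqb]
        exact absurd (h.symm.trans e) (hmix q' U' U hU' hqt' hup hqb')
      · have e : code (q', U') = Sum.inl U' := by simp [code, hqb']
        exact absurd (h.trans e) (hmix q U U' hU hqt hup' hqb)
      · by_cases hU0 : U = ∅ <;> by_cases hU0' : U' = ∅
        · simp only [code, hqb, hqb', hU0, hU0', if_false, if_true, Sum.inr.injEq] at h
          rw [h, hU0, hU0']
        · simp only [code, hqb, hqb', hU0, hU0', if_false, if_true] at h
          split_ifs at h
        · simp only [code, hqb, hqb', hU0, hU0', if_false, if_true] at h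
          split_ifs at h
        · simp only [code, hqb, hqb', hU0, hU0', if_false] at h
          have hsing : ∀ (q q' : Q) (U : Finset Q), (∀ k ∈ U, q < k ∧ k ≠ t) → U ≠ ∅ →
              ({q'} : Finset Q) ≠ insert q U := by
            intro q q' U hU hU0 he
            obtain ⟨k, hk⟩ := Finset.nonempty_iff_ne_empty.2 hU0
            have h1 : k ∈ ({q'} : Finset Q) := he ▸ Finset.mem_insert_of_mem hk
            have h2 : q ∈ ({q'} : Finset Q) := he ▸ Finset.mem_insert_self q U
            rw [Finset.mem_singleton] at h1 h2
            exact (hU k hk).1.ne (h2.trans h1.symm)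
          split_ifs at h with h1 h2 h2
          · have : q = q' := by simpa using h
            subst this
            rw [h1, h2]
          · exact absurd (Sum.inl.inj h) (hsing q' q U' hU' hU0')
          · exact absurd (Sum.inl.inj h).symm (hsing q q' U hU hU0)
          · have h := Sum.inl.inj h
            have hqq : q = q' := by
              by_contra hne
              have h3 : q ∈ insert q' U' := h ▸ Finset.mem_insert_self q U
              have h4 : q' ∈ insert q U := h ▸ Finset.mem_insert_self q' U'
              have h5 := (hU' q ((Finset.mem_insert.1 h3).resolve_left hne)).1
              have h6 := (hU q' ((Finset.mem_insert.1 h4).resolve_left (Ne.symm hne))).1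
              exact lt_asymm h5 h6
            subst hqq
            rw [← Finset.erase_insert (hq_notMem q U hU), h,
              Finset.erase_insert (hq_notMem q U' hU')]
  rwa [Finset.card_disjSum, Finset.card_powerset, hmid] at hcard

end Counting

end MostComplex

namespace MostComplex

/-! ### Complexity of atoms -/

section AtomUpper

variable {α : Type}

theorem mem_between_quotientDFA {L : Language α} {X Y : Set (quotients L)} {x : List α} :
    x ∈ between (quotientDFA L) X Y ↔ (∀ q ∈ X, x ∈ q.1) ∧ ∀ q ∈ Y, x ∉ q.1 := by
  have h : x ∈ between (quotientDFA L) X Y ↔ (∀ q ∈ X, x ∈ (quotientDFA L).acceptsFrom q) ∧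
    ∀ q ∈ Y, x ∉ (quotientDFA L).acceptsFrom q := Iff.rfl
  simp only [h, quotientDFA_acceptsFrom]

theorem atomOf_quotients {L : Language α} (h : IsRegularTwoSidedIdeal L) :
    atomOf L (quotients L) = L := by
  ext x
  constructor
  · intro hx
    exact hx.1 L (self_mem_quotients L)
  · intro hx
    exact ⟨fun K hK => h.le_quotient hK hx, fun K hK => absurd hK.1 hK.2⟩

theorem nonempty_of_mem_atoms {L A : Language α} (hA : A ∈ atoms L) : ∃ x, x ∈ A := by
  obtain ⟨x, rfl⟩ := hA
  exact ⟨x, (leftSetoid L).iseqv.refl x⟩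

theorem top_mem_of_atom {L : Language α} (h : IsRegularTwoSidedIdeal L) {S : Set (Language α)}
    (hA : atomOf L S ∈ atoms L) : ⊤ ∈ S := by
  obtain ⟨x, hx⟩ := nonempty_of_mem_atoms hA
  by_contra hcon
  exact hx.2 ⊤ ⟨h.top_mem, hcon⟩ (mem_top_language x)

/-- A word in `L` lies in every quotient, so a non-empty intersection with `L` in S has S full. -/
theorem self_notMem_of_atom {L : Language α} (h : IsRegularTwoSidedIdeal L) {S : Set (Language α)}
    (hS : S ⊆ quotients L) (hA : atomOf L S ∈ atoms L) (hne : S ≠ quotients L) : L ∉ S := by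
  intro hL
  obtain ⟨x, hx⟩ := nonempty_of_mem_atoms hA
  refine hne (subset_antisymm hS fun K hK => ?_)
  by_contra hKS
  exact hx.2 K ⟨hK, hKS⟩ (h.le_quotient hK (hx.1 L hL))

theorem between_eq_zero {Q : Type} {M : DFA α Q} {X Y : Set Q} {q : Q} (hX : q ∈ X) (hY : q ∈ Y) :
    between M X Y = 0 := by
  ext x
  refine ⟨fun hx => absurd (hx.1 q hX) (hx.2 q hY), fun hx => absurd hx (Language.notMem_zero x)⟩

theorem evalFrom_quotientDFA_mono (L : Language α) (w : List α) :
    Monotone fun q => (quotientDFA L).evalFrom q w := by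
  intro p q hpq
  show ((quotientDFA L).evalFrom p w).1 ≤ ((quotientDFA L).evalFrom q w).1
  rw [quotientDFA_evalFrom, quotientDFA_evalFrom]
  exact leftQuotient_mono hpq w

theorem evalFrom_quotientDFA_top {L : Language α} (h : IsRegularTwoSidedIdeal L) (w : List α) :
    (quotientDFA L).evalFrom ⟨⊤, h.top_mem⟩ w = ⟨⊤, h.top_mem⟩ := by
  refine Subtype.ext ?_
  rw [quotientDFA_evalFrom]
  rfl

/-- Disjoint images X of S and Y of its complement determine a non-empty candidate, and X contains
t. If b is not in Y, the least element T b of Y is traded for b, which changes neither the language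
nor the size bound. The summand 1 counts the empty language from images that meet. -/
theorem IsRegularTwoSidedIdeal.complexity_between_le {L : Language α}
    (h : IsRegularTwoSidedIdeal L) {n : ℕ} (hn : 2 ≤ n) (hL : complexity L = n)
    {S : Set (quotients L)} (ht : ⟨⊤, h.top_mem⟩ ∈ S) (hb : ⟨L, self_mem_quotients L⟩ ∉ S)
    (hS : S ≠ {⟨L, self_mem_quotients L⟩}ᶜ) :
    complexity (between (quotientDFA L) S Sᶜ) ≤
      ((1 + ∑ x ∈ Finset.Icc 1 S.ncard, ∑ y ∈ Finset.Icc 1 (n - S.ncard),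
        (n - 2).choose (x - 1) * (n - x - 1).choose (y - 1) : ℕ) : ℕ∞) := by
  classical
  have hfin : Finite (quotients L) := h.finite_quotients
  have := Fintype.ofFinite (quotients L)
  have hL' : ENat.card (quotients L) = n := hL
  have hcard : Fintype.card (quotients L) = n := by
    rw [ENat.card_eq_coe_fintype_card] at hL'
    exact_mod_cast hL'
  have hcard' : Nat.card (quotients L) = n := by rw [Nat.card_eq_fintype_card, hcard]
  set b : quotients L := ⟨L, self_mem_quotients L⟩ with hb_def
  set t : quotients L := ⟨⊤, h.top_mem⟩ with ht_def
  have hbt : b ≠ t := h.bot_ne_top hn hL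
  have hbot : ∀ x : quotients L, b ≤ x := fun x => h.le_quotient x.2
  have hSc : Sᶜ.ncard = n - S.ncard := by rw [Set.ncard_compl, hcard']
  -- The excluded case is used here: a second element of the complement leaves room for adding b
  -- when Y is a singleton.
  have hSc2 : 2 ≤ Sᶜ.ncard := by
    by_contra hlt
    have h1 : Sᶜ = {b} := by
      refine (Set.eq_of_subset_of_ncard_le (Set.singleton_subset_iff.2 hb) ?_).symm
      rw [Set.ncard_singleton]
      omega
    exact hS (by rw [← compl_compl S, h1])
  rw [← card_atomPairs hcard hbt, complexity_between, add_comm]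
  let F : Finset (quotients L) × Finset (quotients L) → Language α :=
    fun p => between (quotientDFA L) (p.1 : Set (quotients L)) (p.2 : Set (quotients L))
  refine (Set.encard_le_encard (t := insert 0 (F '' (atomPairs b t S.ncard (n - S.ncard) :
    Set (Finset (quotients L) × Finset (quotients L))))) ?_).trans ?_
  swap
  · refine (Set.encard_insert_le _ _).trans ?_
    rw [Nat.cast_add, Nat.cast_one]
    refine add_le_add_left ((Set.encard_image_le _ _).trans ?_) 1
    rw [Set.encard_coe_eq_coe_finsetCard]
  rintro _ ⟨w, rfl⟩
  set T := fun q => (quotientDFA L).evalFrom q w with hT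
  have hmono : Monotone T := evalFrom_quotientDFA_mono L w
  show between (quotientDFA L) (T '' S) (T '' Sᶜ) ∈ _
  by_cases hdisj : Disjoint (T '' S) (T '' Sᶜ)
  swap
  · obtain ⟨q, h1, h2⟩ := Set.not_disjoint_iff.1 hdisj
    exact Or.inl (between_eq_zero h1 h2)
  right
  have htT : T t = t := evalFrom_quotientDFA_top h w
  have htX : t ∈ T '' S := ⟨t, ht, htT⟩
  have hqY : T b ∈ T '' Sᶜ := ⟨b, hb, rfl⟩
  have hXc : (T '' S).toFinset.card ≤ S.ncard := by
    rw [← Set.ncard_eq_toFinset_card']; exact Set.ncard_image_le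
  have hYc : (T '' Sᶜ).ncard ≤ n - S.ncard := by
    rw [← hSc]; exact Set.ncard_image_le
  have hfinish : ∀ Y : Set (quotients L), b ∈ Y → Disjoint (T '' S) Y → Y.ncard ≤ n - S.ncard →
      between (quotientDFA L) (T '' S) Y = between (quotientDFA L) (T '' S) (T '' Sᶜ) →
      between (quotientDFA L) (T '' S) (T '' Sᶜ) ∈
        F '' (atomPairs b t S.ncard (n - S.ncard) :
          Set (Finset (quotients L) × Finset (quotients L))) := by
    intro Y hbY hd hY he
    refine ⟨((T '' S).toFinset, Y.toFinset), ?_, ?_⟩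
    · refine Finset.mem_coe.2 (mem_atomPairs.2 ⟨?_, ?_, ?_, hXc, ?_⟩)
      · exact Set.mem_toFinset.2 htX
      · exact Set.mem_toFinset.2 hbY
      · exact Set.disjoint_toFinset.2 hd
      · rw [← Set.ncard_eq_toFinset_card']; exact hY
    · simp only [F, Set.coe_toFinset]
      exact he
  by_cases hTb : T b = b
  · refine hfinish (T '' Sᶜ) (by rw [← hTb]; exact hqY) hdisj hYc rfl
  have hge : ∀ x, b ≠ T x := by
    intro x hx
    exact hTb (le_antisymm ((hmono (hbot x)).trans_eq hx.symm) (hbot _))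
  have hbX : b ∉ T '' S := by
    rintro ⟨x, -, hx⟩; exact hge x hx.symm
  by_cases hex : ∃ y ∈ T '' Sᶜ, y ≠ T b
  · obtain ⟨y, hy, hyb⟩ := hex
    -- A word outside some larger quotient in Y is outside T b, so this condition can be dropped; it
    -- is also outside the least quotient b, so that condition can be added.
    refine hfinish (insert b (T '' Sᶜ \ {T b})) (Set.mem_insert _ _) ?_ ?_ ?_
    · rw [Set.disjoint_insert_right]
      exact ⟨hbX, hdisj.mono_right Set.sdiff_subset⟩
    · refine (Set.ncard_insert_le _ _).trans ?_
      rw [Set.ncard_sdiff_singleton_add_one hqY]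
      exact hYc
    · ext x
      rw [mem_between_quotientDFA, mem_between_quotientDFA]
      refine and_congr_right fun _ => ⟨fun hx q hq => ?_, fun hx q hq => ?_⟩
      · by_cases hqb : q = T b
        · intro hxq
          obtain ⟨z, hz, rfl⟩ := hy
          refine hx (T z) (Or.inr ⟨⟨z, hz, rfl⟩, hyb⟩) ?_
          have : (T b).1 ≤ (T z).1 := hmono (hbot z)
          rw [hqb] at hxq
          exact this hxq
        · exact hx q (Or.inr ⟨hq, hqb⟩)
      · rcases hq with rfl | hq
        · intro hxq
          have : b.1 ≤ (T b).1 := hbot _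
          exact hx (T b) hqY (this hxq)
        · exact hx q hq.1
  · push Not at hex
    have hY : T '' Sᶜ = {T b} := Set.eq_singleton_iff_unique_mem.2 ⟨hqY, hex⟩
    refine hfinish {b, T b} (Or.inl rfl) ?_ ?_ ?_
    · rw [Set.disjoint_insert_right, ← hY]
      exact ⟨hbX, hdisj⟩
    · refine (Set.ncard_insert_le _ _).trans ?_
      rw [Set.ncard_singleton, ← hSc]
      exact hSc2
    · rw [hY]
      ext x
      rw [mem_between_quotientDFA, mem_between_quotientDFA]
      refine and_congr_right fun _ => ⟨fun hx q hq => hx q (Or.inr hq), fun hx q hq => ?_⟩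
      rcases hq with rfl | hq
      · intro hxq
        have : b.1 ≤ (T b).1 := hbot _
        exact hx (T b) rfl (this hxq)
      · exact hx q hq

/-- The image of the single excluded state is one state q, and all other images lie strictly above q
unless the language is empty. Membership in a quotient implies membership in the larger ones, so the
other images may be replaced by their upward closure, and t may be left out. -/
theorem IsRegularTwoSidedIdeal.complexity_between_compl_bot_le {L : Language α}
    (h : IsRegularTwoSidedIdeal L) {n : ℕ} (hn : 2 ≤ n) (hL : complexity L = n) :
    complexity (between (quotientDFA L) {⟨L, self_mem_quotients L⟩}ᶜ
      {⟨L, self_mem_quotients L⟩}) ≤ ((2 ^ (n - 2) + n - 1 : ℕ) : ℕ∞) := by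
  classical
  have hfin : Finite (quotients L) := h.finite_quotients
  have := Fintype.ofFinite (quotients L)
  have hL' : ENat.card (quotients L) = n := hL
  have hcard : Fintype.card (quotients L) = n := by
    rw [ENat.card_eq_coe_fintype_card] at hL'
    exact_mod_cast hL'
  set b : quotients L := ⟨L, self_mem_quotients L⟩ with hb_def
  set t : quotients L := ⟨⊤, h.top_mem⟩ with ht_def
  have hbt : b ≠ t := h.bot_ne_top hn hL
  have hbot : ∀ x : quotients L, b ≤ x := fun x => h.le_quotient x.2
  have htop : ∀ x : quotients L, x ≤ t := fun x => le_top (a := x.1)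
  let P : Finset (quotients L × Finset (quotients L)) := Finset.univ.filter fun p =>
    p.1 ≠ t ∧ (∀ k ∈ p.2, p.1 < k ∧ k ≠ t) ∧ ∀ k ∈ p.2, ∀ l, k ≤ l → l ≠ t → l ∈ p.2
  have hP := card_upper_sets_le hcard hbot hbt P fun p hp => (Finset.mem_filter.1 hp).2
  let F : quotients L × Finset (quotients L) → Language α :=
    fun p => between (quotientDFA L) (insert t (p.2 : Set (quotients L))) {p.1}
  rw [complexity_between]
  refine (Set.encard_le_encard (t := insert 0 (F '' (P : Set _))) ?_).trans ?_
  swap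
  · refine (Set.encard_insert_le _ _).trans ?_
    have h1 : (F '' (P : Set _)).encard ≤ ((2 ^ (n - 2) + (n - 2) : ℕ) : ℕ∞) := by
      refine (Set.encard_image_le _ _).trans ?_
      rw [Set.encard_coe_eq_coe_finsetCard]
      exact_mod_cast hP
    refine (add_le_add_left h1 1).trans ?_
    have h2 : 2 ^ (n - 2) + n - 1 = 2 ^ (n - 2) + (n - 2) + 1 := by omega
    rw [h2, Nat.cast_add _ 1]
    rfl
  rintro _ ⟨w, rfl⟩
  set T := fun q => (quotientDFA L).evalFrom q w with hT
  have hmono : Monotone T := evalFrom_quotientDFA_mono L w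
  show between (quotientDFA L) (T '' {b}ᶜ) (T '' {b}) ∈ _
  rw [Set.image_singleton]
  by_cases hTb : T b ∈ T '' {b}ᶜ
  · exact Or.inl (between_eq_zero hTb rfl)
  right
  have htX : t ∈ T '' {b}ᶜ := ⟨t, hbt.symm, evalFrom_quotientDFA_top h w⟩
  have hlt : ∀ x ∈ T '' {b}ᶜ, T b < x := by
    rintro _ ⟨x, hx, rfl⟩
    exact lt_of_le_of_ne (hmono (hbot x)) fun he => hTb ⟨x, hx, he.symm⟩
  refine ⟨(T b, Finset.univ.filter fun k => k ≠ t ∧ ∃ x ∈ T '' {b}ᶜ, x ≤ k), ?_, ?_⟩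
  · refine Finset.mem_coe.2 (Finset.mem_filter.2 ⟨Finset.mem_univ _, ?_, ?_, ?_⟩)
    · exact (hlt t htX).ne
    · intro k hk
      obtain ⟨-, hkt, x, hx, hxk⟩ := Finset.mem_filter.1 hk
      exact ⟨(hlt x hx).trans_le hxk, hkt⟩
    · intro k hk l hkl hlt
      obtain ⟨-, hkt, x, hx, hxk⟩ := Finset.mem_filter.1 hk
      exact Finset.mem_filter.2 ⟨Finset.mem_univ _, hlt, x, hx, hxk.trans hkl⟩
  · ext x
    rw [mem_between_quotientDFA, mem_between_quotientDFA]
    refine and_congr_left fun _ => ⟨fun hx q hq => ?_, fun hx q hq => ?_⟩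
    · by_cases hqt : q = t
      · rw [hqt]; exact mem_top_language x
      · exact hx q (Or.inr (Finset.mem_coe.2 (Finset.mem_filter.2
          ⟨Finset.mem_univ _, hqt, q, hq, le_rfl⟩)))
    · rcases hq with rfl | hq
      · exact mem_top_language x
      · obtain ⟨-, -, y, hy, hyq⟩ := Finset.mem_filter.1 (Finset.mem_coe.1 hq)
        have : y.1 ≤ q.1 := hyq
        exact this (hx y hy)

theorem IsRegularTwoSidedIdeal.complexity_atomOf_le {L : Language α}
    (h : IsRegularTwoSidedIdeal L) {n : ℕ} (hn : 2 ≤ n) (hL : complexity L = n)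
    {S : Set (Language α)} (hS : S ⊆ quotients L) (hA : atomOf L S ∈ atoms L) :
    complexity (atomOf L S) ≤ atomBound n L S := by
  unfold atomBound
  split_ifs with h1 h2
  · rw [h1, atomOf_quotients h, hL]
  all_goals
    have htS := top_mem_of_atom h hA
    have hLS := self_notMem_of_atom h hS hA h1
    set S' : Set (quotients L) := {q | q.1 ∈ S} with hS'
    have hSS' : (quotientDFA L).acceptsFrom '' S' = S := by
      ext K
      simp only [Set.mem_image, quotientDFA_acceptsFrom]
      exact ⟨fun ⟨q, hq, he⟩ => he ▸ hq, fun hK => ⟨⟨K, hS hK⟩, hK, rfl⟩⟩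
    have hatom := (isMinimalDFA_quotientDFA L).atomOf S'
    rw [quotientDFA_accepts, hSS'] at hatom
    rw [hatom]
  · have he : S' = {⟨L, self_mem_quotients L⟩}ᶜ := by
      ext q
      simp only [hS', h2, Set.mem_ofPred_eq, Set.mem_sdiff, q.2, true_and, Set.mem_singleton_iff,
        Set.mem_compl_iff, Subtype.ext_iff]
    rw [he, compl_compl]
    exact h.complexity_between_compl_bot_le hn hL
  · have hcard : S.ncard = S'.ncard := by
      rw [← hSS', Set.ncard_image_of_injective _ (isMinimalDFA_quotientDFA L).injective]
    rw [hcard]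
    refine h.complexity_between_le hn hL htS hLS fun he => h2 ?_
    rw [← hSS', he, Set.image_compl_eq_range_sdiff_image (isMinimalDFA_quotientDFA L).injective,
      ← quotients_accepts (isMinimalDFA_quotientDFA L).1, quotientDFA_accepts, Set.image_singleton,
      quotientDFA_acceptsFrom]

end AtomUpper

/-! ### Atoms of the witness -/

section AtomLower

/-- A finite set can be mapped onto any smaller set, with a prescribed value at one point. -/
theorem exists_image_eq {Q : Type*} [Finite Q] {A B : Set Q} {a c : Q} (ha : a ∈ A) (hc : c ∈ B)
    (hcard : B.ncard ≤ A.ncard) : ∃ g : Q → Q, g '' A = B ∧ g a = c := by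
  classical
  have h1 : (B \ {c}).ncard ≤ (A \ {a}).ncard := by
    rw [Set.ncard_sdiff_singleton_of_mem hc, Set.ncard_sdiff_singleton_of_mem ha]
    omega
  obtain ⟨A', hA', hA'c⟩ := Set.exists_subset_card_eq h1
  obtain ⟨e⟩ : Nonempty (A' ≃ (B \ {c} : Set Q)) := by
    exact Finite.card_eq.1 hA'c
  have haA' : a ∉ A' := fun h => (hA' h).2 rfl
  refine ⟨fun x => if hx : x ∈ A' then (e ⟨x, hx⟩).1 else c, ?_, by simp [haA']⟩
  ext y
  constructor
  · rintro ⟨x, -, rfl⟩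
    dsimp only
    split_ifs with hx
    · exact (e ⟨x, hx⟩).2.1
    · exact hc
  · intro hy
    by_cases hyc : y = c
    · exact ⟨a, ha, by simp [haA', hyc]⟩
    · refine ⟨(e.symm ⟨y, hy, hyc⟩).1, (hA' (e.symm ⟨y, hy, hyc⟩).2).1, ?_⟩
      simp

variable {β : Type} {n : ℕ} {φ : β → Letter} {hn : 5 ≤ n}

theorem between_image_mem_quotients (hφ : Function.Surjective φ) {g : Set.Icc 1 n → Set.Icc 1 n}
    (hg : g ∈ flatMaps (bot hn) (top hn)) (X Y : Set (Set.Icc 1 n)) :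
    between (dialectDFA φ hn) (g '' X) (g '' Y) ∈ quotients (between (dialectDFA φ hn) X Y) := by
  rw [← transformations_dialectDFA_eq hφ] at hg
  obtain ⟨w, -, hw⟩ := hg
  obtain rfl : (fun q => (dialectDFA φ hn).evalFrom q w) = g := funext hw
  exact ⟨w, leftQuotient_between _ _ _ _⟩

/-- Since S and its complement are disjoint, they can be mapped onto X and Y independently; the
combined map fixes 1 and n and so is induced by a word. -/
theorem between_mem_quotients (hφ : Function.Surjective φ) {S X Y : Set (Set.Icc 1 n)}
    (htS : top hn ∈ S) (hbS : bot hn ∉ S) (htX : top hn ∈ X) (hbY : bot hn ∈ Y)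
    (hX : X.ncard ≤ S.ncard) (hY : Y.ncard ≤ Sᶜ.ncard) :
    between (dialectDFA φ hn) X Y ∈ quotients (between (dialectDFA φ hn) S Sᶜ) := by
  classical
  obtain ⟨g1, hg1, hg1t⟩ := exists_image_eq htS htX hX
  obtain ⟨g2, hg2, hg2b⟩ := exists_image_eq (A := Sᶜ) hbS hbY hY
  have hmem := between_image_mem_quotients (hn := hn) hφ
    (g := fun q => if q ∈ S then g1 q else g2 q)
    ⟨by simp [htS, hg1t], Or.inl (by simp [hbS, hg2b])⟩ S Sᶜ
  have e1 : (fun q => if q ∈ S then g1 q else g2 q) '' S = X := by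
    rw [← hg1]
    exact Set.image_congr fun q hq => by simp [hq]
  have e2 : (fun q => if q ∈ S then g1 q else g2 q) '' Sᶜ = Y := by
    rw [← hg2]
    exact Set.image_congr fun q hq => by
      have : q ∉ S := hq
      simp [this]
  rwa [e1, e2] at hmem

theorem zero_mem_quotients_between (hφ : Function.Surjective φ) {X Y : Set (Set.Icc 1 n)}
    (htX : top hn ∈ X) (hbY : bot hn ∈ Y) :
    0 ∈ quotients (between (dialectDFA φ hn) X Y) := by
  have hmem := between_image_mem_quotients (hn := hn) hφ (g := fun _ => top hn)
    ⟨rfl, Or.inr fun _ => Or.inr rfl⟩ X Y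
  rwa [between_eq_zero (q := top hn) (Set.mem_image_of_mem (fun _ => top hn) htX)
    (Set.mem_image_of_mem (fun _ => top hn) hbY)] at hmem

/-- A word accepted exactly from R tests the inclusion of X in R and the disjointness of Y from R.
-/
theorem exists_mem_between_iff {a f : β} (ha : φ a = .a) (hf : φ f = .f)
    (R : Set (Set.Icc 1 n)) (ht : top hn ∈ R) (hb : bot hn ∉ R) :
    ∃ w, ∀ X Y : Set (Set.Icc 1 n),
      w ∈ between (dialectDFA φ hn) X Y ↔ X ⊆ R ∧ ∀ q ∈ Y, q ∉ R := by
  obtain ⟨w, hw⟩ := exists_word_accepted_exactly (hn := hn) ha hf R ht hb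
  refine ⟨w, fun X Y => ?_⟩
  rw [mem_between]
  simp only [dialectDFA_accept, hw]
  rfl

theorem ncard_states (n : ℕ) : Nat.card (Set.Icc 1 n) = n := by
  rw [Nat.card_eq_fintype_card]; simp

/-- All normal forms of the upper bound occur, and the empty language as well. The test words for R
= X and for R = the complement of Y recover X and Y from the language. -/
theorem le_complexity_between (hφ : Function.Surjective φ) {S : Set (Set.Icc 1 n)}
    (htS : top hn ∈ S) (hbS : bot hn ∉ S) :
    ((1 + ∑ x ∈ Finset.Icc 1 S.ncard, ∑ y ∈ Finset.Icc 1 (n - S.ncard),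
        (n - 2).choose (x - 1) * (n - x - 1).choose (y - 1) : ℕ) : ℕ∞) ≤
      complexity (between (dialectDFA φ hn) S Sᶜ) := by
  classical
  obtain ⟨a, ha⟩ := hφ .a
  obtain ⟨f, hf⟩ := hφ .f
  have hcard : Fintype.card (Set.Icc 1 n) = n := by simp
  have hSc : Sᶜ.ncard = n - S.ncard := by rw [Set.ncard_compl, ncard_states]
  rw [← card_atomPairs hcard (bot_ne_top hn), add_comm]
  let F : Finset (Set.Icc 1 n) × Finset (Set.Icc 1 n) → Language β :=
    fun p => between (dialectDFA φ hn) (p.1 : Set (Set.Icc 1 n)) (p.2 : Set (Set.Icc 1 n))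
  have hinj : Set.InjOn F (atomPairs (bot hn) (top hn) S.ncard (n - S.ncard) :
      Set (Finset (Set.Icc 1 n) × Finset (Set.Icc 1 n))) := by
    have hone : ∀ p ∈ atomPairs (bot hn) (top hn) S.ncard (n - S.ncard),
        ∀ p' ∈ atomPairs (bot hn) (top hn) S.ncard (n - S.ncard), F p = F p' →
        p'.1 ⊆ p.1 ∧ p'.2 ⊆ p.2 := by
      rintro ⟨X, Y⟩ hp ⟨X', Y'⟩ hp' he
      obtain ⟨h1, h2, h3, -, -⟩ := mem_atomPairs.1 hp
      have hd := Finset.disjoint_left.1 h3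
      constructor
      · obtain ⟨w, hw⟩ := exists_mem_between_iff (hn := hn) ha hf (X : Set (Set.Icc 1 n)) h1
          fun h => hd h h2
        have hmem : w ∈ F (X, Y) := (hw _ _).2 ⟨subset_rfl, fun q hq hq' => hd hq' hq⟩
        rw [he] at hmem
        exact Finset.coe_subset.1 ((hw _ _).1 hmem).1
      · obtain ⟨w, hw⟩ := exists_mem_between_iff (hn := hn) ha hf (Y : Set (Set.Icc 1 n))ᶜ
          (fun h => hd h1 h) fun h => h h2
        have hmem : w ∈ F (X, Y) :=
          (hw _ _).2 ⟨fun q hq hq' => hd hq hq', fun q hq hq' => hq' hq⟩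
        rw [he] at hmem
        intro q hq
        by_contra hqY
        exact ((hw _ _).1 hmem).2 q hq hqY
    intro p hp p' hp' he
    have h1 := hone p hp p' hp' he
    have h2 := hone p' hp' p hp he.symm
    exact Prod.ext (h2.1.antisymm h1.1) (h2.2.antisymm h1.2)
  have hnot : 0 ∉ F '' (atomPairs (bot hn) (top hn) S.ncard (n - S.ncard) :
      Set (Finset (Set.Icc 1 n) × Finset (Set.Icc 1 n))) := by
    rintro ⟨⟨X, Y⟩, hp, he⟩
    obtain ⟨h1, h2, h3, -, -⟩ := mem_atomPairs.1 hp
    have hd := Finset.disjoint_left.1 h3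
    obtain ⟨w, hw⟩ := exists_mem_between_iff (hn := hn) ha hf (X : Set (Set.Icc 1 n)) h1
      fun h => hd h h2
    have hmem : w ∈ F (X, Y) := (hw _ _).2 ⟨subset_rfl, fun q hq hq' => hd hq' hq⟩
    rw [he] at hmem
    exact Language.notMem_zero w hmem
  calc _ = (insert 0 (F '' (atomPairs (bot hn) (top hn) S.ncard (n - S.ncard) :
      Set (Finset (Set.Icc 1 n) × Finset (Set.Icc 1 n))))).encard := by
        rw [Set.encard_insert_of_notMem hnot, hinj.encard_image, Set.encard_coe_eq_coe_finsetCard]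
        push_cast; rfl
    _ ≤ _ := by
      refine Set.encard_le_encard (Set.insert_subset ?_ ?_)
      · exact zero_mem_quotients_between hφ htS hbS
      · rintro _ ⟨⟨X, Y⟩, hp, rfl⟩
        obtain ⟨h1, h2, h3, h4, h5⟩ := mem_atomPairs.1 hp
        refine between_mem_quotients hφ htS hbS h1 h2 ?_ ?_
        · rwa [Set.ncard_coe_finset]
        · rw [Set.ncard_coe_finset, hSc]; exact h5

theorem le_complexity_between_compl_bot (hφ : Function.Surjective φ) :
    ((2 ^ (n - 2) + n - 1 : ℕ) : ℕ∞) ≤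
      complexity (between (dialectDFA φ hn) {bot hn}ᶜ {bot hn}) := by
  classical
  obtain ⟨a, ha⟩ := hφ .a
  obtain ⟨f, hf⟩ := hφ .f
  let mid : Finset (Set.Icc 1 n) := {bot hn, top hn}ᶜ
  have hmid : mid.card = n - 2 := by
    rw [Finset.card_compl, Finset.card_pair (bot_ne_top hn)]; simp
  have hmem : ∀ x, x ∈ mid ↔ x ≠ bot hn ∧ x ≠ top hn := by intro x; simp [mid]
  -- The left summand comes from maps fixing 1, the right one from maps that send 1 to a middle
  -- state q and all other states to n. With the empty language this makes 2^(n-2) + (n − 2) + 1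
  -- quotients.
  let F : Finset (Set.Icc 1 n) ⊕ Set.Icc 1 n → Language β := Sum.elim
    (fun U => between (dialectDFA φ hn) (insert (top hn) (U : Set (Set.Icc 1 n))) {bot hn})
    (fun q => between (dialectDFA φ hn) {top hn} {q})
  have hword : ∀ R ⊆ mid, ∃ w, ∀ X Y : Set (Set.Icc 1 n), w ∈ between (dialectDFA φ hn) X Y ↔
      X ⊆ insert (top hn) (R : Set (Set.Icc 1 n)) ∧
        ∀ q ∈ Y, q ∉ insert (top hn) (R : Set (Set.Icc 1 n)) := by
    intro R hR
    refine exists_mem_between_iff (hn := hn) ha hf _ (Set.mem_insert _ _) ?_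
    rintro (h | h)
    · exact bot_ne_top hn h
    · exact ((hmem _).1 (hR h)).1 rfl
  have hbot : ∀ R ⊆ mid, ∀ q ∈ ({bot hn} : Set (Set.Icc 1 n)),
      q ∉ insert (top hn) (R : Set (Set.Icc 1 n)) := by
    rintro R hR _ rfl (h | h)
    · exact bot_ne_top hn h
    · exact ((hmem _).1 (hR h)).1 rfl
  have hmix : ∀ U ⊆ mid, ∀ q ∈ mid, F (Sum.inl U) ≠ F (Sum.inr q) := by
    intro U hU q hq he
    by_cases hU0 : U = ∅
    · obtain ⟨w, hw⟩ := hword {q} (Finset.singleton_subset_iff.2 hq)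
      have h1 : w ∈ F (Sum.inl U) := (hw _ _).2
        ⟨by simp [hU0], hbot _ (Finset.singleton_subset_iff.2 hq)⟩
      rw [he] at h1
      exact ((hw _ _).1 h1).2 q rfl (Or.inr (by simp))
    · obtain ⟨w, hw⟩ := hword ∅ (Finset.empty_subset _)
      have h1 : w ∈ F (Sum.inr q) := (hw _ _).2 ⟨by simp, by
        rintro _ rfl (h | h)
        · exact ((hmem _).1 hq).2 h
        · simp at h⟩
      rw [← he] at h1
      obtain ⟨k, hk⟩ := Finset.nonempty_iff_ne_empty.2 hU0
      rcases ((hw _ _).1 h1).1 (Or.inr hk) with h | h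
      · exact ((hmem _).1 (hU hk)).2 h
      · simp at h
  have hinl : ∀ U ⊆ mid, ∀ U' ⊆ mid, F (Sum.inl U) = F (Sum.inl U') → U' ⊆ U := by
    intro U hU U' hU' he k hk
    obtain ⟨w, hw⟩ := hword U hU
    have h1 : w ∈ F (Sum.inl U) := (hw _ _).2 ⟨subset_rfl, hbot U hU⟩
    rw [he] at h1
    rcases ((hw _ _).1 h1).1 (Or.inr hk) with h | h
    · exact absurd h ((hmem _).1 (hU' hk)).2
    · exact h
  have hinr : ∀ q ∈ mid, ∀ q' ∈ mid, F (Sum.inr q) = F (Sum.inr q') → q = q' := by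
    intro q hq q' hq' he
    by_contra hne
    obtain ⟨w, hw⟩ := hword {q'} (Finset.singleton_subset_iff.2 hq')
    have h1 : w ∈ F (Sum.inr q) := (hw _ _).2 ⟨by simp, by
      rintro _ rfl (h | h)
      · exact ((hmem _).1 hq).2 h
      · exact hne (by simpa using h)⟩
    rw [he] at h1
    exact ((hw _ _).1 h1).2 q' rfl (Or.inr (by simp))
  have hinj : Set.InjOn F (mid.powerset.disjSum mid : Set (Finset (Set.Icc 1 n) ⊕ Set.Icc 1 n)) := by
    rintro (U | q) hp (U' | q') hp' he
    · have hp := Finset.mem_powerset.1 (Finset.inl_mem_disjSum.1 (Finset.mem_coe.1 hp))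
      have hp' := Finset.mem_powerset.1 (Finset.inl_mem_disjSum.1 (Finset.mem_coe.1 hp'))
      rw [(hinl U' hp' U hp he.symm).antisymm (hinl U hp U' hp' he)]
    · exact absurd he (hmix U (Finset.mem_powerset.1 (Finset.inl_mem_disjSum.1
        (Finset.mem_coe.1 hp))) q' (Finset.inr_mem_disjSum.1 (Finset.mem_coe.1 hp')))
    · exact absurd he.symm (hmix U' (Finset.mem_powerset.1 (Finset.inl_mem_disjSum.1
        (Finset.mem_coe.1 hp'))) q (Finset.inr_mem_disjSum.1 (Finset.mem_coe.1 hp)))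
    · rw [hinr q (Finset.inr_mem_disjSum.1 (Finset.mem_coe.1 hp)) q'
        (Finset.inr_mem_disjSum.1 (Finset.mem_coe.1 hp')) he]
  have hnot : 0 ∉ F '' (mid.powerset.disjSum mid : Set (Finset (Set.Icc 1 n) ⊕ Set.Icc 1 n)) := by
    rintro ⟨U | q, hp, he⟩
    · have hp := Finset.mem_powerset.1 (Finset.inl_mem_disjSum.1 (Finset.mem_coe.1 hp))
      obtain ⟨w, hw⟩ := hword U hp
      have h1 : w ∈ F (Sum.inl U) := (hw _ _).2 ⟨subset_rfl, hbot U hp⟩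
      rw [he] at h1
      exact Language.notMem_zero w h1
    · have hp := Finset.inr_mem_disjSum.1 (Finset.mem_coe.1 hp)
      have h1 : [] ∈ F (Sum.inr q) := by
        refine ⟨?_, ?_⟩
        · rintro _ rfl; exact (dialectDFA_accept (φ := φ) (hn := hn) _).2 rfl
        · rintro _ rfl h; exact ((hmem _).1 hp).2 h
      rw [he] at h1
      exact Language.notMem_zero _ h1
  calc _ = (insert 0 (F '' (mid.powerset.disjSum mid :
      Set (Finset (Set.Icc 1 n) ⊕ Set.Icc 1 n)))).encard := by
        rw [Set.encard_insert_of_notMem hnot, hinj.encard_image, Set.encard_coe_eq_coe_finsetCard,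
          Finset.card_disjSum, Finset.card_powerset, hmid]
        have h2 : 2 ^ (n - 2) + n - 1 = 2 ^ (n - 2) + (n - 2) + 1 := by
          generalize 2 ^ (n - 2) = k
          omega
        rw [h2, Nat.cast_add _ 1]
        rfl
    _ ≤ _ := by
      refine Set.encard_le_encard (Set.insert_subset ?_ ?_)
      · exact zero_mem_quotients_between hφ (bot_ne_top hn).symm rfl
      · rintro _ ⟨U | q, hp, rfl⟩
        · have hp := Finset.mem_powerset.1 (Finset.inl_mem_disjSum.1 (Finset.mem_coe.1 hp))
          have h3 := between_mem_quotients (hn := hn) hφ (S := {bot hn}ᶜ)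
            (X := insert (top hn) (U : Set (Set.Icc 1 n))) (Y := {bot hn})
            (bot_ne_top hn).symm (fun h => h rfl) (Set.mem_insert _ _) rfl ?_ ?_
          · rwa [compl_compl] at h3
          · refine Set.ncard_le_ncard ?_
            rintro x (rfl | hx)
            · exact (bot_ne_top hn).symm
            · exact ((hmem _).1 (hp hx)).1
          · rw [compl_compl]
        · have hp := (hmem q).1 (Finset.inr_mem_disjSum.1 (Finset.mem_coe.1 hp))
          have h3 := between_image_mem_quotients (hn := hn) hφ
            (g := fun x => if x = bot hn then q else top hn)
            ⟨by simp [(bot_ne_top hn).symm], Or.inr fun x => by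
              by_cases hx : x = bot hn <;> simp [hx]⟩ {bot hn}ᶜ {bot hn}
          have e1 : (fun x => if x = bot hn then q else top hn) '' {bot hn}ᶜ = {top hn} := by
            ext y
            constructor
            · rintro ⟨x, hx, rfl⟩
              have hx : x ≠ bot hn := hx
              simp [hx]
            · rintro rfl
              exact ⟨top hn, (bot_ne_top hn).symm, by simp [(bot_ne_top hn).symm]⟩
          have e2 : (fun x => if x = bot hn then q else top hn) '' {bot hn} = {q} := by simp
          rwa [e1, e2] at h3

theorem complexity_atomOf_dialectDFA (hφ : Function.Surjective φ) {S : Set (Language β)}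
    (hS : S ⊆ quotients (dialectDFA φ hn).accepts)
    (hA : atomOf (dialectDFA φ hn).accepts S ∈ atoms (dialectDFA φ hn).accepts) :
    complexity (atomOf (dialectDFA φ hn).accepts S) = atomBound n (dialectDFA φ hn).accepts S := by
  obtain ⟨a, ha⟩ := hφ .a
  obtain ⟨e, he⟩ := hφ .e
  obtain ⟨f, hf⟩ := hφ .f
  set M := dialectDFA φ hn with hM
  have hmin : IsMinimalDFA M := isMinimalDFA_dialectDFA ha he hf
  have hid : IsRegularTwoSidedIdeal M.accepts := isRegularTwoSidedIdeal_dialectDFA he hf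
  have hL : complexity M.accepts = n := complexity_dialectDFA ha he hf
  refine le_antisymm (hid.complexity_atomOf_le (by omega) hL hS hA) ?_
  have htop : M.acceptsFrom (top hn) = ⊤ := acceptsFrom_top
  unfold atomBound
  split_ifs with h1 h2
  · rw [h1, atomOf_quotients hid, hL]
  all_goals
    have htS := top_mem_of_atom hid hA
    have hLS := self_notMem_of_atom hid hS hA h1
    set S' : Set (Set.Icc 1 n) := M.acceptsFrom ⁻¹' S with hS'
    have hSS' : M.acceptsFrom '' S' = S := by
      rw [hS', Set.image_preimage_eq_iff, ← quotients_accepts hmin.1]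
      exact hS
    have htS' : top hn ∈ S' := by rw [hS', Set.mem_preimage, htop]; exact htS
    have hbS' : bot hn ∉ S' := hLS
    have hatom := hmin.atomOf S'
    rw [hSS'] at hatom
    rw [hatom]
  · have he : S' = {bot hn}ᶜ := by
      ext q
      have hq : M.acceptsFrom q = M.accepts ↔ q = bot hn :=
        ⟨fun h => hmin.2 _ _ h, fun h => by rw [h]; rfl⟩
      rw [hS', h2, Set.mem_preimage, Set.mem_sdiff, Set.mem_singleton_iff, hq,
        quotients_accepts hmin.1]
      simp
    rw [he, compl_compl]
    exact le_complexity_between_compl_bot hφ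
  · have hcard : S.ncard = S'.ncard := by
      rw [← hSS', Set.ncard_image_of_injective _ hmin.injective]
    rw [hcard]
    exact le_complexity_between hφ htS' hbS'

end AtomLower

end MostComplex

namespace MostComplex

/-! ### Boolean operations on the witnesses -/

section Boolean

variable {β : Type} {m n : ℕ} {φ ψ : β → Letter} {hm : 5 ≤ m} {hn : 5 ≤ n}

/-- The letters `x` that play the roles of `a` or `b` in both automata. -/
def IsPermLetter (φ ψ : β → Letter) (x : β) : Prop :=
  (φ x = .a ∨ φ x = .b) ∧ (ψ x = .a ∨ ψ x = .b)

theorem step_bot_of_perm {x : β} (hx : φ x = .a ∨ φ x = .b) :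
    (dialectDFA φ hn).step (bot hn) x = bot hn := by
  refine step_bot ?_
  rcases hx with h | h <;> rw [h] <;> simp

theorem step_injective_of_perm {x : β} (hx : φ x = .a ∨ φ x = .b) :
    Function.Injective fun q => (dialectDFA φ hn).step q x := by
  rcases hx with h | h
  · exact step_injective_a h
  · exact step_injective_b h

theorem evalFrom_bot_of_perm {w : List β} (hw : ∀ x ∈ w, φ x = .a ∨ φ x = .b) :
    (dialectDFA φ hn).evalFrom (bot hn) w = bot hn := by
  induction w with
  | nil => rfl
  | cons x w ih =>
    rw [DFA.evalFrom_cons, step_bot_of_perm (hw x (by simp))]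
    exact ih fun y hy => hw y (by simp [hy])

theorem evalFrom_injective_of_perm {w : List β} (hw : ∀ x ∈ w, φ x = .a ∨ φ x = .b) :
    Function.Injective fun q => (dialectDFA φ hn).evalFrom q w := by
  induction w with
  | nil => exact fun p q h => h
  | cons x w ih =>
    exact (ih fun y hy => hw y (by simp [hy])).comp (step_injective_of_perm (hw x (by simp)))

theorem inter_evalFrom {α Q R : Type} (M : DFA α Q) (N : DFA α R) (s : Q × R) (w : List α) :
    (M.inter N).evalFrom s w = (M.evalFrom s.1 w, N.evalFrom s.2 w) := by
  induction w generalizing s with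
  | nil => rfl
  | cons x w ih => rw [DFA.evalFrom_cons, ih]; rfl

/-- The second pair of states is reached from the first by a word whose letters play the roles of `a` and
`b`. -/
def PermReach (φ ψ : β → Letter) (hm : 5 ≤ m) (hn : 5 ≤ n) (s s' : Set.Icc 1 m × Set.Icc 1 n) :
    Prop :=
  ∃ w : List β, (∀ x ∈ w, IsPermLetter φ ψ x) ∧
    ((dialectDFA φ hm).inter (dialectDFA ψ hn)).evalFrom s w = s'

theorem PermReach.refl (s : Set.Icc 1 m × Set.Icc 1 n) : PermReach φ ψ hm hn s s :=
  ⟨[], by simp, rfl⟩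

theorem PermReach.trans {s s' s'' : Set.Icc 1 m × Set.Icc 1 n} (h : PermReach φ ψ hm hn s s')
    (h' : PermReach φ ψ hm hn s' s'') : PermReach φ ψ hm hn s s'' := by
  obtain ⟨u, hu, rfl⟩ := h
  obtain ⟨v, hv, rfl⟩ := h'
  refine ⟨u ++ v, fun x hx => ?_, evalFrom_append _ _ _ _⟩
  rcases List.mem_append.1 hx with h | h
  · exact hu x h
  · exact hv x h

theorem PermReach.step {x : β} (hx : IsPermLetter φ ψ x) (s : Set.Icc 1 m × Set.Icc 1 n) :
    PermReach φ ψ hm hn s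
      ((dialectDFA φ hm).step s.1 x, (dialectDFA ψ hn).step s.2 x) :=
  ⟨[x], by simpa using hx, rfl⟩

/-- A permutation letter is undone by one of its powers, so reachability is an equivalence relation.
-/
theorem PermReach.step_symm {x : β} (hx : IsPermLetter φ ψ x) (s : Set.Icc 1 m × Set.Icc 1 n) :
    PermReach φ ψ hm hn ((dialectDFA φ hm).step s.1 x, (dialectDFA ψ hn).step s.2 x) s := by
  set P := (dialectDFA φ hm).inter (dialectDFA ψ hn)
  have hinj : Function.Injective fun s => P.step s x := by
    intro s s' h
    have h1 := congrArg Prod.fst h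
    have h2 := congrArg Prod.snd h
    exact Prod.ext (step_injective_of_perm (hn := hm) hx.1 h1)
      (step_injective_of_perm (hn := hn) hx.2 h2)
  obtain ⟨k, hk⟩ := exists_iterate_leftInverse hinj
  have hit : ∀ j s, P.evalFrom s (List.replicate j x) = (fun s => P.step s x)^[j] s := by
    intro j
    induction j with
    | zero => intro s; rfl
    | succ j ih =>
      intro s
      rw [List.replicate_succ, DFA.evalFrom_cons, ih, Function.iterate_succ_apply]
  refine ⟨List.replicate (k + 1) x, fun y hy => ?_, ?_⟩
  · rw [List.eq_of_mem_replicate hy]; exact hx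
  · exact (hit _ _).trans (hk s)

theorem PermReach.symm {s s' : Set.Icc 1 m × Set.Icc 1 n} (h : PermReach φ ψ hm hn s s') :
    PermReach φ ψ hm hn s' s := by
  obtain ⟨w, hw, rfl⟩ := h
  induction w generalizing s with
  | nil => exact PermReach.refl s
  | cons x w ih =>
    exact (ih fun y hy => hw y (by simp [hy])).trans (PermReach.step_symm (hw x (by simp)) s)

/-- The properties of a pair of dialects that make the boolean operations maximally complex. -/
structure JointlyTransitive (φ ψ : β → Letter) (hm : 5 ≤ m) (hn : 5 ≤ n) : Prop where
  exists_a : (∃ x, φ x = .a) ∧ ∃ x, ψ x = .a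
  exists_d : ∃ x, φ x = .d ∧ ψ x = .d
  exists_e : ∃ x, φ x = .e ∧ ψ x = .e
  exists_f : ∃ x, φ x = .f ∧ ψ x = .f
  exists_perm : ∀ p p' : Set.Icc 1 m, ∀ q q' : Set.Icc 1 n, p ≠ bot hm → p ≠ top hm →
    p' ≠ bot hm → p' ≠ top hm → q ≠ bot hn → q ≠ top hn → q' ≠ bot hn → q' ≠ top hn →
    ∃ w : List β, (∀ x ∈ w, IsPermLetter φ ψ x) ∧
      (dialectDFA φ hm).evalFrom p w = p' ∧ (dialectDFA ψ hn).evalFrom q w = q'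

theorem JointlyTransitive.symm (h : JointlyTransitive φ ψ hm hn) :
    JointlyTransitive ψ φ hn hm where
  exists_a := h.exists_a.symm
  exists_d := h.exists_d.imp fun _ hx => hx.symm
  exists_e := h.exists_e.imp fun _ hx => hx.symm
  exists_f := h.exists_f.imp fun _ hx => hx.symm
  exists_perm q q' p p' h1 h2 h3 h4 h5 h6 h7 h8 := by
    obtain ⟨w, hw, hw1, hw2⟩ := h.exists_perm p p' q q' h5 h6 h7 h8 h1 h2 h3 h4
    exact ⟨w, fun x hx => (hw x hx).symm, hw2, hw1⟩

/-- If all pairs of states can be connected with one of them, the dialects are jointly transitive. -/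
theorem exists_perm_of_permReach (s₀ : Set.Icc 1 m × Set.Icc 1 n)
    (h : ∀ p : Set.Icc 1 m, ∀ q : Set.Icc 1 n, p ≠ bot hm → p ≠ top hm → q ≠ bot hn →
      q ≠ top hn → PermReach φ ψ hm hn (p, q) s₀)
    (p p' : Set.Icc 1 m) (q q' : Set.Icc 1 n) (h1 : p ≠ bot hm) (h2 : p ≠ top hm)
    (h3 : p' ≠ bot hm) (h4 : p' ≠ top hm) (h5 : q ≠ bot hn) (h6 : q ≠ top hn)
    (h7 : q' ≠ bot hn) (h8 : q' ≠ top hn) :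
    ∃ w : List β, (∀ x ∈ w, IsPermLetter φ ψ x) ∧
      (dialectDFA φ hm).evalFrom p w = p' ∧ (dialectDFA ψ hn).evalFrom q w = q' := by
  obtain ⟨w, hw, he⟩ := (h p q h1 h2 h5 h6).trans (h p' q' h3 h4 h7 h8).symm
  rw [inter_evalFrom, Prod.mk.injEq] at he
  exact ⟨w, hw, he⟩

theorem step_b_of_le {x : β} (hx : φ x = .b) {q : Set.Icc 1 n} (hq : 4 ≤ q.1) :
    (dialectDFA φ hn).step q x = q := by
  refine Subtype.ext ?_
  rw [dialectDFA_step_val, hx]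
  simp only [delta]
  split_ifs <;> omega

theorem step_b_two {x : β} (hx : φ x = .b) {q : Set.Icc 1 n} (hq : q.1 = 2) :
    ((dialectDFA φ hn).step q x).1 = 3 := by
  rw [dialectDFA_step_val, hx]
  simp [delta, hq]

theorem step_a_last {x : β} (hx : φ x = .a) {q : Set.Icc 1 n} (hq : q.1 = n - 1) :
    ((dialectDFA φ hn).step q x).1 = 2 := by
  rw [dialectDFA_step_val, hx]
  simp [delta, hq]

theorem evalFrom_replicate_of_fixed {α Q : Type} {M : DFA α Q} {q : Q} {x : α}
    (h : M.step q x = q) (k : ℕ) : M.evalFrom q (List.replicate k x) = q := by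
  induction k with
  | zero => rfl
  | succ k ih => rw [List.replicate_succ, DFA.evalFrom_cons, h, ih]

/-- The letter that is the long cycle in one component is the transposition (2,3) in the other.
Hence rows and columns with index at least 4 are connected, and the pairs with both indices in {2,
3} are moved out to such a row or column. -/
theorem jointlyTransitive_of_swap {a b d e f : β} (ha : φ a = .a ∧ ψ a = .b)
    (hb : φ b = .b ∧ ψ b = .a) (hd : φ d = .d ∧ ψ d = .d) (he : φ e = .e ∧ ψ e = .e)
    (hf : φ f = .f ∧ ψ f = .f) : JointlyTransitive φ ψ hm hn := by
  refine ⟨⟨⟨a, ha.1⟩, ⟨b, hb.2⟩⟩, ⟨d, hd⟩, ⟨e, he⟩, ⟨f, hf⟩, ?_⟩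
  have hA : IsPermLetter φ ψ a := ⟨Or.inl ha.1, Or.inr ha.2⟩
  have hB : IsPermLetter φ ψ b := ⟨Or.inr hb.1, Or.inl hb.2⟩
  have hrow : ∀ (p p' : Set.Icc 1 m) (q : Set.Icc 1 n), p ≠ bot hm → p ≠ top hm → p' ≠ bot hm →
      p' ≠ top hm → 4 ≤ q.1 → PermReach φ ψ hm hn (p, q) (p', q) := by
    have htwo : ∀ (p : Set.Icc 1 m) (q : Set.Icc 1 n), p ≠ bot hm → p ≠ top hm → 4 ≤ q.1 →
        PermReach φ ψ hm hn (two hm, q) (p, q) := by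
      intro p q h1 h2 h3
      obtain ⟨k, hk⟩ := exists_evalFrom_two (φ := φ) ha.1 h1 h2
      refine ⟨List.replicate k a, fun y hy => ?_, ?_⟩
      · rw [List.eq_of_mem_replicate hy]; exact hA
      · rw [inter_evalFrom, hk, evalFrom_replicate_of_fixed (step_b_of_le ha.2 h3)]
    exact fun p p' q h1 h2 h3 h4 h5 => (htwo p q h1 h2 h5).symm.trans (htwo p' q h3 h4 h5)
  have hcol : ∀ (p : Set.Icc 1 m) (q q' : Set.Icc 1 n), q ≠ bot hn → q ≠ top hn → q' ≠ bot hn →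
      q' ≠ top hn → 4 ≤ p.1 → PermReach φ ψ hm hn (p, q) (p, q') := by
    have htwo : ∀ (p : Set.Icc 1 m) (q : Set.Icc 1 n), q ≠ bot hn → q ≠ top hn → 4 ≤ p.1 →
        PermReach φ ψ hm hn (p, two hn) (p, q) := by
      intro p q h1 h2 h3
      obtain ⟨k, hk⟩ := exists_evalFrom_two (φ := ψ) hb.2 h1 h2
      refine ⟨List.replicate k b, fun y hy => ?_, ?_⟩
      · rw [List.eq_of_mem_replicate hy]; exact hB
      · rw [inter_evalFrom, hk, evalFrom_replicate_of_fixed (step_b_of_le hb.1 h3)]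
    exact fun p q q' h1 h2 h3 h4 h5 => (htwo p q h1 h2 h5).symm.trans (htwo p q' h3 h4 h5)
  have h4m : (⟨4, by omega, by omega⟩ : Set.Icc 1 m) ≠ bot hm ∧
      (⟨4, by omega, by omega⟩ : Set.Icc 1 m) ≠ top hm :=
    ⟨(ne_bot_iff _).2 (show 2 ≤ 4 by omega), (ne_top_iff _).2 (show 4 ≤ m - 1 by omega)⟩
  have h4n : (⟨4, by omega, by omega⟩ : Set.Icc 1 n) ≠ bot hn ∧
      (⟨4, by omega, by omega⟩ : Set.Icc 1 n) ≠ top hn :=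
    ⟨(ne_bot_iff _).2 (show 2 ≤ 4 by omega), (ne_top_iff _).2 (show 4 ≤ n - 1 by omega)⟩
  refine exists_perm_of_permReach (⟨4, by omega, by omega⟩, ⟨4, by omega, by omega⟩) ?_
  have hq4 : ∀ (p : Set.Icc 1 m) (q : Set.Icc 1 n), p ≠ bot hm → p ≠ top hm → q ≠ bot hn →
      q ≠ top hn → 4 ≤ q.1 →
      PermReach φ ψ hm hn (p, q) (⟨4, by omega, by omega⟩, ⟨4, by omega, by omega⟩) := by
    intro p q h1 h2 h3 h4 hq
    exact (hrow p _ q h1 h2 h4m.1 h4m.2 hq).trans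
      (hcol _ q _ h3 h4 h4n.1 h4n.2 (le_refl 4))
  have hp4 : ∀ (p : Set.Icc 1 m) (q : Set.Icc 1 n), p ≠ bot hm → p ≠ top hm → q ≠ bot hn →
      q ≠ top hn → 4 ≤ p.1 →
      PermReach φ ψ hm hn (p, q) (⟨4, by omega, by omega⟩, ⟨4, by omega, by omega⟩) := by
    intro p q h1 h2 h3 h4 hp
    exact (hcol p q _ h3 h4 h4n.1 h4n.2 hp).trans (hrow p _ _ h1 h2 h4m.1 h4m.2 (le_refl 4))
  have hmid_step : ∀ {k : ℕ} {hk : 5 ≤ k} {χ : β → Letter} {x : β} {q : Set.Icc 1 k},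
      (χ x = .a ∨ χ x = .b) → q ≠ bot hk → q ≠ top hk →
      (dialectDFA χ hk).step q x ≠ bot hk ∧ (dialectDFA χ hk).step q x ≠ top hk := by
    intro k hk χ x q hx h1 h2
    constructor
    · intro h
      exact h1 (step_injective_of_perm hx (h.trans (step_bot_of_perm (hn := hk) hx).symm))
    · intro h
      exact h2 (step_injective_of_perm hx (h.trans (step_top (hn := hk) x).symm))
  have hq3 : ∀ (p : Set.Icc 1 m) (q : Set.Icc 1 n), p ≠ bot hm → p ≠ top hm → q ≠ bot hn →
      q ≠ top hn → q.1 = 3 →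
      PermReach φ ψ hm hn (p, q) (⟨4, by omega, by omega⟩, ⟨4, by omega, by omega⟩) := by
    intro p q h1 h2 h3 h4 hq
    refine (PermReach.step hB (p, q)).trans (hq4 _ _ (hmid_step hB.1 h1 h2).1
      (hmid_step hB.1 h1 h2).2 (hmid_step hB.2 h3 h4).1 (hmid_step hB.2 h3 h4).2 ?_)
    show 4 ≤ ((dialectDFA ψ hn).step q b).1
    rw [step_a_val hb.2 (by omega) (by omega)]
    omega
  intro p q h1 h2 h3 h4
  have hp2 := (ne_bot_iff p).1 h1
  have hq2 := (ne_bot_iff q).1 h3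
  by_cases hq : 4 ≤ q.1
  · exact hq4 p q h1 h2 h3 h4 hq
  by_cases hp : 4 ≤ p.1
  · exact hp4 p q h1 h2 h3 h4 hp
  by_cases hq' : q.1 = 3
  · exact hq3 p q h1 h2 h3 h4 hq'
  have hq2' : q.1 = 2 := by omega
  by_cases hp' : p.1 = 3
  · refine (PermReach.step hA (p, q)).trans (hp4 _ _ (hmid_step hA.1 h1 h2).1
      (hmid_step hA.1 h1 h2).2 (hmid_step hA.2 h3 h4).1 (hmid_step hA.2 h3 h4).2 ?_)
    show 4 ≤ ((dialectDFA φ hm).step p a).1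
    rw [step_a_val ha.1 (by omega) (by omega)]
    omega
  · refine (PermReach.step hB (p, q)).trans (hq3 _ _ (hmid_step hB.1 h1 h2).1
      (hmid_step hB.1 h1 h2).2 (hmid_step hB.2 h3 h4).1 (hmid_step hB.2 h3 h4).2 ?_)
    show ((dialectDFA ψ hn).step q b).1 = 3
    rw [step_a_val hb.2 (by omega) (by omega)]
    omega

/-- With the same roles in both components, the difference of the cycle lengths does the work. From
(2, q) with q ≥ 4, applying `b` and then undoing `a` gives (2, q − 1), down to (2, 3). All rows are
brought to row 2 by undoing `a`. -/
theorem jointlyTransitive_of_lt {a b d e f : β} (ha : φ a = .a ∧ ψ a = .a)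
    (hb : φ b = .b ∧ ψ b = .b) (hd : φ d = .d ∧ ψ d = .d) (he : φ e = .e ∧ ψ e = .e)
    (hf : φ f = .f ∧ ψ f = .f) (hmn : m < n) : JointlyTransitive φ ψ hm hn := by
  refine ⟨⟨⟨a, ha.1⟩, ⟨a, ha.2⟩⟩, ⟨d, hd⟩, ⟨e, he⟩, ⟨f, hf⟩, ?_⟩
  have hA : IsPermLetter φ ψ a := ⟨Or.inl ha.1, Or.inl ha.2⟩
  have hB : IsPermLetter φ ψ b := ⟨Or.inr hb.1, Or.inr hb.2⟩
  refine exists_perm_of_permReach (two hm, ⟨3, three_mem hn⟩) ?_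
  have hthree : ∀ k, ∀ p : Set.Icc 1 m, ∀ q : Set.Icc 1 n, p.1 = 2 → q.1 = 3 + k → q.1 ≤ n - 1 →
      PermReach φ ψ hm hn (p, q) (two hm, ⟨3, three_mem hn⟩) := by
    intro k
    induction k with
    | zero =>
      intro p q hp hq _
      rw [show p = two hm from Subtype.ext hp, show q = ⟨3, three_mem hn⟩ from Subtype.ext hq]
      exact PermReach.refl _
    | succ k ih =>
      intro p q hp hq hqn
      have hq' : q.1 - 1 ∈ Set.Icc 1 n := ⟨by omega, by omega⟩
      have h1 := PermReach.step (hm := hm) (hn := hn) hB (p, q)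
      have h2 := PermReach.step (hm := hm) (hn := hn) hA (p, ⟨q.1 - 1, hq'⟩)
      have e1 : (dialectDFA φ hm).step p b = (dialectDFA φ hm).step p a := by
        refine Subtype.ext ?_
        rw [step_b_two hb.1 hp, step_a_val ha.1 (by omega) (by omega), hp]
      have e2 : (dialectDFA ψ hn).step q b = (dialectDFA ψ hn).step ⟨q.1 - 1, hq'⟩ a := by
        rw [step_b_of_le hb.2 (by omega)]
        refine Subtype.ext ?_
        rw [step_a_val ha.2 (show 2 ≤ q.1 - 1 by omega) (show q.1 - 1 < n - 1 by omega)]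
        show q.1 = q.1 - 1 + 1
        omega
      dsimp only at h1 h2
      rw [e1, e2] at h1
      exact h1.trans (h2.symm.trans (ih p ⟨q.1 - 1, hq'⟩ hp (show q.1 - 1 = 3 + k by omega)
        (show q.1 - 1 ≤ n - 1 by omega)))
  have hdiag : ∀ k, k ≤ m - 3 → ∃ (p : Set.Icc 1 m) (q : Set.Icc 1 n), p.1 = 2 + k ∧ q.1 = 2 + k ∧
      PermReach φ ψ hm hn (two hm, two hn) (p, q) := by
    intro k
    induction k with
    | zero => intro _; exact ⟨two hm, two hn, rfl, rfl, PermReach.refl _⟩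
    | succ k ih =>
      intro hk
      obtain ⟨p, q, hp, hq, h⟩ := ih (by omega)
      refine ⟨(dialectDFA φ hm).step p a, (dialectDFA ψ hn).step q a, ?_, ?_,
        h.trans (PermReach.step hA (p, q))⟩
      · rw [step_a_val ha.1 (by omega) (by omega), hp]; omega
      · rw [step_a_val ha.2 (by omega) (by omega), hq]; omega
  have htwo : ∀ p : Set.Icc 1 m, ∀ q : Set.Icc 1 n, p.1 = 2 → q ≠ bot hn → q ≠ top hn →
      PermReach φ ψ hm hn (p, q) (two hm, ⟨3, three_mem hn⟩) := by
    intro p q hp h3 h4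
    rw [ne_bot_iff] at h3
    rw [ne_top_iff] at h4
    by_cases hq : q.1 = 2
    -- From (2, 2), follow the diagonal to (m − 1, m − 1); one more `a` wraps only the first
    -- component and gives (2, m). Here m < n is essential.
    · obtain ⟨p', q', hp', hq', h⟩ := hdiag (m - 3) le_rfl
      rw [show p = two hm from Subtype.ext hp, show q = two hn from Subtype.ext hq]
      refine h.trans ((PermReach.step hA (p', q')).trans (hthree (m - 3) _ _ ?_ ?_ ?_))
      · show ((dialectDFA φ hm).step p' a).1 = 2
        exact step_a_last ha.1 (by omega)
      · show ((dialectDFA ψ hn).step q' a).1 = _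
        rw [step_a_val ha.2 (by omega) (by omega)]
        omega
      · show ((dialectDFA ψ hn).step q' a).1 ≤ _
        rw [step_a_val ha.2 (by omega) (by omega)]
        omega
    · exact hthree (q.1 - 3) p q hp (by omega) h4
  have hall : ∀ k, ∀ p : Set.Icc 1 m, ∀ q : Set.Icc 1 n, p.1 = 2 + k → p.1 ≤ m - 1 →
      q ≠ bot hn → q ≠ top hn → PermReach φ ψ hm hn (p, q) (two hm, ⟨3, three_mem hn⟩) := by
    intro k
    induction k with
    | zero => intro p q hp _ h3 h4; exact htwo p q hp h3 h4
    | succ k ih =>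
      intro p q hp hpm h3 h4
      have hp' : p.1 - 1 ∈ Set.Icc 1 m := ⟨by omega, by omega⟩
      have h3' := (ne_bot_iff q).1 h3
      have h4' := (ne_top_iff q).1 h4
      obtain ⟨q', hq1, hq2, hq'⟩ : ∃ q' : Set.Icc 1 n, q' ≠ bot hn ∧ q' ≠ top hn ∧
          (dialectDFA ψ hn).step q' a = q := by
        by_cases hq : q.1 = 2
        · refine ⟨⟨n - 1, pred_mem hn⟩, (ne_bot_iff _).2 (show 2 ≤ n - 1 by omega),
            (ne_top_iff _).2 (le_refl (n - 1)), Subtype.ext ?_⟩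
          rw [step_a_last ha.2 rfl, hq]
        · refine ⟨⟨q.1 - 1, by omega, by omega⟩, (ne_bot_iff _).2 (show 2 ≤ q.1 - 1 by omega),
            (ne_top_iff _).2 (show q.1 - 1 ≤ n - 1 by omega), Subtype.ext ?_⟩
          rw [step_a_val ha.2 (show 2 ≤ q.1 - 1 by omega) (show q.1 - 1 < n - 1 by omega)]
          show q.1 - 1 + 1 = q.1
          omega
      have h1 := PermReach.step (hm := hm) (hn := hn) hA (⟨p.1 - 1, hp'⟩, q')
      have e1 : (dialectDFA φ hm).step ⟨p.1 - 1, hp'⟩ a = p := by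
        refine Subtype.ext ?_
        rw [step_a_val ha.1 (show 2 ≤ p.1 - 1 by omega) (show p.1 - 1 < m - 1 by omega)]
        show p.1 - 1 + 1 = p.1
        omega
      dsimp only at h1
      rw [e1, hq'] at h1
      exact h1.symm.trans (ih _ q' (show p.1 - 1 = 2 + k by omega)
        (show p.1 - 1 ≤ m - 1 by omega) hq1 hq2)
  intro p q h1 h2 h3 h4
  rw [ne_bot_iff] at h1
  rw [ne_top_iff] at h2
  exact hall (p.1 - 2) p q (by omega) h2 h3 h4

theorem jointlyTransitive_of_ne {a b d e f : β} (ha : φ a = .a) (hb : φ b = .b) (hd : φ d = .d)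
    (he : φ e = .e) (hf : φ f = .f) (hmn : m ≠ n) : JointlyTransitive φ φ hm hn := by
  rcases lt_or_gt_of_ne hmn with h | h
  · exact jointlyTransitive_of_lt ⟨ha, ha⟩ ⟨hb, hb⟩ ⟨hd, hd⟩ ⟨he, he⟩ ⟨hf, hf⟩ h
  · exact (jointlyTransitive_of_lt ⟨ha, ha⟩ ⟨hb, hb⟩ ⟨hd, hd⟩ ⟨he, he⟩ ⟨hf, hf⟩ h).symm

end Boolean

end MostComplex

namespace MostComplex

/-! ### Sharpness of the bounds for boolean operations -/

section BooleanBound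

variable {β : Type} {m n : ℕ} {φ ψ : β → Letter} {hm : 5 ≤ m} {hn : 5 ≤ n}
  {f : Bool → Bool → Bool}

theorem step_f_two {x : β} (hx : φ x = .f) : (dialectDFA φ hn).step (two hn) x = top hn :=
  (congrFun (step_f (hn := hn) hx) (two hn)).trans (Function.update_self ..)

theorem step_f_of_ne {x : β} (hx : φ x = .f) {q : Set.Icc 1 n} (hq : q ≠ two hn) :
    (dialectDFA φ hn).step q x = q :=
  (congrFun (step_f (hn := hn) hx) q).trans (Function.update_of_ne hq ..)

theorem three_ne_two (hn : 5 ≤ n) : (⟨3, three_mem hn⟩ : Set.Icc 1 n) ≠ two hn := fun h =>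
  absurd (congrArg Subtype.val h) (show (3 : ℕ) ≠ 2 by omega)

theorem three_ne_bot (hn : 5 ≤ n) : (⟨3, three_mem hn⟩ : Set.Icc 1 n) ≠ bot hn :=
  (ne_bot_iff _).2 (show 2 ≤ 3 by omega)

theorem three_ne_top (hn : 5 ≤ n) : (⟨3, three_mem hn⟩ : Set.Icc 1 n) ≠ top hn :=
  (ne_top_iff _).2 (show 3 ≤ n - 1 by omega)

theorem boolOp_ne {α : Type} {K L K' L' : Language α} {w : List α} {x y x' y' : Bool}
    (hK : w ∈ K ↔ x = true) (hL : w ∈ L ↔ y = true) (hK' : w ∈ K' ↔ x' = true)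
    (hL' : w ∈ L' ↔ y' = true) (h : f x y ≠ f x' y') : boolOp f K L ≠ boolOp f K' L' := by
  classical
  intro he
  have h1 : w ∈ boolOp f K L ↔ w ∈ boolOp f K' L' := by rw [he]
  rw [mem_boolOp, mem_boolOp] at h1
  simp only [hK, hL, hK', hL', Bool.decide_eq_true] at h1
  exact h (Bool.eq_iff_iff.2 h1)

theorem IsProper.flip (hf : IsProper f) : IsProper (flip f) :=
  ⟨fun ⟨g, hg⟩ => hf.2 ⟨g, fun x y => hg y x⟩, fun ⟨g, hg⟩ => hf.1 ⟨g, fun x y => hg y x⟩⟩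

/-- Otherwise f would not depend on its first argument. -/
theorem IsProper.ne_of_eq (hf : IsProper f) (h : f true true = f false true) :
    f true false ≠ f false false := by
  intro h'
  refine hf.2 ⟨fun y => f true y, fun x y => ?_⟩
  cases x <;> cases y <;> simp [h, h']

/-- Pairs of middle states are reached through `e` and permutations. To put one component at 1 or n,
apply `d` at (m − 1, 2) or `f` at (2, 3), which leaves the other component alone, and then permute
the latter. -/
theorem JointlyTransitive.exists_evalFrom (h : JointlyTransitive φ ψ hm hn) (p : Set.Icc 1 m)
    (q : Set.Icc 1 n) :
    ∃ w, (dialectDFA φ hm).evalFrom (bot hm) w = p ∧ (dialectDFA ψ hn).evalFrom (bot hn) w = q := by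
  have hmid : ∀ (p : Set.Icc 1 m) (q : Set.Icc 1 n), p ≠ bot hm → p ≠ top hm → q ≠ bot hn →
      q ≠ top hn → ∃ w, (dialectDFA φ hm).evalFrom (bot hm) w = p ∧
        (dialectDFA ψ hn).evalFrom (bot hn) w = q := by
    intro p q h1 h2 h3 h4
    obtain ⟨e, he⟩ := h.exists_e
    obtain ⟨w, -, hw⟩ := h.exists_perm (two hm) p (two hn) q (two_ne_bot hm) (two_ne_top hm) h1 h2
      (two_ne_bot hn) (two_ne_top hn) h3 h4
    refine ⟨e :: w, ?_⟩
    rw [DFA.evalFrom_cons, DFA.evalFrom_cons, step_e he.1 (bot_ne_top hm),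
      step_e he.2 (bot_ne_top hn)]
    exact hw
  have hleft : ∀ {m n : ℕ} {φ ψ : β → Letter} {hm : 5 ≤ m} {hn : 5 ≤ n},
      JointlyTransitive φ ψ hm hn →
      (∀ (p : Set.Icc 1 m) (q : Set.Icc 1 n), p ≠ bot hm → p ≠ top hm → q ≠ bot hn →
        q ≠ top hn → ∃ w, (dialectDFA φ hm).evalFrom (bot hm) w = p ∧
        (dialectDFA ψ hn).evalFrom (bot hn) w = q) →
      ∀ (p : Set.Icc 1 m) (q : Set.Icc 1 n), p = bot hm ∨ p = top hm → q ≠ bot hn → q ≠ top hn →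
        ∃ w, (dialectDFA φ hm).evalFrom (bot hm) w = p ∧
        (dialectDFA ψ hn).evalFrom (bot hn) w = q := by
    intro m n φ ψ hm hn h hmid p q hp h3 h4
    rcases hp with rfl | rfl
    · obtain ⟨d, hd⟩ := h.exists_d
      obtain ⟨u, hu⟩ := hmid ⟨m - 1, pred_mem hm⟩ (two hn) ((ne_bot_iff _).2 (show 2 ≤ m - 1 by omega))
        ((ne_top_iff _).2 (le_refl (m - 1))) (two_ne_bot hn) (two_ne_top hn)
      obtain ⟨v, hv, -, hv'⟩ := h.exists_perm (two hm) (two hm) (two hn) q (two_ne_bot hm)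
        (two_ne_top hm) (two_ne_bot hm) (two_ne_top hm) (two_ne_bot hn) (two_ne_top hn) h3 h4
      have e1 : (dialectDFA φ hm).step ⟨m - 1, pred_mem hm⟩ d = bot hm :=
        (congrFun (step_d (hn := hm) hd.1) _).trans (Function.update_self ..)
      have e2 : (dialectDFA ψ hn).step (two hn) d = two hn := by
        refine (congrFun (step_d (hn := hn) hd.2) _).trans (Function.update_of_ne (fun h => ?_) ..)
        have : 2 = n - 1 := congrArg Subtype.val h
        omega
      refine ⟨u ++ d :: v, ?_⟩
      rw [evalFrom_append, evalFrom_append, hu.1, hu.2, DFA.evalFrom_cons, DFA.evalFrom_cons, e1, e2]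
      exact ⟨evalFrom_bot_of_perm fun x hx => (hv x hx).1, hv'⟩
    · obtain ⟨x, hx⟩ := h.exists_f
      obtain ⟨u, hu⟩ := hmid (two hm) ⟨3, three_mem hn⟩ (two_ne_bot hm) (two_ne_top hm)
        (three_ne_bot hn) (three_ne_top hn)
      obtain ⟨v, -, -, hv⟩ := h.exists_perm (two hm) (two hm) ⟨3, three_mem hn⟩ q (two_ne_bot hm)
        (two_ne_top hm) (two_ne_bot hm) (two_ne_top hm) (three_ne_bot hn) (three_ne_top hn) h3 h4
      refine ⟨u ++ x :: v, ?_⟩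
      rw [evalFrom_append, evalFrom_append, hu.1, hu.2, DFA.evalFrom_cons, DFA.evalFrom_cons,
        step_f_two hx.1, step_f_of_ne hx.2 (three_ne_two hn)]
      exact ⟨evalFrom_top v, hv⟩
  have hright : ∀ (p : Set.Icc 1 m) (q : Set.Icc 1 n), p ≠ bot hm → p ≠ top hm →
      q = bot hn ∨ q = top hn → ∃ w, (dialectDFA φ hm).evalFrom (bot hm) w = p ∧
        (dialectDFA ψ hn).evalFrom (bot hn) w = q := by
    intro p q h1 h2 hq
    obtain ⟨w, hw⟩ := hleft h.symm (fun q p h3 h4 h1 h2 => (hmid p q h1 h2 h3 h4).imp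
      fun _ hw => hw.symm) q p hq h1 h2
    exact ⟨w, hw.symm⟩
  obtain ⟨x, hx⟩ := h.exists_f
  have hx1 : (dialectDFA φ hm).step (bot hm) x = bot hm := step_f_of_ne hx.1 (two_ne_bot hm).symm
  have hx2 : (dialectDFA ψ hn).step (bot hn) x = bot hn := step_f_of_ne hx.2 (two_ne_bot hn).symm
  by_cases hp : p ≠ bot hm ∧ p ≠ top hm
  · by_cases hq : q ≠ bot hn ∧ q ≠ top hn
    · exact hmid p q hp.1 hp.2 hq.1 hq.2
    · exact hright p q hp.1 hp.2 (by tauto)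
  · by_cases hq : q ≠ bot hn ∧ q ≠ top hn
    · exact hleft h hmid p q (by tauto) hq.1 hq.2
    · have hp' : p = bot hm ∨ p = top hm := by tauto
      have hq' : q = bot hn ∨ q = top hn := by tauto
      rcases hp' with rfl | rfl <;> rcases hq' with rfl | rfl
      · exact ⟨[], rfl, rfl⟩
      · obtain ⟨u, hu⟩ := hleft h hmid (bot hm) (two hn) (Or.inl rfl) (two_ne_bot hn) (two_ne_top hn)
        refine ⟨u ++ [x], ?_⟩
        rw [evalFrom_append, evalFrom_append, hu.1, hu.2, DFA.evalFrom_singleton,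
          DFA.evalFrom_singleton]
        exact ⟨hx1, step_f_two hx.2⟩
      · obtain ⟨u, hu⟩ := hright (two hm) (bot hn) (two_ne_bot hm) (two_ne_top hm) (Or.inl rfl)
        refine ⟨u ++ [x], ?_⟩
        rw [evalFrom_append, evalFrom_append, hu.1, hu.2, DFA.evalFrom_singleton,
          DFA.evalFrom_singleton]
        exact ⟨step_f_two hx.1, hx2⟩
      · obtain ⟨u, hu⟩ := hmid (two hm) (two hn) (two_ne_bot hm) (two_ne_top hm) (two_ne_bot hn)
          (two_ne_top hn)
        refine ⟨u ++ [x], ?_⟩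
        rw [evalFrom_append, evalFrom_append, hu.1, hu.2, DFA.evalFrom_singleton,
          DFA.evalFrom_singleton]
        exact ⟨step_f_two hx.1, step_f_two hx.2⟩

theorem JointlyTransitive.isMinimalDFA_left (h : JointlyTransitive φ ψ hm hn) :
    IsMinimalDFA (dialectDFA φ hm) := by
  obtain ⟨a, ha⟩ := h.exists_a.1
  obtain ⟨e, he⟩ := h.exists_e
  obtain ⟨x, hx⟩ := h.exists_f
  exact isMinimalDFA_dialectDFA ha he.1 hx.1

/-- After w, append `e`, a permutation taking (2, 2) to (3, 2), and `f`. The second component now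
accepts from every state, and the first exactly where w was already accepted, so only the values of
f with second argument true are compared. -/
theorem JointlyTransitive.boolOp_ne_of_mem (h : JointlyTransitive φ ψ hm hn)
    (hf : f true true ≠ f false true) {p p' : Set.Icc 1 m} (q q' : Set.Icc 1 n) {w : List β}
    (hp : (dialectDFA φ hm).evalFrom p w = top hm) (hp' : (dialectDFA φ hm).evalFrom p' w ≠ top hm) :
    boolOp f ((dialectDFA φ hm).acceptsFrom p) ((dialectDFA ψ hn).acceptsFrom q) ≠
      boolOp f ((dialectDFA φ hm).acceptsFrom p') ((dialectDFA ψ hn).acceptsFrom q') := by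
  obtain ⟨e, he⟩ := h.exists_e
  obtain ⟨x, hx⟩ := h.exists_f
  obtain ⟨v, -, hv1, hv2⟩ := h.exists_perm (two hm) ⟨3, three_mem hm⟩ (two hn) (two hn)
    (two_ne_bot hm) (two_ne_top hm) (three_ne_bot hm) (three_ne_top hm) (two_ne_bot hn)
    (two_ne_top hn) (two_ne_bot hn) (two_ne_top hn)
  have hq : ∀ q, (dialectDFA ψ hn).evalFrom q (w ++ e :: (v ++ [x])) = top hn := by
    intro q
    rw [evalFrom_append, DFA.evalFrom_cons]
    by_cases hq : (dialectDFA ψ hn).evalFrom q w = top hn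
    · rw [hq, step_top, evalFrom_top]
    · rw [step_e he.2 hq, evalFrom_append, hv2, DFA.evalFrom_singleton, step_f_two hx.2]
  refine boolOp_ne (w := w ++ e :: (v ++ [x])) (x := true) (y := true) (x' := false) (y' := true)
    ?_ ?_ ?_ ?_ hf
  · rw [mem_acceptsFrom_dialectDFA, evalFrom_append, hp, evalFrom_top]
    simp
  · rw [mem_acceptsFrom_dialectDFA, hq]
    simp
  · rw [mem_acceptsFrom_dialectDFA, evalFrom_append, DFA.evalFrom_cons, step_e he.1 hp',
      evalFrom_append, hv1, DFA.evalFrom_singleton, step_f_of_ne hx.1 (three_ne_two hm)]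
    simpa using three_ne_top hm
  · rw [mem_acceptsFrom_dialectDFA, hq]
    simp

/-- A permutation taking p to 2 and q' away from 2, followed by `f`, accepts from p but from neither
p' nor q'. The value at q is either that at q' or irrelevant to f. -/
theorem JointlyTransitive.boolOp_ne_of_ne_bot (h : JointlyTransitive φ ψ hm hn)
    (hf : f true false ≠ f false false) {p p' : Set.Icc 1 m} {q q' : Set.Icc 1 n} (hpp : p ≠ p')
    (hpb : p ≠ bot hm) (hpt : p ≠ top hm) (hpt' : p' ≠ top hm) (hqt : q' ≠ top hn)
    (hqq : q = q' ∨ f true true = f true false) :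
    boolOp f ((dialectDFA φ hm).acceptsFrom p) ((dialectDFA ψ hn).acceptsFrom q) ≠
      boolOp f ((dialectDFA φ hm).acceptsFrom p') ((dialectDFA ψ hn).acceptsFrom q') := by
  classical
  obtain ⟨x, hx⟩ := h.exists_f
  obtain ⟨u, hu, hup, huq⟩ : ∃ u : List β, (∀ x ∈ u, IsPermLetter φ ψ x) ∧
      (dialectDFA φ hm).evalFrom p u = two hm ∧ (dialectDFA ψ hn).evalFrom q' u ≠ two hn := by
    by_cases hq' : q' = bot hn
    · obtain ⟨u, hu, h1, -⟩ := h.exists_perm p (two hm) (two hn) (two hn) hpb hpt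
        (two_ne_bot hm) (two_ne_top hm) (two_ne_bot hn) (two_ne_top hn) (two_ne_bot hn)
        (two_ne_top hn)
      refine ⟨u, hu, h1, ?_⟩
      rw [hq', evalFrom_bot_of_perm fun x hx => (hu x hx).2]
      exact (two_ne_bot hn).symm
    · obtain ⟨u, hu, h1, h2⟩ := h.exists_perm p (two hm) q' ⟨3, three_mem hn⟩ hpb hpt
        (two_ne_bot hm) (two_ne_top hm) hq' hqt (three_ne_bot hn) (three_ne_top hn)
      refine ⟨u, hu, h1, ?_⟩
      rw [h2]
      exact three_ne_two hn
  have hne : ∀ {k : ℕ} {hk : 5 ≤ k} {χ : β → Letter}, (∀ x ∈ u, χ x = .a ∨ χ x = .b) →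
      χ x = .f → ∀ {r : Set.Icc 1 k}, r ≠ top hk → (dialectDFA χ hk).evalFrom r u ≠ two hk →
      (dialectDFA χ hk).evalFrom r (u ++ [x]) ≠ top hk := by
    intro k hk χ hχ hχx r hr hr2
    rw [evalFrom_append, DFA.evalFrom_singleton, step_f_of_ne hχx hr2]
    exact fun h => hr (evalFrom_injective_of_perm hχ (h.trans (evalFrom_top (hn := hk) u).symm))
  have h1 : (dialectDFA φ hm).evalFrom p (u ++ [x]) = top hm := by
    rw [evalFrom_append, hup, DFA.evalFrom_singleton, step_f_two hx.1]
  have h2 : (dialectDFA φ hm).evalFrom p' (u ++ [x]) ≠ top hm :=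
    hne (fun x hx => (hu x hx).1) hx.1 hpt' fun h =>
      hpp (evalFrom_injective_of_perm (fun x hx => (hu x hx).1) (hup.trans h.symm))
  have h3 : (dialectDFA ψ hn).evalFrom q' (u ++ [x]) ≠ top hn :=
    hne (fun x hx => (hu x hx).2) hx.2 hqt huq
  refine boolOp_ne (w := u ++ [x]) (x := true)
    (y := decide ((dialectDFA ψ hn).evalFrom q (u ++ [x]) = top hn)) (x' := false) (y' := false)
    ?_ ?_ ?_ ?_ ?_
  · rw [mem_acceptsFrom_dialectDFA, h1]
    simp
  · rw [mem_acceptsFrom_dialectDFA]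
    simp
  · rw [mem_acceptsFrom_dialectDFA]
    simpa using h2
  · rw [mem_acceptsFrom_dialectDFA]
    simpa using h3
  · rcases hqq with rfl | hqq
    · rw [decide_eq_false h3]
      exact hf
    · cases decide ((dialectDFA ψ hn).evalFrom q (u ++ [x]) = top hn)
      · exact hf
      · rw [hqq]
        exact hf

theorem JointlyTransitive.boolOp_ne_of_ne_left (h : JointlyTransitive φ ψ hm hn) (hf : IsProper f)
    {p p' : Set.Icc 1 m} {q q' : Set.Icc 1 n} (hpp : p ≠ p')
    (hqq : f true true ≠ f false true ∨
      q ≠ top hn ∧ q' ≠ top hn ∧ (q = q' ∨ f true true = f true false)) :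
    boolOp f ((dialectDFA φ hm).acceptsFrom p) ((dialectDFA ψ hn).acceptsFrom q) ≠
      boolOp f ((dialectDFA φ hm).acceptsFrom p') ((dialectDFA ψ hn).acceptsFrom q') := by
  by_cases hη : f true true ≠ f false true
  · have hsep : ¬ (dialectDFA φ hm).acceptsFrom p = (dialectDFA φ hm).acceptsFrom p' :=
      fun h' => hpp (h.isMinimalDFA_left.2 p p' h')
    rw [Language.ext_iff, not_forall] at hsep
    obtain ⟨w, hw⟩ := hsep
    rw [mem_acceptsFrom_dialectDFA, mem_acceptsFrom_dialectDFA] at hw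
    by_cases hp : (dialectDFA φ hm).evalFrom p w = top hm
    · exact h.boolOp_ne_of_mem hη q q' hp (by tauto)
    · exact (h.boolOp_ne_of_mem hη q' q (by tauto) hp).symm
  obtain ⟨hq, hq', hγ⟩ := hqq.resolve_left hη
  have hne := hf.ne_of_eq (not_not.1 hη)
  have htop : ∀ {p p' : Set.Icc 1 m} {q q' : Set.Icc 1 n}, p = top hm → p' ≠ top hm →
      q ≠ top hn → q' ≠ top hn →
      boolOp f ((dialectDFA φ hm).acceptsFrom p) ((dialectDFA ψ hn).acceptsFrom q) ≠
      boolOp f ((dialectDFA φ hm).acceptsFrom p') ((dialectDFA ψ hn).acceptsFrom q') := by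
    intro p p' q q' hp hp' hq hq'
    refine boolOp_ne (w := []) (x := true) (y := false) (x' := false) (y' := false) ?_ ?_ ?_ ?_ hne
      <;> rw [mem_acceptsFrom_dialectDFA, DFA.evalFrom_nil] <;> simpa
  by_cases hp : p = top hm
  · exact htop hp (fun h => hpp (hp.trans h.symm)) hq hq'
  by_cases hp' : p' = top hm
  · exact (htop hp' hp hq' hq).symm
  by_cases hpb : p = bot hm
  · refine (h.boolOp_ne_of_ne_bot hne hpp.symm (fun h => hpp (hpb.trans h.symm)) hp' hp hq ?_).symm
    exact hγ.imp_left Eq.symm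
  · exact h.boolOp_ne_of_ne_bot hne hpp hpb hp hp' hq' hγ

theorem JointlyTransitive.boolOp_ne_of_ne_right (h : JointlyTransitive φ ψ hm hn) (hf : IsProper f)
    {p p' : Set.Icc 1 m} {q q' : Set.Icc 1 n} (hqq : q ≠ q')
    (hpp : f true true ≠ f true false ∨
      p ≠ top hm ∧ p' ≠ top hm ∧ (p = p' ∨ f true true = f false true)) :
    boolOp f ((dialectDFA φ hm).acceptsFrom p) ((dialectDFA ψ hn).acceptsFrom q) ≠
      boolOp f ((dialectDFA φ hm).acceptsFrom p') ((dialectDFA ψ hn).acceptsFrom q') :=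
  h.symm.boolOp_ne_of_ne_left hf.flip hqq hpp

theorem encard_setOf_imp_ne {n : ℕ} (hn : 5 ≤ n) (c : Prop) [Decidable c] :
    {q : Set.Icc 1 n | c → q ≠ top hn}.encard = ((if c then n - 1 else n : ℕ) : ℕ∞) := by
  by_cases hc : c
  · simp only [hc, forall_const, if_true]
    have h := Set.encard_add_encard_compl ({top hn} : Set (Set.Icc 1 n))
    rw [Set.encard_singleton, Set.encard_univ, enatCard_states] at h
    have h' : ((1 : ℕ) + (n - 1 : ℕ) : ℕ∞) = n := by
      rw [← Nat.cast_add, Nat.add_sub_cancel' (by omega)]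
    exact WithTop.add_left_cancel (ENat.natCast_ne_top 1) (h.trans h'.symm)
  · simp only [hc, false_imp_iff, if_false]
    rw [← enatCard_states n, ← Set.encard_univ]
    rfl

/-- Every pair of states is reached, so it remains to see that unmerged pairs give different
languages. -/
theorem JointlyTransitive.complexity_boolOp (h : JointlyTransitive φ ψ hm hn) (hf : IsProper f) :
    complexity (boolOp f (dialectDFA φ hm).accepts (dialectDFA ψ hn).accepts) =
      (boolBound f m n : ℕ∞) := by
  refine le_antisymm ?_ ?_
  · obtain ⟨⟨a, ha⟩, ⟨b, hb⟩⟩ := h.exists_a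
    obtain ⟨e, he⟩ := h.exists_e
    obtain ⟨x, hx⟩ := h.exists_f
    exact complexity_boolOp_le (isRegularTwoSidedIdeal_dialectDFA he.1 hx.1)
      (isRegularTwoSidedIdeal_dialectDFA he.2 hx.2) (complexity_dialectDFA ha he.1 hx.1)
      (complexity_dialectDFA hb he.2 hx.2)
  let F : Set.Icc 1 m × Set.Icc 1 n → Language β := fun s =>
    boolOp f ((dialectDFA φ hm).acceptsFrom s.1) ((dialectDFA ψ hn).acceptsFrom s.2)
  -- The pairs without an absorbing n; all pairs with one are represented by (n, n) in its
  -- respective components, that is by `(top hm, top hn)`.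
  let N : Set (Set.Icc 1 m × Set.Icc 1 n) :=
    {p | f true true = f true false → p ≠ top hm} ×ˢ {q | f true true = f false true → q ≠ top hn}
  have hinj : Set.InjOn F N := by
    rintro ⟨p, q⟩ ⟨hp, hq⟩ ⟨p', q'⟩ ⟨hp', hq'⟩ heq
    simp only [Set.mem_ofPred_eq] at hp hq hp' hq'
    by_contra hne
    by_cases hpp : p = p'
    · have hqq : q ≠ q' := fun hqq => hne (by rw [hpp, hqq])
      exact h.boolOp_ne_of_ne_right hf hqq (by tauto) heq
    by_cases hγ : f true true = f true false
    · exact h.boolOp_ne_of_ne_left hf hpp (by tauto) heq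
    by_cases hqq : q = q'
    · exact h.boolOp_ne_of_ne_left hf hpp (by tauto) heq
    · exact h.boolOp_ne_of_ne_right hf hqq (Or.inl hγ) heq
  have hsub : ∀ A : Set (Set.Icc 1 m × Set.Icc 1 n), F '' A ⊆
      quotients (boolOp f (dialectDFA φ hm).accepts (dialectDFA ψ hn).accepts) := by
    rintro A _ ⟨⟨p, q⟩, -, rfl⟩
    obtain ⟨w, rfl, rfl⟩ := h.exists_evalFrom p q
    refine ⟨w, ?_⟩
    rw [leftQuotient_boolOp]
    exact congrArg₂ _ (leftQuotient_acceptsFrom _ _ w) (leftQuotient_acceptsFrom _ _ w)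
  have hN : N.encard = (((if f true true = f true false then m - 1 else m) *
      (if f true true = f false true then n - 1 else n) : ℕ) : ℕ∞) := by
    rw [Set.encard_prod, encard_setOf_imp_ne, encard_setOf_imp_ne, Nat.cast_mul]
  unfold boolBound
  by_cases hc : f true true = f true false ∨ f true true = f false true
  · have htop : (top hm, top hn) ∉ N := fun ⟨h1, h2⟩ => by
      rcases hc with hc | hc
      · exact h1 hc rfl
      · exact h2 hc rfl
    have hinj' : Set.InjOn F (insert (top hm, top hn) N) := by
      rw [Set.injOn_insert htop]
      refine ⟨hinj, ?_⟩
      rintro ⟨⟨p, q⟩, ⟨hp, hq⟩, heq⟩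
      simp only [Set.mem_ofPred_eq] at hp hq
      by_cases hη : f true true = f false true
      · by_cases hγ : f true true = f true false
        · refine boolOp_ne (w := []) (x := false) (y := false) (x' := true) (y' := true)
            ?_ ?_ ?_ ?_ ?_ heq
          · rw [mem_acceptsFrom_dialectDFA, DFA.evalFrom_nil]
            simpa using hp hγ
          · rw [mem_acceptsFrom_dialectDFA, DFA.evalFrom_nil]
            simpa using hq hη
          · rw [mem_acceptsFrom_dialectDFA, DFA.evalFrom_nil]
            simp
          · rw [mem_acceptsFrom_dialectDFA, DFA.evalFrom_nil]
            simp
          · rw [hγ]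
            exact (hf.ne_of_eq hη).symm
        · exact h.boolOp_ne_of_ne_right hf (hq hη) (Or.inl hγ) heq
      · exact h.boolOp_ne_of_ne_left hf (hp (hc.resolve_right hη)) (Or.inl hη) heq
    rw [if_pos hc, Nat.cast_add, ← hN, Nat.cast_one, ← Set.encard_insert_of_notMem htop,
      ← hinj'.encard_image]
    exact Set.encard_le_encard (hsub _)
  · rw [if_neg hc, add_zero, ← hN, ← hinj.encard_image]
    exact Set.encard_le_encard (hsub _)

theorem boolOp_and {α : Type} (K L : Language α) : boolOp (fun x y => x && y) K L = K ⊓ L := by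
  classical
  ext w
  rw [mem_boolOp, Bool.and_eq_true, decide_eq_true_iff, decide_eq_true_iff]
  rfl

theorem boolOp_or {α : Type} (K L : Language α) : boolOp (fun x y => x || y) K L = K ⊔ L := by
  classical
  ext w
  rw [mem_boolOp, Bool.or_eq_true, decide_eq_true_iff, decide_eq_true_iff]
  rfl

theorem boolOp_sdiff {α : Type} (K L : Language α) : boolOp (fun x y => x && !y) K L = K \ L := by
  classical
  ext w
  rw [mem_boolOp, Bool.and_eq_true, Bool.not_eq_true', decide_eq_true_iff, decide_eq_false_iff_not]
  rfl

theorem boolOp_xor {α : Type} (K L : Language α) :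
    boolOp (fun x y => Bool.xor x y) K L = symmDiff K L := by
  classical
  ext w
  rw [mem_boolOp]
  have h : w ∈ symmDiff K L ↔ (w ∈ K ∧ w ∉ L) ∨ (w ∈ L ∧ w ∉ K) := Iff.rfl
  rw [h]
  by_cases h1 : w ∈ K <;> by_cases h2 : w ∈ L <;> simp [h1, h2]

theorem isProper_and : IsProper fun x y => x && y :=
  ⟨fun ⟨g, hg⟩ => by simpa using (hg true true).trans (hg true false).symm,
    fun ⟨g, hg⟩ => by simpa using (hg true true).trans (hg false true).symm⟩

theorem isProper_or : IsProper fun x y => x || y :=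
  ⟨fun ⟨g, hg⟩ => by simpa using (hg false true).trans (hg false false).symm,
    fun ⟨g, hg⟩ => by simpa using (hg true false).trans (hg false false).symm⟩

theorem isProper_sdiff : IsProper fun x y => x && !y :=
  ⟨fun ⟨g, hg⟩ => by simpa using (hg true true).trans (hg true false).symm,
    fun ⟨g, hg⟩ => by simpa using (hg true false).trans (hg false false).symm⟩

theorem isProper_xor : IsProper fun x y => Bool.xor x y :=
  ⟨fun ⟨g, hg⟩ => by simpa using (hg true true).trans (hg true false).symm,
    fun ⟨g, hg⟩ => by simpa using (hg true true).trans (hg false true).symm⟩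

theorem boolBound_and (m n : ℕ) : boolBound (fun x y => x && y) m n = m * n := by
  simp [boolBound]

theorem boolBound_xor (m n : ℕ) : boolBound (fun x y => Bool.xor x y) m n = m * n := by
  simp [boolBound]

theorem boolBound_sdiff {m n : ℕ} (hm : 1 ≤ m) (hn : 1 ≤ n) :
    boolBound (fun x y => x && !y) m n = m * n - (m - 1) := by
  obtain ⟨m, rfl⟩ := Nat.exists_eq_add_of_le hm
  obtain ⟨n, rfl⟩ := Nat.exists_eq_add_of_le hn
  simp only [boolBound, Bool.not_true, Bool.and_false, Bool.not_false, Bool.and_true, Bool.false_eq_true,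
    if_false, if_true, or_true, Nat.add_sub_cancel_left]
  rw [eq_tsub_iff_add_eq_of_le]
  · ring
  · nlinarith

theorem boolBound_or {m n : ℕ} (hm : 1 ≤ m) (hn : 1 ≤ n) :
    boolBound (fun x y => x || y) m n = m * n - (m + n - 2) := by
  obtain ⟨m, rfl⟩ := Nat.exists_eq_add_of_le hm
  obtain ⟨n, rfl⟩ := Nat.exists_eq_add_of_le hn
  simp only [boolBound, Bool.or_true, Bool.or_false, if_true, or_true, Nat.add_sub_cancel_left]
  rw [show 1 + m + (1 + n) - 2 = m + n by omega, eq_tsub_iff_add_eq_of_le]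
  · ring
  · nlinarith

end BooleanBound

end MostComplex

namespace MostComplex

/-! ### Comparing a competitor with the witness -/

section Comparison

variable {α β : Type}

theorem exists_bijOn_of_encard_eq {α β : Type*} {s : Set α} {t : Set β} {k : ℕ} (hs : s.encard = k)
    (ht : t.encard = k) {x : α} {y : β} (hx : x ∈ s) (hy : y ∈ t) :
    ∃ g : α → β, Set.BijOn g s t ∧ g x = y := by
  classical
  have : Nonempty β := ⟨y⟩
  obtain ⟨g, hg⟩ := (Set.finite_of_encard_eq_coe hs).exists_bijOn_of_encard_eq (hs.trans ht.symm)
  refine ⟨Equiv.swap (g x) y ∘ g, Set.BijOn.comp (Equiv.swap_bijOn_self ?_) hg, ?_⟩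
  · exact iff_of_true (hg.mapsTo hx) hy
  · exact Equiv.swap_apply_left _ _

/-- The bound depends only on the size of S and on whether it contains the initial quotient: the
full set and the set missing only that quotient are recognised by these data. -/
theorem atomBound_congr {n : ℕ} {K : Language α} {L : Language β}
    (hK : complexity K = n) (hL : complexity L = n) {T : Set (Language α)} {S : Set (Language β)}
    (hT : T ⊆ quotients K) (hS : S ⊆ quotients L) (hTS : T.encard = S.encard)
    (hmem : K ∈ T ↔ L ∈ S) : atomBound n K T = atomBound n L S := by
  have key : ∀ {γ : Type} {M : Language γ} {U : Set (Language γ)}, complexity M = n →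
      U ⊆ quotients M → (U = quotients M ↔ U.encard = n) ∧
      (U = quotients M \ {M} ↔ M ∉ U ∧ U.encard + 1 = n) := by
    intro γ M U hM hU
    have hM' : (quotients M).encard = n := hM
    have hfin : (quotients M).Finite := Set.finite_of_encard_eq_coe hM
    refine ⟨⟨fun h => by rw [h, hM'], fun h => ?_⟩, ⟨fun h => ?_, fun ⟨h1, h2⟩ => ?_⟩⟩
    · exact (hfin.subset hU).eq_of_subset_of_encard_le hU (by rw [hM', h])
    · rw [h, Set.encard_sdiff_singleton_add_one (self_mem_quotients M)]
      exact ⟨fun h => h.2 rfl, hM'⟩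
    · have hU' : U ⊆ quotients M \ {M} := fun X hX => ⟨hU hX, fun h => h1 (h ▸ hX)⟩
      refine (hfin.subset hU).eq_of_subset_of_encard_le hU' ?_
      have := Set.encard_sdiff_singleton_add_one (self_mem_quotients M)
      rw [hM', ← h2] at this
      exact (WithTop.add_right_cancel (ENat.natCast_ne_top 1) this).le
  have hc : T.ncard = S.ncard := by rw [Set.ncard, Set.ncard, hTS]
  unfold atomBound
  refine if_congr ?_ rfl (if_congr ?_ rfl (by rw [hc]))
  · rw [(key hK hT).1, (key hL hS).1, hTS]
  · rw [(key hK hT).2, (key hL hS).2, hTS, hmem]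

end Comparison

/-! ### Assembly of the main theorem -/

section Main

variable {m n : ℕ}

theorem JointlyTransitive.complexity_operations {β : Type} {φ ψ : β → Letter} {hm : 5 ≤ m}
    {hn : 5 ≤ n} (h : JointlyTransitive φ ψ hm hn) :
    let K := (dialectDFA φ hm).accepts
    let L := (dialectDFA ψ hn).accepts
    complexity (K ⊓ L) = ((m * n : ℕ) : ℕ∞) ∧ complexity (symmDiff K L) = ((m * n : ℕ) : ℕ∞) ∧
      complexity (K \ L) = ((m * n - (m - 1) : ℕ) : ℕ∞) ∧
      complexity (K ⊔ L) = ((m * n - (m + n - 2) : ℕ) : ℕ∞) := by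
  refine ⟨?_, ?_, ?_, ?_⟩
  · rw [← boolOp_and, h.complexity_boolOp isProper_and, boolBound_and]
  · rw [← boolOp_xor, h.complexity_boolOp isProper_xor, boolBound_xor]
  · rw [← boolOp_sdiff, h.complexity_boolOp isProper_sdiff,
      boolBound_sdiff (by omega) (by omega)]
  · rw [← boolOp_or, h.complexity_boolOp isProper_or, boolBound_or (by omega) (by omega)]

theorem IsRegularTwoSidedIdeal.complexity_operations_le {α : Type} {K L : Language α}
    (hK : IsRegularTwoSidedIdeal K) (hL : IsRegularTwoSidedIdeal L) (hm : 1 ≤ m) (hn : 1 ≤ n)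
    (hKm : complexity K = m) (hLn : complexity L = n) :
    complexity (K ⊓ L) ≤ ((m * n : ℕ) : ℕ∞) ∧ complexity (symmDiff K L) ≤ ((m * n : ℕ) : ℕ∞) ∧
      complexity (K \ L) ≤ ((m * n - (m - 1) : ℕ) : ℕ∞) ∧
      complexity (K ⊔ L) ≤ ((m * n - (m + n - 2) : ℕ) : ℕ∞) := by
  refine ⟨?_, ?_, ?_, ?_⟩
  · rw [← boolOp_and, ← boolBound_and]
    exact complexity_boolOp_le hK hL hKm hLn
  · rw [← boolOp_xor, ← boolBound_xor]
    exact complexity_boolOp_le hK hL hKm hLn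
  · rw [← boolOp_sdiff, ← boolBound_sdiff hm hn]
    exact complexity_boolOp_le hK hL hKm hLn
  · rw [← boolOp_or, ← boolBound_or hm hn]
    exact complexity_boolOp_le hK hL hKm hLn

theorem jointlyTransitive_abdef_swap (hm : 5 ≤ m) (hn : 5 ≤ n) :
    JointlyTransitive (Subtype.val : abdef → Letter)
      (fun x : abdef => Equiv.swap Letter.a Letter.b x.1) hm hn :=
  jointlyTransitive_of_swap (a := ⟨.a, by simp [abdef]⟩) (b := ⟨.b, by simp [abdef]⟩)
    (d := ⟨.d, by simp [abdef]⟩) (e := ⟨.e, by simp [abdef]⟩) (f := ⟨.f, by simp [abdef]⟩)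
    ⟨rfl, rfl⟩ ⟨rfl, rfl⟩ ⟨rfl, rfl⟩ ⟨rfl, rfl⟩ ⟨rfl, rfl⟩

theorem jointlyTransitive_abdef (hm : 5 ≤ m) (hn : 5 ≤ n) (hmn : m ≠ n) :
    JointlyTransitive (Subtype.val : abdef → Letter) Subtype.val hm hn :=
  jointlyTransitive_of_ne (a := ⟨.a, by simp [abdef]⟩) (b := ⟨.b, by simp [abdef]⟩)
    (d := ⟨.d, by simp [abdef]⟩) (e := ⟨.e, by simp [abdef]⟩) (f := ⟨.f, by simp [abdef]⟩)
    rfl rfl rfl rfl rfl hmn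

theorem jointlyTransitive_swap (hm : 5 ≤ m) (hn : 5 ≤ n) :
    JointlyTransitive id (Equiv.swap Letter.a Letter.b) hm hn :=
  jointlyTransitive_of_swap (a := .a) (b := .b) (d := .d) (e := .e) (f := .f)
    ⟨rfl, rfl⟩ ⟨rfl, rfl⟩ ⟨rfl, rfl⟩ ⟨rfl, rfl⟩ ⟨rfl, rfl⟩

theorem isRegularTwoSidedIdeal_witness (hn : 5 ≤ n) : IsRegularTwoSidedIdeal (witness n hn) :=
  isRegularTwoSidedIdeal_dialectDFA (φ := id) (hn := hn) (y := .e) (z := .f) rfl rfl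

theorem complexity_witness (hn : 5 ≤ n) : complexity (witness n hn) = n :=
  complexity_dialectDFA (φ := id) (hn := hn) (x := .a) (y := .e) (z := .f) rfl rfl rfl

theorem isMostComplexStream_witness :
    IsMostComplexStream IsRegularTwoSidedIdeal 5 witness witnessSwap where
  mem n hn := ⟨isRegularTwoSidedIdeal_witness hn, complexity_witness hn⟩
  isDialect := by
    refine ⟨fun x => some (Equiv.swap Letter.a Letter.b x), ⟨fun x y g hx hy => ?_, fun g => ?_⟩,
      fun n hn => rfl⟩
    · exact (Equiv.swap Letter.a Letter.b).injective (Option.some.inj (hx.trans hy.symm))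
    · exact ⟨Equiv.swap Letter.a Letter.b g, congrArg some (Equiv.swap_apply_self _ _ g)⟩
  syntacticSemigroup n hn α _ K hK hKn := by
    rw [witness_eq, syntacticSize_dialectDFA Function.surjective_id]
    exact hK.syntacticSize_le hn hKn
  quotientComplexity n hn α _ K hK hKn := by
    -- Only `⊤` has to be matched with `⊤`: all other quotients of the witness have the largest
    -- possible complexity n.
    obtain ⟨g, hg, hgt⟩ := exists_bijOn_of_encard_eq hKn (complexity_witness hn) hK.top_mem
      (isRegularTwoSidedIdeal_witness hn).top_mem
    refine ⟨g, hg, fun X hX => ?_⟩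
    by_cases h : X = ⊤
    · rw [h, hgt, complexity_top, complexity_top]
    · rw [complexity_of_mem_quotients (φ := id) (hn := hn) (a := .a) (d := .d) (e := .e) (f := .f)
        rfl rfl rfl rfl (hg.mapsTo hX) fun h' => h (hg.injOn hX hK.top_mem (h'.trans hgt.symm)),
        ← hKn]
      exact complexity_quotient_le hX
  atomCount n hn α _ K hK hKn := by
    rw [witness_eq, encard_atoms_dialectDFA (φ := id) (a := .a) (e := .e) (f := .f) rfl rfl rfl]
    exact hK.encard_atoms_le (by omega) hKn
  atomComplexity n hn α _ K hK hKn S hS hAS T hT hAT hTS hmem := by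
    refine (hK.complexity_atomOf_le (by omega) hKn hT hAT).trans ?_
    rw [atomBound_congr hKn (complexity_witness hn) hT hS hTS hmem]
    exact (complexity_atomOf_dialectDFA (hn := hn) Function.surjective_id hS hAS).ge
  reverse n hn α _ K hK hKn := by
    rw [← encard_atoms, ← encard_atoms, witness_eq,
      encard_atoms_dialectDFA (φ := id) (a := .a) (e := .e) (f := .f) rfl rfl rfl]
    exact hK.encard_atoms_le (by omega) hKn
  star n hn α _ K hK hKn := by
    rw [witness_eq, complexity_kstar_dialectDFA (φ := id) (a := .a) (e := .e) (f := .f) rfl rfl rfl]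
    exact hK.complexity_kstar_le hKn
  product m hm n hn α _ K L hK hKm hL hLn := by
    rw [witness_eq, witness_eq,
      complexity_mul_dialectDFA (φ := id) (a := .a) (e := .e) (f := .f) rfl rfl rfl]
    exact hK.complexity_mul_le hL (by omega) hKm hLn
  boolean f hf m hm n hn α _ K L hK hKm hL hLn := by
    rw [witness_eq, witnessSwap_eq, (jointlyTransitive_swap hm hn).complexity_boolOp hf]
    exact complexity_boolOp_le hK hL hKm hLn

end Main

end MostComplex

theorem mainTheorem2 :
    -- the DFA is minimal and its language is a two-sided ideal of complexity `n`
    (∀ (n : ℕ) (hn : 5 ≤ n), IsMinimalDFA (witnessDFA n hn) ∧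
      IsRegularTwoSidedIdeal (witness n hn) ∧ complexity (witness n hn) = n) ∧
    -- the stream with its dialect stream is most complex
    IsMostComplexStream IsRegularTwoSidedIdeal 5 witness witnessSwap ∧
    -- the languages over restricted alphabets are two-sided ideals of complexity `n` as well
    (∀ (n : ℕ) (hn : 5 ≤ n),
      (IsRegularTwoSidedIdeal (witnessOn adef n hn) ∧ complexity (witnessOn adef n hn) = n) ∧
      (IsRegularTwoSidedIdeal (witnessOn aef n hn) ∧ complexity (witnessOn aef n hn) = n) ∧
      (IsRegularTwoSidedIdeal (witnessOn abdef n hn) ∧ complexity (witnessOn abdef n hn) = n) ∧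
      (IsRegularTwoSidedIdeal (witnessSwapOn abdef n hn) ∧
        complexity (witnessSwapOn abdef n hn) = n)) ∧
    -- the values of the measures with one argument
    (∀ (n : ℕ) (hn : 5 ≤ n),
      syntacticSize (witness n hn) = semigroupBound n ∧
      (∀ K ∈ quotients (witnessOn adef n hn), K ≠ ⊤ → complexity K = n) ∧
      (⊤ ∈ quotients (witnessOn adef n hn) ∧ complexity (⊤ : Language adef) = 1) ∧
      (atoms (witnessOn adef n hn)).encard = ((2 ^ (n - 2) + 1 : ℕ) : ℕ∞) ∧
      (∀ S ⊆ quotients (witness n hn), atomOf (witness n hn) S ∈ atoms (witness n hn) →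
        complexity (atomOf (witness n hn) S) = atomBound n (witness n hn) S) ∧
      complexity (witnessOn adef n hn).reverse = ((2 ^ (n - 2) + 1 : ℕ) : ℕ∞) ∧
      complexity (KStar.kstar (witnessOn aef n hn)) = ((n + 1 : ℕ) : ℕ∞)) ∧
    -- the values of the binary operations
    (∀ (m : ℕ) (hm : 5 ≤ m) (n : ℕ) (hn : 5 ≤ n),
      complexity (witnessOn aef m hm * witnessOn aef n hn) = ((m + n - 1 : ℕ) : ℕ∞) ∧
      complexity (witnessOn abdef m hm ⊓ witnessSwapOn abdef n hn) = ((m * n : ℕ) : ℕ∞) ∧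
      complexity (symmDiff (witnessOn abdef m hm) (witnessSwapOn abdef n hn)) =
        ((m * n : ℕ) : ℕ∞) ∧
      complexity (witnessOn abdef m hm \ witnessSwapOn abdef n hn) =
        ((m * n - (m - 1) : ℕ) : ℕ∞) ∧
      complexity (witnessOn abdef m hm ⊔ witnessSwapOn abdef n hn) =
        ((m * n - (m + n - 2) : ℕ) : ℕ∞) ∧
      (m ≠ n →
        complexity (witnessOn abdef m hm ⊓ witnessOn abdef n hn) = ((m * n : ℕ) : ℕ∞) ∧
        complexity (symmDiff (witnessOn abdef m hm) (witnessOn abdef n hn)) =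
          ((m * n : ℕ) : ℕ∞) ∧
        complexity (witnessOn abdef m hm \ witnessOn abdef n hn) =
          ((m * n - (m - 1) : ℕ) : ℕ∞) ∧
        complexity (witnessOn abdef m hm ⊔ witnessOn abdef n hn) =
          ((m * n - (m + n - 2) : ℕ) : ℕ∞))) ∧
    -- these values are upper bounds for all regular two-sided ideals of complexity `n`
    (∀ n : ℕ, 5 ≤ n → ∀ (α : Type) [Finite α] (L : Language α),
      IsRegularTwoSidedIdeal L → complexity L = n →
        syntacticSize L ≤ semigroupBound n ∧
        (Nat.card α < 6 → syntacticSize L < semigroupBound n) ∧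
        (∀ K ∈ quotients L, complexity K ≤ n) ∧
        (⊤ ∈ quotients L ∧ complexity (⊤ : Language α) = 1) ∧
        (atoms L).encard ≤ ((2 ^ (n - 2) + 1 : ℕ) : ℕ∞) ∧
        (∀ S ⊆ quotients L, atomOf L S ∈ atoms L →
          complexity (atomOf L S) ≤ atomBound n L S) ∧
        complexity L.reverse ≤ ((2 ^ (n - 2) + 1 : ℕ) : ℕ∞) ∧
        complexity (KStar.kstar L) ≤ ((n + 1 : ℕ) : ℕ∞)) ∧
    (∀ m : ℕ, 5 ≤ m → ∀ n : ℕ, 5 ≤ n → ∀ (α : Type) [Finite α] (K L : Language α),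
      IsRegularTwoSidedIdeal K → complexity K = m →
      IsRegularTwoSidedIdeal L → complexity L = n →
        complexity (K * L) ≤ ((m + n - 1 : ℕ) : ℕ∞) ∧
        complexity (K ⊓ L) ≤ ((m * n : ℕ) : ℕ∞) ∧
        complexity (symmDiff K L) ≤ ((m * n : ℕ) : ℕ∞) ∧
        complexity (K \ L) ≤ ((m * n - (m - 1) : ℕ) : ℕ∞) ∧
        complexity (K ⊔ L) ≤ ((m * n - (m + n - 2) : ℕ) : ℕ∞)) ∧
    -- every proper boolean operation has maximal complexity, also over five letters, and for
    -- `m ≠ n` without the dialect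
    (∀ f, IsProper f → ∀ (m : ℕ) (hm : 5 ≤ m) (n : ℕ) (hn : 5 ≤ n) (α : Type) [Finite α] (K L : Language α),
      IsRegularTwoSidedIdeal K → complexity K = m →
      IsRegularTwoSidedIdeal L → complexity L = n →
        complexity (boolOp f K L) ≤
          complexity (boolOp f (witnessOn abdef m hm) (witnessSwapOn abdef n hn)) ∧
        (m ≠ n → complexity (boolOp f K L) ≤
          complexity (boolOp f (witnessOn abdef m hm) (witnessOn abdef n hn)))) := by
  refine ⟨fun n hn => ⟨isMinimalDFA_dialectDFA (φ := id) (hn := hn) (x := .a) (y := .e) (z := .f) rfl rfl rfl,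
      isMostComplexStream_witness.mem n hn⟩, isMostComplexStream_witness, fun n hn => ?_,
    fun n hn => ?_, fun m hm n hn => ?_, fun n hn α _ L hL hLn => ?_,
    fun m hm n hn α _ K L hK hKm hL hLn => ?_, fun f hf m hm n hn α _ K L hK hKm hL hLn => ?_⟩
  · rw [witnessOn_eq, witnessOn_eq, witnessOn_eq, witnessSwapOn_eq]
    have ideal : ∀ {Γ : Set Letter} {φ : Γ → Letter} {a e f : Γ}, φ a = .a → φ e = .e →
        φ f = .f → IsRegularTwoSidedIdeal (dialectDFA φ hn).accepts ∧
          complexity (dialectDFA φ hn).accepts = n := fun ha he hf =>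
      ⟨isRegularTwoSidedIdeal_dialectDFA he hf, complexity_dialectDFA ha he hf⟩
    exact ⟨ideal (a := ⟨.a, by simp [adef]⟩) (e := ⟨.e, by simp [adef]⟩) (f := ⟨.f, by simp [adef]⟩)
        rfl rfl rfl,
      ideal (a := ⟨.a, by simp [aef]⟩) (e := ⟨.e, by simp [aef]⟩) (f := ⟨.f, by simp [aef]⟩)
        rfl rfl rfl,
      ideal (a := ⟨.a, by simp [abdef]⟩) (e := ⟨.e, by simp [abdef]⟩) (f := ⟨.f, by simp [abdef]⟩)
        rfl rfl rfl,
      ideal (a := ⟨.b, by simp [abdef]⟩) (e := ⟨.e, by simp [abdef]⟩) (f := ⟨.f, by simp [abdef]⟩)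
        rfl rfl rfl⟩
  · have hatoms : (atoms (witnessOn adef n hn)).encard = ((2 ^ (n - 2) + 1 : ℕ) : ℕ∞) := by
      rw [witnessOn_eq]
      exact encard_atoms_dialectDFA (a := ⟨.a, by simp [adef]⟩) (e := ⟨.e, by simp [adef]⟩)
        (f := ⟨.f, by simp [adef]⟩) rfl rfl rfl
    refine ⟨syntacticSize_dialectDFA (hn := hn) Function.surjective_id, ?_, ⟨?_, complexity_top⟩, hatoms,
      fun S hS hA => complexity_atomOf_dialectDFA (hn := hn) Function.surjective_id hS hA,
      (encard_atoms _).symm.trans hatoms, ?_⟩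
    · rw [witnessOn_eq]
      exact fun K hK hne => complexity_of_mem_quotients (a := ⟨.a, by simp [adef]⟩)
        (d := ⟨.d, by simp [adef]⟩) (e := ⟨.e, by simp [adef]⟩) (f := ⟨.f, by simp [adef]⟩)
        rfl rfl rfl rfl hK hne
    · rw [witnessOn_eq]
      exact (isRegularTwoSidedIdeal_dialectDFA (y := ⟨.e, by simp [adef]⟩)
        (z := ⟨.f, by simp [adef]⟩) rfl rfl).top_mem
    · rw [witnessOn_eq]
      exact complexity_kstar_dialectDFA (a := ⟨.a, by simp [aef]⟩) (e := ⟨.e, by simp [aef]⟩)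
        (f := ⟨.f, by simp [aef]⟩) rfl rfl rfl
  · simp only [witnessOn_eq, witnessSwapOn_eq]
    obtain ⟨h1, h2, h3, h4⟩ := (jointlyTransitive_abdef_swap hm hn).complexity_operations
    exact ⟨complexity_mul_dialectDFA (a := ⟨.a, by simp [aef]⟩) (e := ⟨.e, by simp [aef]⟩)
        (f := ⟨.f, by simp [aef]⟩) rfl rfl rfl, h1, h2, h3, h4,
      fun hmn => (jointlyTransitive_abdef hm hn hmn).complexity_operations⟩
  · refine ⟨hL.syntacticSize_le hn hLn, hL.syntacticSize_lt hn hLn,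
      fun K hK => hLn ▸ complexity_quotient_le hK, ⟨hL.top_mem, complexity_top⟩,
      hL.encard_atoms_le (by omega) hLn,
      fun S hS hA => hL.complexity_atomOf_le (by omega) hLn hS hA, ?_, hL.complexity_kstar_le hLn⟩
    rw [← encard_atoms]
    exact hL.encard_atoms_le (by omega) hLn
  · exact ⟨hK.complexity_mul_le hL (by omega) hKm hLn,
      hK.complexity_operations_le hL (by omega) (by omega) hKm hLn⟩
  · rw [witnessOn_eq, witnessOn_eq, witnessSwapOn_eq,
      (jointlyTransitive_abdef_swap hm hn).complexity_boolOp hf]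
    refine ⟨complexity_boolOp_le hK hL hKm hLn, fun hmn => ?_⟩
    rw [(jointlyTransitive_abdef hm hn hmn).complexity_boolOp hf]
    exact complexity_boolOp_le hK hL hKm hLn
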